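/- Let $H$ be a separable, infinite-dimensional complex Hilbert space with a fixed orthonormal basis $\{\xi_k\}_{k\in\mathbb N}$, let $\mathcal B(H)$ be the algebra of bounded operators on $H$, let $\mathcal K(H)$ be the ideal of compact operators, and let $q:\mathcal B(H)\to\mathcal Q(H)=\mathcal B(H)/\mathcal K(H)$ be the quotient map onto the Calkin algebra. An endomorphism is a $*$-homomorphism from an algebra to itself, not necessarily unital, and for a unitary $v\in\mathcal Q(H)$ put $\mathrm{Ad}(v)(a)=vav^*$. The strong topology on $\mathcal B(H)$ is that of pointwise norm convergence on $H$; strongly continuous means strong-strong continuous. For a $\mathrm C^*$-algebra $\mathcal A\subseteq\mathcal B(H)$ let $\mathcal A_{\mathcal Q}=\mathcal A/(\mathcal A\cap\mathcal K(H))$, identified with $q[\mathcal A]\subseteq\mathcal Q(H)$. A $*$-homomorphism $\phi:\mathcal A_{\mathcal Q}\to\mathcal Q(H)$ is \emph{trivial} if there are a unitary $v\in\mathcal Q(H)$ and a strongly continuous $*$-homomorphism $\Phi:\mathcal A\to\mathcal B(H)$ such that $q(\Phi(a))=v\,\phi(q(a))\,v^*$ for all $a\in\mathcal A$. In particular (case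 $\mathcal A=\mathcal B(H)$), an endomorphism $\phi$ of $\mathcal Q(H)$ is trivial if there are a unitary $v\in\mathcal Q(H)$ and a strongly continuous endomorphism $\Phi$ of $\mathcal B(H)$ with $q\circ\Phi=\mathrm{Ad}(v)\circ\phi\circ q$. For a partition $\vec E=\{E_n\}_{n\in\mathbb N}$ of $\mathbb N$ into consecutive finite nonempty intervals, let $\mathcal D[\vec E]$ be the von Neumann algebra of all operators in $\mathcal B(H)$ that commute with the orthogonal projection onto $\mathrm{span}\{\xi_k:k\in E_n\}$ for every $n$. An endomorphism $\phi$ of $\mathcal Q(H)$ is \emph{locally trivial} if the restriction of $\phi$ to $\mathcal D[\vec E]_{\mathcal Q}$ is trivial for every such partition $\vec E$. The Open Coloring Axiom (OCA) is the following statement: let $X$ be a separable metric space and let $[X]^2=K_0\sqcup K_1$ be a partition of the set of unordered pairs of distinct elements of $X$ such that $K_0$, identified with a symmetric subset of $X\times X$, is open; then either there is an uncountable $Y\subseteq X$ with $[Y]^2\subseteq K_0$, or $X=\bigcup_{n\in\mathbb N}Y_n$ for some sets $Y_n$ with $[Y_n]^2\subseteq K_1$. \textbf{Theorem.} Assume OCA.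 Every unital, locally trivial endomorphism $\phi:\mathcal Q(H)\to\mathcal Q(H)$ is trivial. -/

import Mathlib

open scoped InnerProductSpace

/-! ### The Open Coloring Axiom -/

/-- `Y` is `K`-homogeneous: every unordered pair of distinct elements of `Y` lies in `K`. -/
def IsHomogeneous {X : Type*} (K : Set (Sym2 X)) (Y : Set X) : Prop :=
  ∀ x ∈ Y, ∀ y ∈ Y, x ≠ y → s(x, y) ∈ K

/-- `K₀` and `K₁` form an open coloring of `X`: they partition the unordered pairs of distinct
points of `X`, and `K₀`, viewed as a symmetric subset of `X × X`, is open. -/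
structure IsOpenColoring {X : Type*} [TopologicalSpace X] (K₀ K₁ : Set (Sym2 X)) : Prop where
  union_eq : K₀ ∪ K₁ = {z | ¬ z.IsDiag}
  disjoint : Disjoint K₀ K₁
  isOpen : IsOpen {p : X × X | s(p.1, p.2) ∈ K₀}

/-- The Open Coloring Axiom. (A separable metric space has at most continuum many points, so
that quantifying over the lowest universe is no restriction.) -/
def OCA : Prop :=
  ∀ (X : Type) [MetricSpace X] [TopologicalSpace.SeparableSpace X] (K₀ K₁ : Set (Sym2 X)),
    IsOpenColoring K₀ K₁ →
      (∃ Y : Set X, ¬ Y.Countable ∧ IsHomogeneous K₀ Y) ∨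
      (∃ Y : ℕ → Set X, (∀ n, IsHomogeneous K₁ (Y n)) ∧ ⋃ n, Y n = Set.univ)

/-! ### The Calkin algebra -/

noncomputable section Calkin

variable (H : Type*) [NormedAddCommGroup H] [InnerProductSpace ℂ H]

/-- The ideal of compact operators in the algebra of bounded operators on `H`. -/
def compactIdeal : Ideal (H →L[ℂ] H) where
  carrier := {T | IsCompactOperator T}
  add_mem' := fun hS hT => hS.add hT
  zero_mem' := isCompactOperator_zero
  smul_mem' := fun S _ hT => hT.clm_comp S

instance compactIdeal_isTwoSided : (compactIdeal H).IsTwoSided where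
  mul_mem_of_left := fun S hT => IsCompactOperator.comp_clm hT S

/-- The Calkin algebra of `H`. -/
abbrev Calkin : Type _ := (H →L[ℂ] H) ⧸ compactIdeal H

variable {H} [CompleteSpace H]

/-- The adjoint of a compact operator is compact. -/
theorem star_mem_compactIdeal {T : H →L[ℂ] H} (hT : T ∈ compactIdeal H) :
    star T ∈ compactIdeal H := by
  have hS : IsCompactOperator ⇑(T * star T) := IsCompactOperator.comp_clm hT (star T)
  change IsCompactOperator ⇑(star T)
  have hball : TotallyBounded (⇑(T * star T) '' Metric.closedBall 0 1) :=
    TotallyBounded.subset subset_closure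
      (hS.isCompact_closure_image_closedBall (f := (T * star T).toLinearMap) 1).totallyBounded
  have key : TotallyBounded (⇑(star T) '' Metric.closedBall 0 1) := by
    rw [Metric.totallyBounded_iff]
    intro ε hε
    obtain ⟨t, hts, htf, htc⟩ :=
      Metric.finite_approx_of_totallyBounded hball (ε ^ 2 / 4) (by positivity)
    have hts' : ∀ y, y ∈ t → ∃ x, x ∈ Metric.closedBall 0 1 ∧ (T * star T) x = y :=
      fun y hy => hts hy
    choose! g hg using hts'
    refine ⟨(fun y => star T (g y)) '' t, htf.image _, ?_⟩
    rintro _ ⟨x, hx, rfl⟩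
    have hx' := htc ⟨x, hx, rfl⟩
    simp only [Set.mem_iUnion] at hx'
    obtain ⟨y, hy, hxy⟩ := hx'
    simp only [Set.mem_iUnion]
    refine ⟨_, ⟨y, hy, rfl⟩, ?_⟩
    obtain ⟨hgb, hgy⟩ := hg y hy
    rw [Metric.mem_ball, dist_eq_norm, ← hgy, ← map_sub] at hxy
    rw [Metric.mem_ball, dist_eq_norm, ← map_sub]
    set z := x - g y
    have hz : ‖z‖ ≤ 2 := by
      have h1 : ‖x‖ ≤ 1 := by simpa using hx
      have h2 : ‖g y‖ ≤ 1 := by simpa using hgb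
      exact (norm_sub_le _ _).trans (by linarith)
    have h3 : ‖star T z‖ ^ 2 ≤ ‖z‖ * ‖(T * star T) z‖ := by
      have h4 : ⟪star T z, star T z⟫_ℂ = ⟪z, (T * star T) z⟫_ℂ := by
        rw [ContinuousLinearMap.star_eq_adjoint, ContinuousLinearMap.adjoint_inner_left]
        rfl
      have h5 : ‖star T z‖ ^ 2 = ‖⟪z, (T * star T) z⟫_ℂ‖ := by
        rw [← h4, inner_self_eq_norm_sq_to_K]
        simp
      rw [h5]
      exact norm_inner_le_norm _ _
    have h6 : ‖star T z‖ ^ 2 < ε ^ 2 := by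
      nlinarith [norm_nonneg z, norm_nonneg ((T * star T) z)]
    exact lt_of_pow_lt_pow_left₀ 2 hε.le h6
  exact (isCompactOperator_iff_isCompact_closure_image_closedBall
    (star T).toLinearMap one_pos).2 (key.closure.isCompact_of_isClosed isClosed_closure)

/-- The involution of the Calkin algebra, `star (q T) = q (star T)`. -/
instance : StarRing (Calkin H) where
  star := Quotient.map' star fun S T h => by
    have h' := (Submodule.quotientRel_def _).1 h
    refine (Submodule.quotientRel_def _).2 ?_
    rw [← star_sub]
    exact star_mem_compactIdeal h'
  star_involutive := by
    rintro ⟨S⟩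
    exact congrArg (Ideal.Quotient.mk (compactIdeal H)) (star_star S)
  star_mul := by
    rintro ⟨S⟩ ⟨T⟩
    exact congrArg (Ideal.Quotient.mk (compactIdeal H)) (star_mul S T)
  star_add := by
    rintro ⟨S⟩ ⟨T⟩
    exact congrArg (Ideal.Quotient.mk (compactIdeal H)) (star_add S T)

instance : StarModule ℂ (Calkin H) where
  star_smul := by
    rintro c ⟨S⟩
    exact congrArg (Ideal.Quotient.mk (compactIdeal H)) (star_smul c S)

variable (H) in
/-- The quotient map from the bounded operators onto the Calkin algebra. -/
def Calkin.q : (H →L[ℂ] H) →⋆ₐ[ℂ] Calkin H where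
  __ := Ideal.Quotient.mkₐ ℂ (compactIdeal H)
  map_star' := fun _ => rfl

/-! ### Trivial endomorphisms -/

variable (H) in
/-- The strong operator topology on the bounded operators on `H`, i.e. the topology of pointwise
norm convergence. -/
abbrev strongTopology : TopologicalSpace (H →L[ℂ] H) :=
  TopologicalSpace.induced (ContinuousLinearMap.toPointwiseConvergenceCLM ℂ (RingHom.id ℂ) H H)
    inferInstance

/-- Strong-strong continuity of a map from the bounded operators to themselves. -/
def StronglyContinuous (Φ : (H →L[ℂ] H) → (H →L[ℂ] H)) : Prop :=
  @Continuous _ _ (strongTopology H) (strongTopology H) Φ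

/-- Strong-strong continuity of a map from an algebra of bounded operators to the bounded
operators. -/
def StronglyContinuousOn (A : StarSubalgebra ℂ (H →L[ℂ] H)) (Φ : A → (H →L[ℂ] H)) : Prop :=
  @Continuous _ _ ((strongTopology H).induced Subtype.val) (strongTopology H) Φ

/-- The algebra `A / (A ∩ K(H))`, realized as the image of `A` in the Calkin algebra. -/
def calkinImage (A : StarSubalgebra ℂ (H →L[ℂ] H)) : StarSubalgebra ℂ (Calkin H) :=
  A.map (Calkin.q H)

/-- The quotient map from `A` to `A / (A ∩ K(H))`. -/
def calkinMk (A : StarSubalgebra ℂ (H →L[ℂ] H)) (a : A) : calkinImage A :=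
  ⟨Calkin.q H a, a, a.2, rfl⟩

/-- A `*`-homomorphism `φ : A / (A ∩ K(H)) → Q(H)` is trivial if `Ad(v) ∘ φ` lifts to a strongly
continuous `*`-homomorphism `A → B(H)`, for some unitary `v` of the Calkin algebra.
No map is required to be unital. -/
def IsTrivialOn (A : StarSubalgebra ℂ (H →L[ℂ] H)) (φ : calkinImage A →⋆ₙₐ[ℂ] Calkin H) : Prop :=
  ∃ v ∈ unitary (Calkin H), ∃ Φ : A →⋆ₙₐ[ℂ] (H →L[ℂ] H),
    StronglyContinuousOn A Φ ∧ ∀ a : A, Calkin.q H (Φ a) = v * φ (calkinMk A a) * star v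

/-- An endomorphism `φ` of the Calkin algebra is trivial if `Ad(v) ∘ φ` lifts to a strongly
continuous endomorphism of `B(H)`, for some unitary `v` of the Calkin algebra. -/
def IsTrivialEnd (φ : Calkin H →⋆ₙₐ[ℂ] Calkin H) : Prop :=
  ∃ v ∈ unitary (Calkin H), ∃ Φ : (H →L[ℂ] H) →⋆ₙₐ[ℂ] (H →L[ℂ] H),
    StronglyContinuous Φ ∧ ∀ T : H →L[ℂ] H, Calkin.q H (Φ T) = v * φ (Calkin.q H T) * star v

/-- The restriction of `φ` to a `*`-subalgebra of the Calkin algebra. -/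
def restrictEnd (φ : Calkin H →⋆ₙₐ[ℂ] Calkin H) (B : StarSubalgebra ℂ (Calkin H)) :
    B →⋆ₙₐ[ℂ] Calkin H :=
  φ.comp (B.subtype : B →⋆ₙₐ[ℂ] Calkin H)

/-! ### Locally trivial endomorphisms -/

/-- A partition of `ℕ` into consecutive, nonempty, finite intervals
`E_n = [endpoint n, endpoint (n + 1))`. -/
structure IntervalPartition where
  endpoint : ℕ → ℕ
  endpoint_zero : endpoint 0 = 0
  strictMono : StrictMono endpoint

/-- The `n`-th interval of the partition. -/
def IntervalPartition.block (E : IntervalPartition) (n : ℕ) : Set ℕ :=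
  Set.Ico (E.endpoint n) (E.endpoint (n + 1))

/-- The orthogonal projection `P_M` onto the closed span of `{ξ_k : k ∈ M}`. -/
def basisProj (ξ : HilbertBasis ℕ ℂ H) (M : Set ℕ) : H →L[ℂ] H :=
  (Submodule.span ℂ (ξ '' M)).topologicalClosure.starProjection

/-- The von Neumann algebra `D[E]` of all operators commuting with `P_{E_n}` for all `n`;
equivalently, of all operators leaving every `span {ξ_k : k ∈ E_n}` invariant. -/
def blockAlgebra (ξ : HilbertBasis ℕ ℂ H) (E : IntervalPartition) :
    StarSubalgebra ℂ (H →L[ℂ] H) :=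
  StarSubalgebra.centralizer ℂ (Set.range fun n => basisProj ξ (E.block n))

/-- An endomorphism of the Calkin algebra is locally trivial (with respect to the basis `ξ`) if
its restriction to the image of `D[E]` is trivial for every partition `E`. -/
def IsLocallyTrivial (ξ : HilbertBasis ℕ ℂ H) (φ : Calkin H →⋆ₙₐ[ℂ] Calkin H) : Prop :=
  ∀ E : IntervalPartition,
    IsTrivialOn (blockAlgebra ξ E) (restrictEnd φ (calkinImage (blockAlgebra ξ E)))

end Calkin

/-! ### Eventual domination under the Open Coloring Axiom -/

/-! The endomorphism turns out to be, up to a unitary of the Calkin algebra, an amplification T ↦ T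
⊗ 1 on m copies of H, with m finite and positive. The proof finds m, writes φ in this form on every
D[E] with a unitary depending on E, and then uses OCA to choose one unitary for all E.

Local form. A strongly continuous lift Φ on D[E] sends each basis projection to a compact
projection, hence to one of finite rank. Matrix units make this rank constant on the intervals of E,
and a gliding hump shows that lifts for different partitions eventually have the same ranks.
Partitions pairing consecutive indices then force one eventual value m, positive because φ is unital
(`exists_multiplicity`). Transporting bases of the ranges by matrix units intertwines Φ with the
amplification modulo compacts (`exists_intertwiner`, `exists_local_ampl`).

Reduction to matrices. All D[E] contain the diagonal operators, so any two of the local unitaries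
differ by a unitary commuting with the amplified diagonals. An operator essentially commuting with
all diagonal operators is diagonal modulo compacts (`sub_diagOp_mem_compactIdeal`). Hence, relative
to one fixed unitary, the local form on D[E] is given by a sequence α_E of m × m unitary matrices
(`exists_local_matOp`). Only the increments α_E(i)⁻¹ α_E(j) with i, j in one interval matter on
D[E]. Since both sequences implement φ on the common part of D[E] and D[F], testing on permutation
operators shows that their increments agree asymptotically on common intervals
(`isBlockCoherent_of_conj`).

Uniformization. OCA gives one sequence b in the compact group U(m) whose increments asymptotically
match those of every α_E (`IsBlockCoherent.exists_uniformization`). Partitions are first replaced by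
functions f, which bound the pairs i ≤ j ≤ f(i) to be compared. OCA is used twice: to dominate
uncountably many functions by one (`OCA.exists_dominating`), and to cover the space of pairs (f,
a_f) by countably many ε-coherent pieces, one of which is cofinal (`IsCoherent.exists_cofinal`).
Limits along an ultrafilter and a diagonal argument over ε finish this step.

Globalization. The block diagonal unitary built from b implements φ on each D[E]
(`q_conj_eq_of_discr`), and every operator is, modulo compacts, a sum of two block diagonal ones
(`exists_add_mem_blockAlgebra`). -/

open Filter in
theorem exists_monotone_eventuallyLE {S : Set (ℕ → ℕ)} (hS : S.Countable) :
    ∃ h : ℕ → ℕ, Monotone h ∧ ∀ f ∈ S, f ≤ᶠ[atTop] h := by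
  rcases S.eq_empty_or_nonempty with rfl | hne
  · exact ⟨0, monotone_const, by simp⟩
  obtain ⟨s, rfl⟩ := hS.exists_eq_range hne
  -- The double sum contains the term s k n once n ≥ k; summing also over i ≤ n makes it monotone.
  refine ⟨fun n => ∑ k ∈ Finset.range (n + 1), ∑ i ∈ Finset.range (n + 1), s k i, ?_, ?_⟩
  · intro a b hab
    have : Finset.range (a + 1) ⊆ Finset.range (b + 1) := Finset.range_mono (by omega)
    exact (Finset.sum_le_sum fun k _ => Finset.sum_le_sum_of_subset this).trans
      (Finset.sum_le_sum_of_subset this)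
  · rintro _ ⟨k, rfl⟩
    filter_upwards [eventually_ge_atTop k] with n hn
    calc s k n ≤ ∑ i ∈ Finset.range (n + 1), s k i :=
          Finset.single_le_sum (f := fun i => s k i) (by simp) (by simp)
      _ ≤ _ := Finset.single_le_sum (f := fun k => ∑ i ∈ Finset.range (n + 1), s k i)
          (by simp) (by simp; omega)

/-- An uncountable type contains a copy of `ω₁`. -/
theorem exists_uncountable_wellOrder (ι : Type*) [Uncountable ι] :
    ∃ (_ : LinearOrder ι) (_ : WellFoundedLT ι) (I : Set ι), ¬ I.Countable ∧
      ∀ y ∈ I, {x ∈ I | x < y}.Countable := by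
  obtain ⟨hl, hw⟩ := exists_wellFoundedLT ι
  refine ⟨hl, hw, ?_⟩
  by_cases h : ∀ y : ι, (Set.Iio y).Countable
  · exact ⟨Set.univ, Set.not_countable_univ, fun y _ => (h y).mono fun x hx => hx.2⟩
  · push Not at h
    -- The least y with uncountably many predecessors: its initial segment is a copy of ω₁.
    obtain ⟨y, hy, hmin⟩ := WellFounded.has_min (wellFounded_lt (α := ι))
      {y | ¬ (Set.Iio y).Countable} h
    refine ⟨Set.Iio y, hy, fun z hz => ?_⟩
    have := hmin z
    by_contra hc
    refine this (fun hc' => hc (hc'.mono fun x hx => hx.2)) hz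

open Filter in
/-- Every family of functions indexed by an uncountable set can be replaced, after passing to an
uncountable subfamily, by a dominating chain of length `ω₁` of monotone functions. -/
theorem exists_dominating_chain {ι : Type*} [Uncountable ι] (f : ι → ℕ → ℕ) :
    ∃ (_ : LinearOrder ι) (I : Set ι) (g : ι → ℕ → ℕ), ¬ I.Countable ∧
      (∀ y ∈ I, {x ∈ I | x < y}.Countable) ∧ (∀ i, Monotone (g i)) ∧
      (∀ i ∈ I, f i ≤ᶠ[atTop] g i) ∧ ∀ i ∈ I, ∀ j ∈ I, i < j → g i ≤ᶠ[atTop] g j := by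
  classical
  obtain ⟨hl, hw, I, hI, hc⟩ := exists_uncountable_wellOrder ι
  have hB : ∀ S : Set (ℕ → ℕ), ∃ h : ℕ → ℕ, Monotone h ∧ (S.Countable → ∀ f ∈ S, f ≤ᶠ[atTop] h) := by
    intro S
    by_cases hS : S.Countable
    · obtain ⟨h, h1, h2⟩ := exists_monotone_eventuallyLE hS
      exact ⟨h, h1, fun _ => h2⟩
    · exact ⟨0, monotone_const, fun h => absurd h hS⟩
  choose B hB1 hB2 using hB
  -- Transfinite recursion: g y bounds f y together with all earlier g x, x ∈ I. There are only
  -- countably many of these when y ∈ I; elsewhere `B` may take its default value 0.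
  let F : (y : ι) → ((x : ι) → x < y → ℕ → ℕ) → ℕ → ℕ := fun y ih =>
    B (insert (f y) (Set.range fun x : {x // x ∈ I ∧ x < y} => ih x.1 x.2.2))
  let g : ι → ℕ → ℕ := (wellFounded_lt (α := ι)).fix F
  have hg : ∀ y, g y = B (insert (f y) (Set.range fun x : {x // x ∈ I ∧ x < y} => g x.1)) :=
    fun y => (wellFounded_lt (α := ι)).fix_eq F y
  have hcount : ∀ y ∈ I,
      (insert (f y) (Set.range fun x : {x // x ∈ I ∧ x < y} => g x.1)).Countable := by
    intro y hy
    have : Countable {x // x ∈ I ∧ x < y} := (hc y hy).to_subtype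
    exact (Set.countable_range _).insert _
  refine ⟨hl, I, g, hI, hc, fun i => ?_, fun i hi => ?_, fun i hi j hj hij => ?_⟩
  · rw [hg]; exact hB1 _
  · rw [hg i]; exact hB2 _ (hcount i hi) _ (Set.mem_insert _ _)
  · rw [hg j]; exact hB2 _ (hcount j hj) _ (Set.mem_insert_of_mem _ ⟨⟨i, hi, hij⟩, rfl⟩)

/-- An uncountable set split into countably many pieces has an uncountable piece. -/
theorem exists_not_countable_fiber {α β : Type*} [Countable β] {Z : Set α} (hZ : ¬ Z.Countable)
    (c : α → β) : ∃ b, ¬ {z ∈ Z | c z = b}.Countable := by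
  by_contra! h
  refine hZ ((Set.countable_iUnion h).mono fun z hz => ?_)
  simp [hz]

open Filter in
/-- In a chain of length `ω₁` of monotone functions, which is unbounded modulo finite, every
uncountable set contains two functions which are comparable everywhere. -/
theorem exists_le_of_unbounded_chain {ι : Type*} [LinearOrder ι] {I : Set ι} {g : ι → ℕ → ℕ}
    (hc : ∀ y ∈ I, {x ∈ I | x < y}.Countable) (hmono : ∀ i, Monotone (g i))
    (hchain : ∀ i ∈ I, ∀ j ∈ I, i < j → g i ≤ᶠ[atTop] g j)
    (hunb : ∀ h : ℕ → ℕ, {i ∈ I | g i ≤ᶠ[atTop] h}.Countable)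
    {Z : Set ι} (hZI : Z ⊆ I) (hZ : ¬ Z.Countable) :
    ∃ i ∈ Z, ∃ j ∈ Z, g i ≤ g j ∧ g i ≠ g j := by
  classical
  -- a countable subset of `Z`, dense for the topology of pointwise convergence
  obtain ⟨D, hDZ, hD, hdense⟩ : ∃ D ⊆ Z, D.Countable ∧
      ∀ z ∈ Z, ∀ n : ℕ, ∃ d ∈ D, ∀ k < n, g d k = g z k := by
    have : ∀ t : List ℕ, ∃ D ⊆ Z, D.Countable ∧
        ∀ z ∈ Z, (List.range t.length).map (g z) = t →
          ∃ d ∈ D, (List.range t.length).map (g d) = t := by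
      intro t
      by_cases h : ∃ z ∈ Z, (List.range t.length).map (g z) = t
      · obtain ⟨z, hz, hzt⟩ := h
        exact ⟨{z}, by simpa, Set.countable_singleton z, fun _ _ _ => ⟨z, rfl, hzt⟩⟩
      · exact ⟨∅, by simp, Set.countable_empty, fun z hz hzt => absurd ⟨z, hz, hzt⟩ h⟩
    choose D h1 h2 h3 using this
    refine ⟨⋃ t, D t, Set.iUnion_subset h1, Set.countable_iUnion h2, fun z hz n => ?_⟩
    obtain ⟨d, hd, hdt⟩ := h3 ((List.range n).map (g z)) z hz (by simp)
    refine ⟨d, Set.mem_iUnion.2 ⟨_, hd⟩, fun k hk => ?_⟩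
    simp only [List.length_map, List.length_range] at hdt
    exact List.map_inj_left.1 hdt k (by simpa using hk)
  -- an element of the chain above `D`
  obtain ⟨ζ, hζI, hζ⟩ : ∃ ζ ∈ I, ∀ d ∈ D, g d ≤ᶠ[atTop] g ζ := by
    have hcnt : (⋃ d ∈ D, {x ∈ I | x < d}).Countable :=
      hD.biUnion fun d hd => hc d (hZI (hDZ hd))
    have : ¬ Z ⊆ (⋃ d ∈ D, {x ∈ I | x < d}) ∪ D := fun h => hZ ((hcnt.union hD).mono h)
    obtain ⟨ζ, hζZ, hζ⟩ := Set.not_subset.1 this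
    refine ⟨ζ, hZI hζZ, fun d hd => ?_⟩
    simp only [Set.mem_union, Set.mem_iUnion, not_or, not_exists] at hζ
    refine hchain d (hZI (hDZ hd)) ζ (hZI hζZ) (lt_of_le_of_ne ?_ ?_)
    · exact not_lt.1 fun h => hζ.1 d hd ⟨hZI hζZ, h⟩
    · rintro rfl; exact hζ.2 hd
  have hZ' : ¬ {z ∈ Z | ζ < z}.Countable := by
    intro h
    refine hZ (((h.union (hc ζ hζI)).union (Set.countable_singleton ζ)).mono fun z hz => ?_)
    rcases lt_trichotomy ζ z with h | h | h
    · exact Or.inl (Or.inl ⟨hz, h⟩)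
    · exact Or.inr h.symm
    · exact Or.inl (Or.inr ⟨hZI hz, h⟩)
  have hN : ∀ z, ∃ N, z ∈ Z ∧ ζ < z → ∀ k ≥ N, g ζ k ≤ g z k := by
    intro z
    by_cases h : z ∈ Z ∧ ζ < z
    · obtain ⟨N, hN⟩ := eventually_atTop.1 (hchain ζ hζI z (hZI h.1) h.2)
      exact ⟨N, fun _ => hN⟩
    · exact ⟨0, fun h' => absurd h' h⟩
  choose N hN using hN
  -- An uncountable part of Z on which the functions dominate g ζ from the same n₀ on and agree
  -- below n₀.
  obtain ⟨⟨n₀, t₀⟩, hn₀⟩ := exists_not_countable_fiber hZ'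
    (fun z => (N z, (List.range (N z)).map (g z)))
  set Z₀ := {z ∈ {z ∈ Z | ζ < z} | (N z, (List.range (N z)).map (g z)) = (n₀, t₀)} with hZ₀
  have hZ₀Z : ∀ z ∈ Z₀, z ∈ Z := fun z hz => hz.1.1
  have hZ₀N : ∀ z ∈ Z₀, ∀ k ≥ n₀, g ζ k ≤ g z k := by
    intro z hz
    have h1 : N z = n₀ := (Prod.ext_iff.1 hz.2).1
    exact h1 ▸ hN z hz.1
  have hZ₀t : ∀ z ∈ Z₀, (List.range n₀).map (g z) = t₀ := by
    intro z hz
    have h1 : N z = n₀ := (Prod.ext_iff.1 hz.2).1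
    rw [← h1]; exact (Prod.ext_iff.1 hz.2).2
  -- the least coordinate where `Z₀` is unbounded
  have hex : ∃ n, ∀ b : ℕ, ∃ z ∈ Z₀, b < g z n := by
    by_contra! h
    choose b hb using h
    have hsub : Z₀ ⊆ {i ∈ I | g i ≤ᶠ[atTop] b} := fun z hz =>
      ⟨hZI (hZ₀Z z hz), Eventually.of_forall fun n => hb n z hz⟩
    exact hn₀ ((hunb b).mono hsub)
  let n := Nat.find hex
  have hn : ∀ b : ℕ, ∃ z ∈ Z₀, b < g z n := Nat.find_spec hex
  have hlt : ∀ k < n, ∃ b : ℕ, ∀ z ∈ Z₀, g z k ≤ b := by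
    intro k hk
    have := Nat.find_min hex hk
    push Not at this
    exact this
  have hnn₀ : n₀ ≤ n := by
    by_contra! hlt'
    obtain ⟨z₁, hz₁, -⟩ := hn 0
    obtain ⟨z₂, hz₂, h2⟩ := hn (g z₁ n)
    have := (hZ₀t z₁ hz₁).trans (hZ₀t z₂ hz₂).symm
    have := List.map_inj_left.1 this n (by simpa using hlt')
    omega
  choose! b hb using hlt
  -- Coordinates below n are bounded on Z₀, so only finitely many initial segments occur; one of
  -- them must allow arbitrarily large values at n.
  have hfin : ∃ t : Fin n → ℕ, ∀ c : ℕ, ∃ z ∈ Z₀, (∀ k : Fin n, g z k = t k) ∧ c < g z n := by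
    by_contra! h
    choose c hc' using h
    let T : Finset (Fin n → ℕ) := Fintype.piFinset fun k => Finset.range (b k + 1)
    obtain ⟨z, hz, hz'⟩ := hn (T.sup c)
    have hzT : (fun k : Fin n => g z k) ∈ T := by
      simp only [T, Fintype.mem_piFinset, Finset.mem_range]
      exact fun k => Nat.lt_succ_of_le (hb k k.2 z hz)
    have h1 := hc' _ z hz (fun _ => rfl)
    have h2 := Finset.le_sup (f := c) hzT
    omega
  obtain ⟨t, ht⟩ := hfin
  obtain ⟨z₁, hz₁, hzt₁, -⟩ := ht 0
  obtain ⟨d, hdD, hd⟩ := hdense z₁ (hZ₀Z z₁ hz₁) n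
  obtain ⟨k₀, hk₀⟩ := eventually_atTop.1 (hζ d hdD)
  -- Choose z with g z n > g d k. Below n the two functions agree; between n and k monotonicity
  -- gives g d ≤ g d k < g z n ≤ g z; beyond k, g d ≤ g ζ ≤ g z.
  set k := max k₀ n
  obtain ⟨z, hz, hzt, hzn⟩ := ht (g d k)
  refine ⟨d, hDZ hdD, z, hZ₀Z z hz, fun i => ?_, fun heq => ?_⟩
  · rcases lt_or_ge i n with hi | hi
    · exact ((hd i hi).trans ((hzt₁ ⟨i, hi⟩).trans (hzt ⟨i, hi⟩).symm)).le
    · rcases le_total i k with hik | hik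
      · exact (hmono d hik).trans (hzn.le.trans (hmono z hi))
      · exact (hk₀ i ((le_max_left _ _).trans hik)).trans (hZ₀N z hz i (hnn₀.trans hi))
  · have : g d n ≤ g d k := hmono d (le_max_right _ _)
    rw [heq] at this hzn
    omega

/-- The alternative of the Open Coloring Axiom for a space which is separable metrizable. -/
theorem OCA.of_secondCountable (hOCA : OCA) {X : Type} [TopologicalSpace X] [T3Space X]
    [SecondCountableTopology X] (R : X → X → Prop) (hsymm : ∀ x y, R x y → R y x)
    (hopen : IsOpen {p : X × X | p.1 ≠ p.2 ∧ R p.1 p.2}) :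
    (∃ Y : Set X, ¬ Y.Countable ∧ ∀ x ∈ Y, ∀ y ∈ Y, x ≠ y → R x y) ∨
    (∃ Y : ℕ → Set X, (∀ n, ∀ x ∈ Y n, ∀ y ∈ Y n, x ≠ y → ¬ R x y) ∧ ⋃ n, Y n = Set.univ) := by
  let := TopologicalSpace.metrizableSpaceMetric X
  let S : X → X → Prop := fun x y => x ≠ y ∧ R x y
  have hS : Std.Symm S := ⟨fun x y h => ⟨h.1.symm, hsymm _ _ h.2⟩⟩
  have key := hOCA X (Sym2.fromRel hS) ({z | ¬ z.IsDiag} \ Sym2.fromRel hS)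
    { union_eq := by
        refine Set.union_sdiff_cancel ?_
        rintro ⟨x, y⟩ h
        exact fun h' => h.1 h'
      disjoint := Set.disjoint_sdiff_right
      isOpen := hopen }
  refine key.imp ?_ ?_
  · rintro ⟨Y, hY, h⟩
    exact ⟨Y, hY, fun x hx y hy hxy => (h x hx y hy hxy).2⟩
  · rintro ⟨Y, h, hY⟩
    exact ⟨Y, fun n x hx y hy hxy hR => (h n x hx y hy hxy).2 ⟨hxy, hR⟩, hY⟩

open Filter in
/-- Under the Open Coloring Axiom, uncountably many functions of any uncountable family are
dominated by a single one. -/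
theorem OCA.exists_dominating (hOCA : OCA) {ι : Type*} [Uncountable ι] (f : ι → ℕ → ℕ) :
    ∃ h : ℕ → ℕ, ¬ {i | f i ≤ᶠ[atTop] h}.Countable := by
  obtain ⟨_, I, g, hI, hc, hmono, hfg, hchain⟩ := exists_dominating_chain f
  by_contra! hcon
  have hunb : ∀ h : ℕ → ℕ, {i ∈ I | g i ≤ᶠ[atTop] h}.Countable := fun h =>
    (hcon h).mono fun i hi => (hfg i hi.1).trans hi.2
  have hfib : ∀ S : Set (ℕ → ℕ), S.Countable → {i ∈ I | g i ∈ S}.Countable := by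
    intro S hS
    refine (hS.biUnion fun s _ => hunb s).mono fun i hi => ?_
    simp only [Set.mem_iUnion]
    exact ⟨g i, hi.2, hi.1, EventuallyLE.refl _ _⟩
  -- The open colour is pointwise incomparability. An uncountable homogeneous set for it would be an
  -- antichain, contrary to `exists_le_of_unbounded_chain`.
  let X : Type := {x : ℕ → ℕ // x ∈ g '' I}
  have hopen : IsOpen {p : X × X | p.1 ≠ p.2 ∧ ¬ (p.1.1 ≤ p.2.1) ∧ ¬ (p.2.1 ≤ p.1.1)} := by
    have hle : IsClosed {p : (ℕ → ℕ) × (ℕ → ℕ) | p.1 ≤ p.2} :=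
      isClosed_le continuous_fst continuous_snd
    have h1 : IsOpen {p : X × X | ¬ ((p.1 : ℕ → ℕ) ≤ p.2)} :=
      hle.isOpen_compl.preimage (f := fun p : X × X => ((p.1 : ℕ → ℕ), (p.2 : ℕ → ℕ)))
        (.prodMk (continuous_subtype_val.comp continuous_fst)
          (continuous_subtype_val.comp continuous_snd))
    have h2 : IsOpen {p : X × X | ¬ ((p.2 : ℕ → ℕ) ≤ p.1)} :=
      hle.isOpen_compl.preimage (f := fun p : X × X => ((p.2 : ℕ → ℕ), (p.1 : ℕ → ℕ)))
        (.prodMk (continuous_subtype_val.comp continuous_snd)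
          (continuous_subtype_val.comp continuous_fst))
    exact (isOpen_ne_fun continuous_fst continuous_snd).and (h1.and h2)
  rcases hOCA.of_secondCountable (X := X) (fun x y => ¬ (x.1 ≤ y.1) ∧ ¬ (y.1 ≤ x.1))
    (fun x y h => ⟨h.2, h.1⟩) hopen with ⟨Y, hY, hYh⟩ | ⟨Y, hYh, hYu⟩
  · have hZ : ¬ {i ∈ I | ∃ y ∈ Y, y.1 = g i}.Countable := by
      intro h
      refine hY (((h.image g).preimage_of_injOn (f := Subtype.val)
        Subtype.val_injective.injOn).mono ?_)
      rintro ⟨x, i, hi, rfl⟩ hx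
      exact ⟨i, ⟨hi, _, hx, rfl⟩, rfl⟩
    obtain ⟨i, ⟨hi, x, hx, hxi⟩, j, ⟨hj, y, hy, hyj⟩, hle, hne⟩ :=
      exists_le_of_unbounded_chain hc hmono hchain hunb (Set.sep_subset _ _) hZ
    refine (hYh x hx y hy ?_).1 (by rwa [hxi, hyj])
    rintro rfl
    exact hne (hxi.symm.trans hyj)
  · -- a chain for the pointwise order is bounded by countably many functions
    have hcount : ∀ n, {i ∈ I | ∃ y ∈ Y n, y.1 = g i}.Countable := by
      intro n
      set C := {i ∈ I | ∃ y ∈ Y n, y.1 = g i}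
      have htot : ∀ i ∈ C, ∀ j ∈ C, g i ≤ g j ∨ g j ≤ g i := by
        rintro i ⟨hi, x, hx, hxi⟩ j ⟨hj, y, hy, hyj⟩
        by_cases hxy : x = y
        · subst hxy; left; rw [← hxi, ← hyj]
        · have := hYh n x hx y hy hxy
          rw [hxi, hyj] at this
          tauto
      -- If values at k are unbounded on C, the functions g (s b), with value above b at k, are
      -- cofinal in the total order C. Otherwise the coordinatewise bounds dominate C.
      by_cases hk : ∃ k, ∀ b : ℕ, ∃ i ∈ C, b < g i k
      · obtain ⟨k, hk⟩ := hk
        choose s hsC hs using hk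
        refine (Set.countable_iUnion fun b => hunb (g (s b))).mono fun i hi => ?_
        refine Set.mem_iUnion.2 ⟨g i k, hi.1, Eventually.of_forall ?_⟩
        rcases htot i hi _ (hsC (g i k)) with h | h
        · exact h
        · exact absurd (hs (g i k)) (not_lt.2 (h k))
      · push Not at hk
        choose b hb using hk
        have hsub : C ⊆ {i ∈ I | g i ≤ᶠ[atTop] b} := fun i hi =>
          ⟨hi.1, Eventually.of_forall fun k => hb k i hi⟩
        exact (hunb b).mono hsub
    refine hI ((Set.countable_iUnion hcount).mono fun i hi => ?_)
    have : (⟨g i, i, hi, rfl⟩ : X) ∈ ⋃ n, Y n := hYu ▸ Set.mem_univ _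
    obtain ⟨n, hn⟩ := Set.mem_iUnion.1 this
    exact Set.mem_iUnion.2 ⟨n, hi, _, hn, rfl⟩

/-! ### Uniformization of coherent families in a compact group -/

section Uniformization

open Filter Topology

/-- The distance of the increments of `a` and `b` from `i` to `j`. -/
def discr {G : Type*} [Group G] [MetricSpace G] (a b : ℕ → G) (i j : ℕ) : ℝ :=
  dist ((a i)⁻¹ * a j) ((b i)⁻¹ * b j)

variable {G : Type} [Group G] [MetricSpace G]

theorem discr_self (a : ℕ → G) (i j : ℕ) : discr a a i j = 0 := dist_self _

theorem discr_comm (a b : ℕ → G) (i j : ℕ) : discr a b i j = discr b a i j := dist_comm _ _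

theorem discr_triangle (a b c : ℕ → G) (i j : ℕ) :
    discr a c i j ≤ discr a b i j + discr b c i j := dist_triangle _ _ _

theorem discr_mul_left (g : G) (a b : ℕ → G) (i j : ℕ) :
    discr (fun n => g * a n) b i j = discr a b i j := by
  simp [discr, mul_assoc]

section

variable [IsIsometricSMul G G] [IsIsometricSMul Gᵐᵒᵖ G]

theorem discr_swap (a b : ℕ → G) (i j : ℕ) : discr a b i j = discr a b j i := by
  rw [discr, discr, ← dist_inv_inv]; simp

theorem discr_le_add (a b : ℕ → G) (i j : ℕ) :
    discr a b i j ≤ dist (a i) (b i) + dist (a j) (b j) := by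
  calc discr a b i j ≤ dist ((a i)⁻¹ * a j) ((b i)⁻¹ * a j) +
        dist ((b i)⁻¹ * a j) ((b i)⁻¹ * b j) := dist_triangle _ _ _
    _ = _ := by rw [dist_mul_right, dist_mul_left, dist_inv_inv]

end

/-- A single ultrafilter gives limits of all coordinates at once, with no subsequences to choose. -/
theorem exists_tendsto_hyperfilter {G : Type*} [TopologicalSpace G] [CompactSpace G] (u : ℕ → G) :
    ∃ x, Tendsto u (hyperfilter ℕ) (𝓝 x) := by
  obtain ⟨x, -, hx⟩ := isCompact_univ.ultrafilter_le_nhds ((hyperfilter ℕ).map u) (by simp)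
  exact ⟨x, hx⟩

set_option linter.unusedSectionVars false

variable [IsTopologicalGroup G]

theorem tendsto_discr {ι : Type*} {l : Filter ι} {u : ι → ℕ → G} {a : ℕ → G} (b : ℕ → G) {i j : ℕ}
    (hi : Tendsto (fun n => u n i) l (𝓝 (a i))) (hj : Tendsto (fun n => u n j) l (𝓝 (a j))) :
    Tendsto (fun n => discr (u n) b i j) l (𝓝 (discr a b i j)) :=
  (hi.inv.mul hj).dist tendsto_const_nhds

variable [IsIsometricSMul G G] [IsIsometricSMul Gᵐᵒᵖ G] [CompactSpace G]

/-- A coherent family: the increments of `a f` and `a g` are asymptotically equal on the pairs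
`i ≤ j ≤ min (f i) (g i)`. -/
def IsCoherent (a : (ℕ → ℕ) → ℕ → G) : Prop :=
  ∀ f g, ∀ ε > 0, ∃ n, ∀ i j, n ≤ i → i ≤ j → j ≤ f i → j ≤ g i → discr (a f) (a g) i j < ε

/-- G^(J+1) is separable, so countably many balls of radius ε/2 cover it, and two members of Y have
initial segments in the same ball. -/
theorem exists_uncountable_finite_close {Y : Set (ℕ → ℕ)} (hY : ¬ Y.Countable)
    (a : (ℕ → ℕ) → ℕ → G) (J : ℕ) {ε : ℝ} (hε : 0 < ε) :
    ∃ f ∈ Y, ∃ g ∈ Y, f ≠ g ∧ ∀ i ≤ J, dist (a f i) (a g i) < ε := by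
  obtain ⟨s, hs⟩ := TopologicalSpace.exists_dense_seq (Fin (J + 1) → G)
  have : ∀ f : ℕ → ℕ, ∃ k, dist (fun i : Fin (J + 1) => a f i) (s k) < ε / 2 := fun f =>
    hs.exists_dist_lt (fun i : Fin (J + 1) => a f i) (half_pos hε)
  choose c hc using this
  obtain ⟨k, hk⟩ := exists_not_countable_fiber hY c
  obtain ⟨f, hf, g, hg, hfg⟩ : Set.Nontrivial {z ∈ Y | c z = k} := by
    rw [← Set.not_subsingleton_iff]
    exact fun h => hk h.countable
  refine ⟨f, hf.1, g, hg.1, hfg, fun i hi => ?_⟩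
  have h1 := (dist_le_pi_dist _ _ ⟨i, Nat.lt_succ_of_le hi⟩).trans_lt (hf.2 ▸ hc f)
  have h2 := (dist_le_pi_dist _ _ ⟨i, Nat.lt_succ_of_le hi⟩).trans_lt (hg.2 ▸ hc g)
  have := dist_triangle_right (a f i) (a g i) (s k ⟨i, Nat.lt_succ_of_le hi⟩)
  dsimp only at h1 h2
  linarith

/-- This rules out the uncountable alternative of OCA in `IsCoherent.exists_cofinal`. Uncountably
many members of Y lie below one function h modulo finite, and far out all their sequences can be
compared with a h; the remaining pairs involve only a bounded range of indices. -/
theorem IsCoherent.exists_discr_le (hOCA : OCA) {a : (ℕ → ℕ) → ℕ → G} (ha : IsCoherent a)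
    {Y : Set (ℕ → ℕ)} (hY : ¬ Y.Countable) {ε : ℝ} (hε : 0 < ε) :
    ∃ f ∈ Y, ∃ g ∈ Y, f ≠ g ∧
      ∀ i j, i ≤ j → j ≤ f i → j ≤ g i → discr (a f) (a g) i j ≤ ε := by
  classical
  have : Uncountable Y := by rwa [← not_countable_iff]
  obtain ⟨h, hh⟩ := hOCA.exists_dominating (fun f : Y => (f : ℕ → ℕ))
  have hn : ∀ f : ℕ → ℕ, ∃ n, f ≤ᶠ[atTop] h →
      ∀ i j, n ≤ i → i ≤ j → j ≤ f i → discr (a f) (a h) i j < ε / 2 := by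
    intro f
    by_cases hf : f ≤ᶠ[atTop] h
    · obtain ⟨n₁, h1⟩ := eventually_atTop.1 hf
      obtain ⟨n₂, h2⟩ := ha f h (ε / 2) (half_pos hε)
      exact ⟨max n₁ n₂, fun _ i j hi hij hj => h2 i j (le_of_max_le_right hi) hij hj
        (hj.trans (h1 i (le_of_max_le_left hi)))⟩
    · exact ⟨0, fun h => absurd h hf⟩
  choose n hn using hn
  have hY₁ : ¬ {f ∈ Y | f ≤ᶠ[atTop] h}.Countable := by
    intro hc
    refine hh ((hc.preimage_of_injOn (f := Subtype.val) Subtype.val_injective.injOn).mono ?_)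
    exact fun f hf => ⟨f.2, hf⟩
  -- Fixing the threshold and the values of f below it bounds every j ≤ f i with i < n₀ by one
  -- number J.
  obtain ⟨⟨n₀, t⟩, hY₂⟩ := exists_not_countable_fiber hY₁
    (fun f => (n f, (List.range (n f)).map f))
  obtain ⟨J, hJ⟩ : ∃ J, ∀ i ∈ t, i ≤ J := ⟨t.sum, fun i hi => List.le_sum_of_mem hi⟩
  obtain ⟨f, hf, g, hg, hfg, hd⟩ := exists_uncountable_finite_close hY₂ a J
    (show 0 < ε / 2 by positivity)
  have hfn : n f = n₀ := (Prod.ext_iff.1 hf.2).1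
  have hgn : n g = n₀ := (Prod.ext_iff.1 hg.2).1
  refine ⟨f, hf.1.1, g, hg.1.1, hfg, fun i j hij hjf hjg => ?_⟩
  rcases le_or_gt n₀ i with hi | hi
  · have h1 := hn f hf.1.2 i j (hfn ▸ hi) hij hjf
    have h2 := hn g hg.1.2 i j (hgn ▸ hi) hij hjg
    have h3 := discr_triangle (a f) (a h) (a g) i j
    rw [discr_comm (a h)] at h3
    linarith
  · have hfi : f i ∈ t := by
      have ht : (List.range (n f)).map f = t := (Prod.ext_iff.1 hf.2).2
      rw [← ht]
      exact List.mem_map.2 ⟨i, by simpa [hfn] using hi, rfl⟩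
    have hjJ : j ≤ J := hjf.trans (hJ _ hfi)
    have := discr_le_add (a f) (a g) i j
    linarith [hd i (hij.trans hjJ), hd j hjJ]

/-- Up to `ε`, a coherent family agrees on a cofinal set of monotone functions. -/
theorem IsCoherent.exists_cofinal (hOCA : OCA) {a : (ℕ → ℕ) → ℕ → G} (ha : IsCoherent a)
    {ε : ℝ} (hε : 0 < ε) :
    ∃ W : Set (ℕ → ℕ), (∀ f ∈ W, Monotone f) ∧ (∀ g : ℕ → ℕ, ∃ f ∈ W, g ≤ᶠ[atTop] f) ∧
      ∀ f ∈ W, ∀ g ∈ W, ∀ i j, i ≤ j → j ≤ f i → j ≤ g i → discr (a f) (a g) i j ≤ ε := by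
  have : SecondCountableTopology G := EMetric.secondCountable_of_sigmaCompact G
  -- Recording a f as a second coordinate makes the colouring open: the colour depends on finitely
  -- many coordinates of f and of a f, whereas f ↦ a f need not be continuous.
  let X : Type := {p : (ℕ → ℕ) × (ℕ → G) // Monotone p.1 ∧ p.2 = a p.1}
  let R : X → X → Prop := fun p q =>
    ∃ i j, i ≤ j ∧ j ≤ p.1.1 i ∧ j ≤ q.1.1 i ∧ ε < discr p.1.2 q.1.2 i j
  have hsymm : ∀ p q, R p q → R q p := by
    rintro p q ⟨i, j, h1, h2, h3, h4⟩
    exact ⟨i, j, h1, h3, h2, discr_comm p.1.2 q.1.2 i j ▸ h4⟩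
  have hopen : IsOpen {p : X × X | p.1 ≠ p.2 ∧ R p.1 p.2} := by
    refine (isOpen_ne_fun continuous_fst continuous_snd).and ?_
    have c1 : Continuous fun p : X × X => p.1.1 := continuous_subtype_val.comp continuous_fst
    have c2 : Continuous fun p : X × X => p.2.1 := continuous_subtype_val.comp continuous_snd
    have key : {p : X × X | R p.1 p.2} = ⋃ i : ℕ, ⋃ j : ℕ, {p : X × X | i ≤ j ∧ j ≤ p.1.1.1 i ∧
        j ≤ p.2.1.1 i ∧ ε < discr p.1.1.2 p.2.1.2 i j} := by
      ext p; simp [R]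
    rw [key]
    refine isOpen_iUnion fun i => isOpen_iUnion fun j => ?_
    have d1 : ∀ k, Continuous fun p : X × X => p.1.1.2 k := fun k =>
      (continuous_apply k).comp (continuous_snd.comp c1)
    have d2 : ∀ k, Continuous fun p : X × X => p.2.1.2 k := fun k =>
      (continuous_apply k).comp (continuous_snd.comp c2)
    have e1 : Continuous fun p : X × X => p.1.1.1 i :=
      (continuous_apply i).comp (continuous_fst.comp c1)
    have e2 : Continuous fun p : X × X => p.2.1.1 i :=
      (continuous_apply i).comp (continuous_fst.comp c2)
    refine isOpen_const.and (((isOpen_discrete (Set.Ici j)).preimage e1).and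
      (((isOpen_discrete (Set.Ici j)).preimage e2).and ?_))
    exact isOpen_lt continuous_const (((d1 i).inv.mul (d1 j)).dist ((d2 i).inv.mul (d2 j)))
  have : SecondCountableTopology X := TopologicalSpace.Subtype.secondCountableTopology _
  rcases hOCA.of_secondCountable R hsymm hopen with ⟨Y, hY, hYh⟩ | ⟨Y, hYh, hYu⟩
  · exfalso
    have hinj : Function.Injective fun p : X => p.1.1 := by
      rintro ⟨⟨f, b⟩, h1, h2⟩ ⟨⟨g, c⟩, h3, h4⟩ h
      dsimp only at h h2 h4
      subst h2 h4 h
      rfl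
    have hY' : ¬ ((fun p : X => p.1.1) '' Y).Countable := fun h =>
      hY (Set.countable_of_injective_of_countable_image hinj.injOn h)
    obtain ⟨_, ⟨⟨⟨f, b⟩, h1, h2⟩, hp, rfl⟩, _, ⟨⟨⟨g, c⟩, h3, h4⟩, hq, rfl⟩, hfg, hle⟩ :=
      ha.exists_discr_le hOCA hY' hε
    dsimp only at h2 h4 hfg hle
    subst h2 h4
    obtain ⟨i, j, hij, hf, hg, hlt⟩ := hYh _ hp _ hq (fun h => hfg (congrArg (fun p : X => p.1.1) h))
    exact absurd (hle i j hij hf hg) (not_le.2 hlt)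
  · let W : ℕ → Set (ℕ → ℕ) := fun n => {f | ∃ p ∈ Y n, p.1.1 = f}
    have hWm : ∀ n, ∀ f ∈ W n, Monotone f := by
      rintro n f ⟨p, -, rfl⟩; exact p.2.1
    have hWh : ∀ n, ∀ f ∈ W n, ∀ g ∈ W n, ∀ i j, i ≤ j → j ≤ f i → j ≤ g i →
        discr (a f) (a g) i j ≤ ε := by
      rintro n _ ⟨p, hp, rfl⟩ _ ⟨q, hq, rfl⟩ i j hij hf hg
      by_cases hpq : p = q
      · rw [hpq, discr_self]; exact hε.le
      · by_contra! hlt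
        exact hYh n p hp q hq hpq ⟨i, j, hij, hf, hg, by rwa [p.2.2, q.2.2]⟩
    by_cases hcof : ∃ n, ∀ g : ℕ → ℕ, ∃ f ∈ W n, g ≤ᶠ[atTop] f
    · obtain ⟨n, hn⟩ := hcof
      exact ⟨W n, hWm n, hn, hWh n⟩
    -- If no W n is cofinal, a monotone bound h of the countably many witnesses g n lies in some W n
    -- and dominates g n.
    · exfalso
      push Not at hcof
      choose g hg using hcof
      obtain ⟨h, hm, hh⟩ := exists_monotone_eventuallyLE (Set.countable_range g)
      have : (⟨(h, a h), hm, rfl⟩ : X) ∈ ⋃ n, Y n := hYu ▸ Set.mem_univ _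
      obtain ⟨n, hn⟩ := Set.mem_iUnion.1 this
      exact hg n h ⟨_, hn, rfl⟩ (hh _ ⟨n, rfl⟩)

/-- `b` uniformizes `a` up to `ε`. -/
def UniformizesUpTo (a : (ℕ → ℕ) → ℕ → G) (ε : ℝ) (b : ℕ → G) : Prop :=
  ∀ f : ℕ → ℕ, ∃ n, ∀ i j, n ≤ i → i ≤ j → j ≤ f i → discr b (a f) i j ≤ ε

/-- A cofinal set W cannot be bounded at every coordinate, so it is unbounded at some k. Taking F J
∈ W with F J k ≥ J, monotonicity lets a (F J) be compared with a f at any fixed pair beyond k once J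
is large; b is the ultrafilter limit of the a (F J). -/
theorem IsCoherent.exists_uniformizesUpTo (hOCA : OCA) {a : (ℕ → ℕ) → ℕ → G} (ha : IsCoherent a)
    {ε : ℝ} (hε : 0 < ε) : ∃ b, UniformizesUpTo a ε b := by
  obtain ⟨W, hWm, hWc, hWh⟩ := ha.exists_cofinal hOCA (half_pos hε)
  obtain ⟨k, hk⟩ : ∃ k, ∀ J : ℕ, ∃ f ∈ W, J ≤ f k := by
    by_contra! h
    choose c hc using h
    obtain ⟨f, hf, hcf⟩ := hWc c
    obtain ⟨n, hn⟩ := hcf.exists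
    exact absurd hn (not_le.2 (hc n f hf))
  choose F hFW hF using hk
  have hlim := fun i => exists_tendsto_hyperfilter fun J => a (F J) i
  choose b hb using hlim
  have key : ∀ f ∈ W, ∀ i j, k ≤ i → i ≤ j → j ≤ f i → discr b (a f) i j ≤ ε / 2 := by
    intro f hf i j hki hij hj
    refine le_of_tendsto (tendsto_discr (a f) (hb i) (hb j)) ?_
    refine Nat.hyperfilter_le_atTop ?_
    filter_upwards [eventually_ge_atTop j] with J hJ
    exact hWh _ (hFW J) f hf i j hij (hJ.trans ((hF J).trans (hWm _ (hFW J) hki))) hj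
  refine ⟨b, fun g => ?_⟩
  obtain ⟨f, hf, hgf⟩ := hWc g
  obtain ⟨n₁, h1⟩ := eventually_atTop.1 hgf
  obtain ⟨n₂, h2⟩ := ha f g (ε / 2) (half_pos hε)
  refine ⟨max k (max n₁ n₂), fun i j hi hij hj => ?_⟩
  simp only [max_le_iff] at hi
  have hjf : j ≤ f i := hj.trans (h1 i hi.2.1)
  have := discr_triangle b (a f) (a g) i j
  linarith [key f hf i j hi.1 hij hjf, h2 i j hi.2.2 hij hjf hj]

/-- The bound on j disappears: if bad pairs existed beyond every K, one function g would capture all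
of them, and comparing b and c through a g would be contradictory. -/
theorem UniformizesUpTo.discr_le {a : (ℕ → ℕ) → ℕ → G} {ε δ : ℝ} {b c : ℕ → G}
    (hb : UniformizesUpTo a ε b) (hc : UniformizesUpTo a δ c) :
    ∃ K, ∀ i j, K ≤ i → i ≤ j → discr b c i j ≤ ε + δ := by
  by_contra! h
  choose I J hI hIJ hlt using h
  let g : ℕ → ℕ := fun i => (Finset.range (i + 1)).sup J
  obtain ⟨n₁, h1⟩ := hb g
  obtain ⟨n₂, h2⟩ := hc g
  set K := max n₁ n₂
  have hJ : J K ≤ g (I K) := Finset.le_sup (f := J) (by simpa using Nat.lt_succ_of_le (hI K))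
  have e1 := h1 (I K) (J K) ((le_max_left _ _).trans (hI K)) (hIJ K) hJ
  have e2 := h2 (I K) (J K) ((le_max_right _ _).trans (hI K)) (hIJ K) hJ
  have := discr_triangle b (a g) c (I K) (J K)
  rw [discr_comm (a g)] at this
  linarith [hlt K]

/-- Under the Open Coloring Axiom, coherent families in a compact group can be uniformized. -/
theorem IsCoherent.exists_uniformization (hOCA : OCA) {a : (ℕ → ℕ) → ℕ → G} (ha : IsCoherent a) :
    ∃ b : ℕ → G, ∀ f, ∀ ε > 0, ∃ n, ∀ i j, n ≤ i → i ≤ j → j ≤ f i → discr b (a f) i j < ε := by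
  classical
  let δ : ℕ → ℝ := fun n => 1 / (n + 1)
  have hδ : ∀ n, 0 < δ n := fun n => Nat.one_div_pos_of_nat
  have hδm : Antitone δ := fun n l h => Nat.one_div_le_one_div h
  choose b hb using fun n => ha.exists_uniformizesUpTo hOCA (hδ n)
  choose K hK using fun n l => (hb n).discr_le (hb l)
  -- Uniformizations determine only increments, so each b n is determined, up to error, only up to
  -- left multiplication by a constant. Multiplying by θ n aligns b n with b 0 at infinity, making
  -- the c n close pointwise and not only in increments.
  choose θ hθ using fun n => exists_tendsto_hyperfilter fun i => b 0 i * (b n i)⁻¹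
  let c : ℕ → ℕ → G := fun n i => θ n * b n i
  have hc : ∀ n l i, n ≤ l → K n l ≤ i → dist (c n i) (c l i) ≤ 2 * δ n := by
    intro n l i hnl hi
    have ht : Tendsto (fun j => dist (b 0 j * (b n j)⁻¹ * b n i) (b 0 j * (b l j)⁻¹ * b l i))
        (hyperfilter ℕ) (𝓝 (dist (c n i) (c l i))) :=
      ((hθ n).mul_const _).dist ((hθ l).mul_const _)
    refine le_of_tendsto ht (Nat.hyperfilter_le_atTop ?_)
    filter_upwards [eventually_ge_atTop i] with j hj
    rw [mul_assoc, mul_assoc, dist_mul_left]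
    have h1 := hK n l i j hi hj
    rw [discr_swap] at h1
    unfold discr at h1
    linarith [hδm hnl]
  -- At index i use the finest approximation n ≤ i whose comparison thresholds with all coarser ones
  -- have been passed.
  let N : ℕ → ℕ := fun i => Nat.findGreatest (fun n => ∀ n' ≤ n, K n' n ≤ i) i
  have hN : ∀ n, ∃ i₀, ∀ i ≥ i₀, dist (c n i) (c (N i) i) ≤ 2 * δ n := by
    intro n
    refine ⟨max n ((Finset.range (n + 1)).sup fun n' => K n' n), fun i hi => ?_⟩
    have hP : ∀ n' ≤ n, K n' n ≤ i := fun n' hn' =>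
      (Finset.le_sup (f := fun n' => K n' n) (Finset.mem_range.2 (Nat.lt_succ_of_le hn'))).trans
        (le_of_max_le_right hi)
    have hle : n ≤ N i := Nat.le_findGreatest (P := fun n => ∀ n' ≤ n, K n' n ≤ i)
      (le_of_max_le_left hi) hP
    have hs := Nat.findGreatest_spec (P := fun n => ∀ n' ≤ n, K n' n ≤ i)
      (le_of_max_le_left hi) hP
    exact hc n (N i) i hle (hs n hle)
  refine ⟨fun i => c (N i) i, fun f ε hε => ?_⟩
  -- Five parts: 2δ at each of i and j for replacing c (N i) by c n, and δ for comparing c n with a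
  -- f.
  obtain ⟨n, hn⟩ := exists_nat_one_div_lt (show 0 < ε / 5 by positivity)
  obtain ⟨i₀, hi₀⟩ := hN n
  obtain ⟨n₁, hn₁⟩ := hb n f
  refine ⟨max i₀ n₁, fun i j hi hij hj => ?_⟩
  have h1 := hi₀ i (le_of_max_le_left hi)
  have h2 := hi₀ j ((le_of_max_le_left hi).trans hij)
  have h3 := hn₁ i j (le_of_max_le_right hi) hij hj
  have h4 := discr_le_add (c n) (fun i => c (N i) i) i j
  have h5 := discr_triangle (fun i => c (N i) i) (c n) (a f) i j
  have h6 : discr (c n) (a f) i j = discr (b n) (a f) i j := discr_mul_left _ _ _ _ _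
  rw [discr_comm _ (c n)] at h5
  change δ n < ε / 5 at hn
  linarith

end Uniformization

/-! ### Interval partitions -/

namespace IntervalPartition

variable (E : IntervalPartition)

/-- The index of the interval that contains `i`. -/
def idx (i : ℕ) : ℕ := Nat.findGreatest (fun n => E.endpoint n ≤ i) i

theorem endpoint_idx_le (i : ℕ) : E.endpoint (E.idx i) ≤ i :=
  Nat.findGreatest_spec (P := fun n => E.endpoint n ≤ i) (Nat.zero_le i)
    (by simp [E.endpoint_zero])

theorem lt_endpoint_idx_succ (i : ℕ) : i < E.endpoint (E.idx i + 1) := by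
  by_contra! h
  have h1 : E.idx i + 1 ≤ i := (E.strictMono.id_le _).trans h
  have := Nat.le_findGreatest (P := fun n => E.endpoint n ≤ i) h1 h
  exact absurd this (by simp [idx])

theorem idx_eq_iff {i n : ℕ} : E.idx i = n ↔ E.endpoint n ≤ i ∧ i < E.endpoint (n + 1) := by
  constructor
  · rintro rfl
    exact ⟨E.endpoint_idx_le i, E.lt_endpoint_idx_succ i⟩
  · rintro ⟨h1, h2⟩
    have h3 := E.strictMono.lt_iff_lt.1 ((E.endpoint_idx_le i).trans_lt h2)
    have h4 := E.strictMono.lt_iff_lt.1 (h1.trans_lt (E.lt_endpoint_idx_succ i))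
    omega

theorem mem_block {i n : ℕ} : i ∈ E.block n ↔ E.idx i = n := E.idx_eq_iff.symm

theorem idx_mono : Monotone E.idx := fun i j h => by
  have := E.strictMono.lt_iff_lt.1
    ((E.endpoint_idx_le i).trans_lt (h.trans_lt (E.lt_endpoint_idx_succ j)))
  omega

theorem idx_endpoint (n : ℕ) : E.idx (E.endpoint n) = n :=
  E.idx_eq_iff.2 ⟨le_rfl, E.strictMono (Nat.lt_succ_self n)⟩

/-- The partition into the unions of the intervals `2n` and `2n + 1`. -/
def evenPairs : IntervalPartition where
  endpoint n := E.endpoint (2 * n)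
  endpoint_zero := E.endpoint_zero
  strictMono a b h := E.strictMono (by omega)

/-- The partition into the interval `0` and the unions of the intervals `2n + 1` and `2n + 2`. -/
def oddPairs : IntervalPartition where
  -- Truncated subtraction gives 0 at n = 0, so the first interval is interval 0 alone.
  endpoint n := E.endpoint (2 * n - 1)
  endpoint_zero := E.endpoint_zero
  strictMono := strictMono_nat_of_lt_succ fun n => E.strictMono (by omega)

theorem idx_evenPairs (i : ℕ) : E.evenPairs.idx i = E.idx i / 2 := by
  refine E.evenPairs.idx_eq_iff.2 ⟨?_, ?_⟩
  · exact (E.strictMono.monotone (by omega)).trans (E.endpoint_idx_le i)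
  · exact (E.lt_endpoint_idx_succ i).trans_le (E.strictMono.monotone (by omega))

theorem idx_oddPairs (i : ℕ) : E.oddPairs.idx i = (E.idx i + 1) / 2 := by
  refine E.oddPairs.idx_eq_iff.2 ⟨?_, ?_⟩
  · exact (E.strictMono.monotone (by omega)).trans (E.endpoint_idx_le i)
  · exact (E.lt_endpoint_idx_succ i).trans_le (E.strictMono.monotone (by omega))

/-- The union of the intervals `n` and `n + 1` is an interval of this partition. -/
def pairs (n : ℕ) : IntervalPartition := if Even n then E.evenPairs else E.oddPairs

theorem idx_pairs {n i j : ℕ} (hi : E.idx i = n ∨ E.idx i = n + 1)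
    (hj : E.idx j = n ∨ E.idx j = n + 1) : (E.pairs n).idx i = (E.pairs n).idx j := by
  unfold pairs
  split_ifs with h
  · obtain ⟨k, rfl⟩ := h
    rw [idx_evenPairs, idx_evenPairs]; omega
  · obtain ⟨k, rfl⟩ := Nat.not_even_iff_odd.1 h
    rw [idx_oddPairs, idx_oddPairs]; omega

theorem idx_pairs_of_idx_eq (n : ℕ) {i j : ℕ} (h : E.idx i = E.idx j) :
    (E.pairs n).idx i = (E.pairs n).idx j := by
  unfold pairs
  split_ifs
  · rw [idx_evenPairs, idx_evenPairs, h]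
  · rw [idx_oddPairs, idx_oddPairs, h]

/-- Only two partitions occur as `E.pairs m`, so thresholds are uniform in m. -/
theorem exists_eventually_pairs {p : IntervalPartition → ℕ → Prop}
    (h : ∀ m, ∃ n, ∀ i ≥ n, p (E.pairs m) i) : ∃ N, ∀ m, ∀ i ≥ N, p (E.pairs m) i := by
  obtain ⟨n₁, h1⟩ := h 0
  obtain ⟨n₂, h2⟩ := h 1
  have e1 : E.pairs 0 = E.evenPairs := if_pos (by decide)
  have e2 : E.pairs 1 = E.oddPairs := if_neg (by decide)
  rw [e1] at h1
  rw [e2] at h2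
  refine ⟨max n₁ n₂, fun n i hi => ?_⟩
  unfold pairs
  split_ifs
  · exact h1 i (le_of_max_le_left hi)
  · exact h2 i (le_of_max_le_right hi)

/-- Given `f`, there is a partition such that `f` maps every interval below the end of the next
interval. -/
theorem exists_lt_endpoint (f : ℕ → ℕ) :
    ∃ E : IntervalPartition, ∀ n, ∀ i < E.endpoint n, f i < E.endpoint (n + 1) := by
  let e : ℕ → ℕ := fun n => Nat.rec 0 (fun _ m => max m ((Finset.range m).sup f) + 1) n
  have he : ∀ n, e (n + 1) = max (e n) ((Finset.range (e n)).sup f) + 1 := fun n => rfl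
  refine ⟨⟨e, rfl, strictMono_nat_of_lt_succ fun n => ?_⟩, fun n i hi => ?_⟩
  · rw [he]; exact Nat.lt_succ_of_le (le_max_left _ _)
  · change f i < e (n + 1)
    rw [he]
    exact Nat.lt_succ_of_le ((Finset.le_sup (f := f) (Finset.mem_range.2 hi)).trans
      (le_max_right _ _))

end IntervalPartition

/-! ### Uniformization of coherent families indexed by interval partitions. -/

section BlockCoherent

variable {G : Type} [Group G] [MetricSpace G]

/-- A coherent family indexed by partitions: increments are asymptotically equal on the pairs which
belong to common intervals. -/
def IsBlockCoherent (α : IntervalPartition → ℕ → G) : Prop :=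
  ∀ E F : IntervalPartition, ∀ ε > 0, ∃ n, ∀ i j, n ≤ i → i ≤ j → E.idx i = E.idx j →
    F.idx i = F.idx j → discr (α E) (α F) i j < ε

theorem IsBlockCoherent.pairs {α : IntervalPartition → ℕ → G} (hα : IsBlockCoherent α)
    (E F : IntervalPartition) {ε : ℝ} (hε : 0 < ε) : ∃ N, ∀ n, ∀ i ≥ N, ∀ j, i ≤ j →
      (E.pairs n).idx i = (E.pairs n).idx j → F.idx i = F.idx j →
      discr (α (E.pairs n)) (α F) i j < ε :=
  E.exists_eventually_pairs (p := fun F' i => ∀ j, i ≤ j → F'.idx i = F'.idx j →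
    F.idx i = F.idx j → discr (α F') (α F) i j < ε) fun m => by
      obtain ⟨n, hn⟩ := hα (E.pairs m) F ε hε
      exact ⟨n, fun i hi j hij h1 h2 => hn i j hi hij h1 h2⟩

variable [IsIsometricSMul G G] [IsIsometricSMul Gᵐᵒᵖ G]

-- On interval n the sequence γ copies the increments of α (E.pairs n), and t n carries its value
-- across the preceding intervals. Both `E.pairs n` and `E.pairs (n + 1)` keep interval n + 1 within
-- one block, so coherence controls increments across the boundary.
omit [IsIsometricSMul Gᵐᵒᵖ G] in
theorem IsBlockCoherent.exists_glue {α : IntervalPartition → ℕ → G} (hα : IsBlockCoherent α)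
    (E : IntervalPartition) :
    ∃ γ : ℕ → G, ∀ ε > 0, ∃ N, ∀ i j, N ≤ i → i ≤ j → E.idx j ≤ E.idx i + 1 →
      discr γ (α (E.pairs (E.idx i))) i j < ε := by
  let ω : ℕ → ℕ → G := fun n => α (E.pairs n)
  let t : ℕ → G := fun n =>
    Nat.rec 1 (fun n x => x * ((ω n (E.endpoint n))⁻¹ * ω n (E.endpoint (n + 1)))) n
  have ht : ∀ n, t (n + 1) = t n * ((ω n (E.endpoint n))⁻¹ * ω n (E.endpoint (n + 1))) :=
    fun n => rfl
  let γ : ℕ → G := fun i => t (E.idx i) * ((ω (E.idx i) (E.endpoint (E.idx i)))⁻¹ * ω (E.idx i) i)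
  refine ⟨γ, fun ε hε => ?_⟩
  obtain ⟨N, hN⟩ := E.exists_eventually_pairs (p := fun F i => ∀ n j, i ≤ j → E.idx i = E.idx j →
      discr (α (E.pairs n)) (α F) i j < ε) fun m => by
    obtain ⟨N, hN⟩ := hα.pairs E (E.pairs m) hε
    exact ⟨N, fun i hi n j hij h => hN n i hi j hij (E.idx_pairs_of_idx_eq n h)
      (E.idx_pairs_of_idx_eq m h)⟩
  refine ⟨N, fun i j hi hij hj => ?_⟩
  change discr γ (ω (E.idx i)) i j < ε
  rcases (E.idx_mono hij).eq_or_lt with h | h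
  · have : discr γ (ω (E.idx i)) i j = 0 := by
      simp [discr, γ, ← h, mul_assoc]
    rwa [this]
  · have hj' : E.idx j = E.idx i + 1 := by omega
    set n := E.idx i with hn
    -- Up to the endpoint shared by the intervals, γ follows ω n exactly, so by left invariance only
    -- the part inside interval n + 1 contributes.
    have key : discr γ (ω n) i j = discr (ω (n + 1)) (ω n) (E.endpoint (n + 1)) j := by
      have : (γ i)⁻¹ * γ j = (ω n i)⁻¹ * ω n (E.endpoint (n + 1)) *
          ((ω (n + 1) (E.endpoint (n + 1)))⁻¹ * ω (n + 1) j) := by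
        simp only [γ, hj', ← hn, ht]
        group
      have h2 : (ω n i)⁻¹ * ω n j = (ω n i)⁻¹ * ω n (E.endpoint (n + 1)) *
          ((ω n (E.endpoint (n + 1)))⁻¹ * ω n j) := by group
      rw [discr, this, h2, dist_mul_left, discr]
    rw [key]
    refine hN _ _ ?_ _ _ ?_ ?_
    · exact hi.trans (E.lt_endpoint_idx_succ i).le
    · exact (E.idx_eq_iff.1 hj').1
    · rw [E.idx_endpoint, hj']

/-- Under the Open Coloring Axiom, a coherent family indexed by partitions can be uniformized. -/
theorem IsBlockCoherent.exists_uniformization [CompactSpace G] [IsTopologicalGroup G] (hOCA : OCA)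
    {α : IntervalPartition → ℕ → G} (hα : IsBlockCoherent α) :
    ∃ b : ℕ → G, ∀ E : IntervalPartition, ∀ ε > 0, ∃ n, ∀ i j, n ≤ i → i ≤ j →
      E.idx i = E.idx j → discr b (α E) i j < ε := by
  -- With P f as partition, j ≤ f i puts i ≤ j in the same or adjacent intervals, where γ (P f) is
  -- controlled. Thus f ↦ γ (P f) is a coherent family indexed by functions.
  choose P hP using IntervalPartition.exists_lt_endpoint
  choose γ hγ using hα.exists_glue
  have hPf : ∀ f i j, j ≤ f i → (P f).idx j ≤ (P f).idx i + 1 := by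
    intro f i j hj
    have h1 := hj.trans_lt (hP f _ i ((P f).lt_endpoint_idx_succ i))
    have := (P f).strictMono.lt_iff_lt.1 (((P f).endpoint_idx_le j).trans_lt h1)
    omega
  have hsame : ∀ f i j, i ≤ j → j ≤ f i →
      ((P f).pairs ((P f).idx i)).idx i = ((P f).pairs ((P f).idx i)).idx j := by
    intro f i j hij hj
    have := (P f).idx_mono hij
    have := hPf f i j hj
    exact (P f).idx_pairs (Or.inl rfl) (by omega)
  have hQ : ∀ f F, ∀ ε > 0, ∃ n, ∀ i j, n ≤ i → i ≤ j → j ≤ f i → F.idx i = F.idx j →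
      discr (γ (P f)) (α F) i j < ε := by
    intro f F ε hε
    obtain ⟨n₁, h1⟩ := hγ (P f) (ε / 2) (half_pos hε)
    obtain ⟨n₂, h2⟩ := hα.pairs (P f) F (half_pos hε)
    refine ⟨max n₁ n₂, fun i j hi hij hj hF => ?_⟩
    have e1 := h1 i j (le_of_max_le_left hi) hij (hPf f i j hj)
    have e2 := h2 _ i (le_of_max_le_right hi) j hij (hsame f i j hij hj) hF
    have := discr_triangle (γ (P f)) (α ((P f).pairs ((P f).idx i))) (α F) i j
    linarith
  have hcoh : IsCoherent fun f => γ (P f) := by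
    intro f g ε hε
    obtain ⟨n₁, h1⟩ := hγ (P f) (ε / 2) (half_pos hε)
    obtain ⟨n₂, h2⟩ := (P f).exists_eventually_pairs (p := fun F i => ∀ j, i ≤ j → j ≤ g i →
      F.idx i = F.idx j → discr (γ (P g)) (α F) i j < ε / 2) fun m => by
        obtain ⟨n, hn⟩ := hQ g ((P f).pairs m) (ε / 2) (half_pos hε)
        exact ⟨n, fun i hi j hij hj hF => hn i j hi hij hj hF⟩
    refine ⟨max n₁ n₂, fun i j hi hij hf hg => ?_⟩
    have e1 := h1 i j (le_of_max_le_left hi) hij (hPf f i j hf)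
    have e2 := h2 _ i (le_of_max_le_right hi) j hij hg (hsame f i j hij hf)
    have := discr_triangle (γ (P f)) (α ((P f).pairs ((P f).idx i))) (γ (P g)) i j
    rw [discr_comm] at e2
    change discr (γ (P f)) (γ (P g)) i j < ε
    linarith
  obtain ⟨b, hb⟩ := hcoh.exists_uniformization hOCA
  refine ⟨b, fun E ε hε => ?_⟩
  -- For this f, every pair i ≤ j in one interval of E satisfies j ≤ f i.
  let f : ℕ → ℕ := fun i => E.endpoint (E.idx i + 1)
  obtain ⟨n₁, h1⟩ := hb f (ε / 2) (half_pos hε)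
  obtain ⟨n₂, h2⟩ := hQ f E (ε / 2) (half_pos hε)
  refine ⟨max n₁ n₂, fun i j hi hij hE => ?_⟩
  have hj : j ≤ f i := by
    change j ≤ E.endpoint (E.idx i + 1)
    rw [hE]
    exact (E.lt_endpoint_idx_succ j).le
  have e1 := h1 i j (le_of_max_le_left hi) hij hj
  have e2 := h2 i j (le_of_max_le_right hi) hij hj hE
  have := discr_triangle b (γ (P f)) (α E) i j
  linarith

end BlockCoherent

/-! ### Operators given on an orthonormal basis -/

section Operators

open Filter Topology

set_option linter.unusedSectionVars false

variable {H : Type*} [NormedAddCommGroup H] [InnerProductSpace ℂ H] [CompleteSpace H]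

theorem HilbertBasis.clm_ext (ξ : HilbertBasis ℕ ℂ H) {A B : H →L[ℂ] H}
    (h : ∀ i, A (ξ i) = B (ξ i)) : A = B := by
  refine ContinuousLinearMap.ext_on ?_ (s := Set.range ξ) ?_
  · have := ξ.dense_span
    rw [Submodule.dense_iff_topologicalClosure_eq_top]
    exact this
  · rintro _ ⟨i, rfl⟩; exact h i

theorem HilbertBasis.ext_inner (ξ : HilbertBasis ℕ ℂ H) {x y : H}
    (h : ∀ i, ⟪ξ i, x⟫_ℂ = ⟪ξ i, y⟫_ℂ) : x = y := by
  refine ξ.repr.injective ?_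
  ext i
  rw [ξ.repr_apply_apply, ξ.repr_apply_apply, h]

theorem HilbertBasis.clm_ext_inner (ξ : HilbertBasis ℕ ℂ H) {A B : H →L[ℂ] H}
    (h : ∀ i j, ⟪ξ i, A (ξ j)⟫_ℂ = ⟪ξ i, B (ξ j)⟫_ℂ) : A = B :=
  ξ.clm_ext fun j => ξ.ext_inner fun i => h i j

theorem HilbertBasis.inner_eq (ξ : HilbertBasis ℕ ℂ H) (i j : ℕ) :
    ⟪ξ i, ξ j⟫_ℂ = if i = j then 1 else 0 := orthonormal_iff_ite.1 ξ.orthonormal i j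

theorem HilbertBasis.norm_eq_one (ξ : HilbertBasis ℕ ℂ H) (i : ℕ) : ‖ξ i‖ = 1 :=
  ξ.orthonormal.1 i

theorem norm_sq_sum_of_pairwise_inner_eq_zero {ι : Type*} {z : ι → H}
    (hz : ∀ i j, i ≠ j → ⟪z i, z j⟫_ℂ = 0) (s : Finset ι) :
    ‖∑ i ∈ s, z i‖ ^ 2 = ∑ i ∈ s, ‖z i‖ ^ 2 := by
  classical
  induction s using Finset.induction_on with
  | empty => simp
  | insert a s ha ih =>
    rw [Finset.sum_insert ha, Finset.sum_insert ha, ← ih, sq, sq, sq]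
    refine norm_add_sq_eq_norm_sq_add_norm_sq_of_inner_eq_zero _ _ ?_ (𝕜 := ℂ)
    rw [inner_sum]
    exact Finset.sum_eq_zero fun i hi => hz a i (by rintro rfl; exact ha hi)

/-- For orthogonal vectors of norm at most C, Pythagoras and Bessel bound the partial sums of ∑ ⟪ξ
i, x⟫ z i by C‖x‖ and make them converge. -/
theorem HilbertBasis.exists_clm (ξ : HilbertBasis ℕ ℂ H) {z : ℕ → H} {C : ℝ}
    (hz : ∀ i j, i ≠ j → ⟪z i, z j⟫_ℂ = 0) (hC : ∀ i, ‖z i‖ ≤ C) :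
    ∃ A : H →L[ℂ] H, (∀ i, A (ξ i) = z i) ∧ ‖A‖ ≤ C := by
  have hC0 : 0 ≤ C := (norm_nonneg _).trans (hC 0)
  have horth : ∀ x : H, ∀ i j, i ≠ j → ⟪⟪ξ i, x⟫_ℂ • z i, ⟪ξ j, x⟫_ℂ • z j⟫_ℂ = 0 := by
    intro x i j hij
    rw [inner_smul_left, inner_smul_right, hz i j hij]; simp
  have hbound : ∀ x : H, ∀ s : Finset ℕ,
      ‖∑ i ∈ s, ⟪ξ i, x⟫_ℂ • z i‖ ^ 2 ≤ C ^ 2 * ∑ i ∈ s, ‖⟪ξ i, x⟫_ℂ‖ ^ 2 := by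
    intro x s
    rw [norm_sq_sum_of_pairwise_inner_eq_zero (horth x), Finset.mul_sum]
    refine Finset.sum_le_sum fun i _ => ?_
    rw [norm_smul, mul_pow, mul_comm]
    gcongr
    exact hC i
  have hsum : ∀ x : H, Summable fun i => ⟪ξ i, x⟫_ℂ • z i := by
    intro x
    rw [summable_iff_vanishing_norm]
    intro ε hε
    have hs := (ξ.orthonormal.inner_products_summable x).mul_left (C ^ 2)
    rw [summable_iff_vanishing_norm] at hs
    obtain ⟨s, hs⟩ := hs (ε ^ 2) (by positivity)
    refine ⟨s, fun t ht => ?_⟩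
    have h1 := hs t ht
    rw [← Finset.mul_sum, Real.norm_of_nonneg (by positivity)] at h1
    exact lt_of_pow_lt_pow_left₀ 2 hε.le ((hbound x t).trans_lt h1)
  let A₀ : H →ₗ[ℂ] H :=
    { toFun := fun x => ∑' i, ⟪ξ i, x⟫_ℂ • z i
      map_add' := fun x y => by
        rw [← (hsum x).tsum_add (hsum y)]
        simp only [inner_add_right, add_smul]
      map_smul' := fun c x => by
        simp only [inner_smul_right, mul_smul, RingHom.id_apply]
        exact (hsum x).tsum_const_smul c }
  have hA₀ : ∀ x, ‖A₀ x‖ ≤ C * ‖x‖ := by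
    intro x
    refine le_of_tendsto (hsum x).hasSum.norm (Eventually.of_forall fun s => ?_)
    refine (sq_le_sq₀ (norm_nonneg _) (by positivity)).1 ?_
    rw [mul_pow]
    refine (hbound x s).trans ?_
    gcongr
    exact ξ.orthonormal.sum_inner_products_le x
  refine ⟨A₀.mkContinuous C hA₀, fun i => ?_, LinearMap.mkContinuous_norm_le _ hC0 _⟩
  change ∑' j, ⟪ξ j, ξ i⟫_ℂ • z j = z i
  rw [tsum_eq_single i]
  · rw [ξ.inner_eq, if_pos rfl, one_smul]
  · intro j hj; simp [ξ.inner_eq, hj]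

open Classical in
/-- The bounded operator which maps `ξ i` to `z i`, if there is one. -/
noncomputable def basisMap (ξ : HilbertBasis ℕ ℂ H) (z : ℕ → H) : H →L[ℂ] H :=
  if h : ∃ A : H →L[ℂ] H, ∀ i, A (ξ i) = z i then h.choose else 0

theorem basisMap_apply (ξ : HilbertBasis ℕ ℂ H) {z : ℕ → H} {C : ℝ}
    (hz : ∀ i j, i ≠ j → ⟪z i, z j⟫_ℂ = 0) (hC : ∀ i, ‖z i‖ ≤ C) (i : ℕ) :
    basisMap ξ z (ξ i) = z i := by
  have h : ∃ A : H →L[ℂ] H, ∀ i, A (ξ i) = z i :=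
    let ⟨A, hA, _⟩ := ξ.exists_clm hz hC; ⟨A, hA⟩
  rw [basisMap, dif_pos h]
  exact h.choose_spec i

/-- The diagonal operator with entries `c i`. -/
noncomputable def diagOp (ξ : HilbertBasis ℕ ℂ H) (c : ℕ → ℂ) : H →L[ℂ] H :=
  basisMap ξ fun i => c i • ξ i

section Diag

variable (ξ : HilbertBasis ℕ ℂ H) {c d : ℕ → ℂ} {C C' : ℝ}

theorem diag_orthogonal (c : ℕ → ℂ) (i j : ℕ) (hij : i ≠ j) : ⟪c i • ξ i, c j • ξ j⟫_ℂ = 0 := by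
  rw [inner_smul_left, inner_smul_right, ξ.inner_eq, if_neg hij]; simp

theorem diagOp_apply (hc : ∀ i, ‖c i‖ ≤ C) (i : ℕ) : diagOp ξ c (ξ i) = c i • ξ i :=
  basisMap_apply ξ (diag_orthogonal ξ c) (C := C)
    (fun i => by rw [norm_smul, ξ.norm_eq_one, mul_one]; exact hc i) i

theorem diagOp_norm_le (hc : ∀ i, ‖c i‖ ≤ C) : ‖diagOp ξ c‖ ≤ C := by
  obtain ⟨A, hA, hAC⟩ := ξ.exists_clm (diag_orthogonal ξ c) (C := C)
    (fun i => by rw [norm_smul, ξ.norm_eq_one, mul_one]; exact hc i)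
  have : diagOp ξ c = A := ξ.clm_ext fun i => by rw [diagOp_apply ξ hc, hA]
  rwa [this]

theorem diagOp_mul (hc : ∀ i, ‖c i‖ ≤ C) (hd : ∀ i, ‖d i‖ ≤ C') :
    diagOp ξ c * diagOp ξ d = diagOp ξ (fun i => c i * d i) := by
  refine ξ.clm_ext fun i => ?_
  have hcd : ∀ i, ‖c i * d i‖ ≤ C * C' := fun i => by
    rw [norm_mul]
    exact mul_le_mul (hc i) (hd i) (norm_nonneg _) ((norm_nonneg _).trans (hc 0))
  rw [mul_apply_eq_comp, diagOp_apply ξ hd, map_smul, diagOp_apply ξ hc,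
    diagOp_apply ξ hcd, smul_smul, mul_comm]

theorem star_diagOp (hc : ∀ i, ‖c i‖ ≤ C) :
    star (diagOp ξ c) = diagOp ξ (fun i => star (c i)) := by
  refine ξ.clm_ext_inner fun i j => ?_
  have hc' : ∀ i, ‖star (c i)‖ ≤ C := fun i => by rw [norm_star]; exact hc i
  rw [ContinuousLinearMap.star_eq_adjoint, ContinuousLinearMap.adjoint_inner_right,
    diagOp_apply ξ hc, diagOp_apply ξ hc', inner_smul_left, inner_smul_right, ξ.inner_eq]
  split_ifs with h
  · rw [h]; rfl
  · simp

theorem diagOp_const (a : ℂ) : diagOp ξ (fun _ => a) = a • (1 : H →L[ℂ] H) := by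
  refine ξ.clm_ext fun i => ?_
  rw [diagOp_apply ξ (C := ‖a‖) (fun _ => le_rfl)]
  rfl

end Diag

/-! ### Coordinate projections and block algebras -/

theorem basisProj_apply (ξ : HilbertBasis ℕ ℂ H) (M : Set ℕ) [DecidablePred (· ∈ M)] (i : ℕ) :
    basisProj ξ M (ξ i) = if i ∈ M then ξ i else 0 := by
  unfold basisProj
  split_ifs with h
  · rw [Submodule.starProjection_eq_self_iff]
    exact Submodule.le_topologicalClosure _ (Submodule.subset_span ⟨i, h, rfl⟩)
  · rw [Submodule.starProjection_apply_eq_zero_iff, Submodule.orthogonal_closure]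
    rw [Submodule.mem_orthogonal]
    intro u hu
    induction hu using Submodule.span_induction with
    | mem x hx =>
      obtain ⟨j, hj, rfl⟩ := hx
      rw [ξ.inner_eq, if_neg]
      rintro rfl; exact h hj
    | zero => simp
    | add x y _ _ hx hy => rw [inner_add_left, hx, hy, add_zero]
    | smul a x _ hx => rw [inner_smul_left, hx, mul_zero]

theorem star_basisProj (ξ : HilbertBasis ℕ ℂ H) (M : Set ℕ) :
    star (basisProj ξ M) = basisProj ξ M := by
  rw [ContinuousLinearMap.star_eq_adjoint]
  exact (ContinuousLinearMap.isSelfAdjoint_iff_isSymmetric.2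
    (Submodule.starProjection_isSymmetric _)).adjoint_eq

theorem inner_basisProj (ξ : HilbertBasis ℕ ℂ H) (M : Set ℕ) (x y : H) :
    ⟪basisProj ξ M x, y⟫_ℂ = ⟪x, basisProj ξ M y⟫_ℂ :=
  Submodule.inner_starProjection_left_eq_right _ x y

theorem norm_basisProj_apply_le (ξ : HilbertBasis ℕ ℂ H) (M : Set ℕ) (x : H) :
    ‖basisProj ξ M x‖ ≤ ‖x‖ := Submodule.norm_starProjection_apply_le _ x

theorem basisProj_mul (ξ : HilbertBasis ℕ ℂ H) (M N : Set ℕ) :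
    basisProj ξ M * basisProj ξ N = basisProj ξ (M ∩ N) := by
  classical
  refine ξ.clm_ext fun i => ?_
  rw [mul_apply_eq_comp, basisProj_apply, basisProj_apply]
  by_cases hN : i ∈ N <;> by_cases hM : i ∈ M <;> simp [hN, hM, basisProj_apply]

theorem basisProj_add_of_disjoint (ξ : HilbertBasis ℕ ℂ H) {M N : Set ℕ} (h : Disjoint M N) :
    basisProj ξ M + basisProj ξ N = basisProj ξ (M ∪ N) := by
  classical
  refine ξ.clm_ext fun i => ?_
  rw [add_apply, basisProj_apply, basisProj_apply, basisProj_apply]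
  by_cases hN : i ∈ N <;> by_cases hM : i ∈ M <;> simp [hN, hM]
  exact absurd hN (Set.disjoint_left.1 h hM)

theorem basisProj_univ (ξ : HilbertBasis ℕ ℂ H) : basisProj ξ Set.univ = 1 := by
  classical
  exact ξ.clm_ext fun i => by rw [basisProj_apply]; simp

theorem basisProj_empty (ξ : HilbertBasis ℕ ℂ H) : basisProj ξ ∅ = 0 := by
  classical
  exact ξ.clm_ext fun i => by rw [basisProj_apply]; simp

theorem basisProj_compl (ξ : HilbertBasis ℕ ℂ H) (M : Set ℕ) :
    basisProj ξ Mᶜ = 1 - basisProj ξ M := by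
  rw [eq_sub_iff_add_eq', basisProj_add_of_disjoint ξ disjoint_compl_right, Set.union_compl_self,
    basisProj_univ]

/-- Commuting with the interval projections kills exactly the matrix entries between different
intervals; all later membership checks are done on entries. -/
theorem mem_blockAlgebra_iff (ξ : HilbertBasis ℕ ℂ H) (E : IntervalPartition) (T : H →L[ℂ] H) :
    T ∈ blockAlgebra ξ E ↔ ∀ i j, E.idx i ≠ E.idx j → ⟪ξ i, T (ξ j)⟫_ℂ = 0 := by
  classical
  unfold blockAlgebra
  rw [StarSubalgebra.mem_centralizer_iff]
  simp only [Set.forall_mem_range, star_basisProj, and_self]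
  constructor
  · intro h i j hij
    have h1 := congrArg (fun A : H →L[ℂ] H => ⟪ξ i, A (ξ j)⟫_ℂ) (h (E.idx j))
    simp only [mul_apply_eq_comp] at h1
    rw [← inner_basisProj, basisProj_apply, basisProj_apply, if_neg, if_pos, inner_zero_left] at h1
    · exact h1.symm
    · exact E.mem_block.2 rfl
    · rw [E.mem_block]; exact hij
  · intro h n
    refine ξ.clm_ext_inner fun i j => ?_
    rw [mul_apply_eq_comp, mul_apply_eq_comp, ← inner_basisProj,
      basisProj_apply, basisProj_apply]
    simp only [E.mem_block]
    by_cases hij : E.idx i = E.idx j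
    · by_cases hj : E.idx j = n <;> simp [hij, hj]
    · have h0 := h i j hij
      by_cases hi : E.idx i = n <;> by_cases hj : E.idx j = n <;> simp [hi, hj, h0]

theorem diagOp_mem_blockAlgebra (ξ : HilbertBasis ℕ ℂ H) (E : IntervalPartition) {c : ℕ → ℂ}
    {C : ℝ} (hc : ∀ i, ‖c i‖ ≤ C) : diagOp ξ c ∈ blockAlgebra ξ E := by
  rw [mem_blockAlgebra_iff]
  intro i j hij
  have : i ≠ j := fun h => hij (h ▸ rfl)
  rw [diagOp_apply ξ hc, inner_smul_right, ξ.inner_eq, if_neg this, mul_zero]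

theorem basisProj_mem_blockAlgebra (ξ : HilbertBasis ℕ ℂ H) (E : IntervalPartition) (M : Set ℕ) :
    basisProj ξ M ∈ blockAlgebra ξ E := by
  classical
  rw [mem_blockAlgebra_iff]
  intro i j hij
  have : i ≠ j := fun h => hij (h ▸ rfl)
  rw [basisProj_apply]
  split_ifs <;> simp [ξ.inner_eq, this]

theorem tendsto_basisProj_Iio (ξ : HilbertBasis ℕ ℂ H) (x : H) :
    Tendsto (fun n => basisProj ξ (Set.Iio n) x) atTop (𝓝 x) := by
  classical
  have h : ∀ n, basisProj ξ (Set.Iio n) x = ∑ i ∈ Finset.range n, ξ.repr x i • ξ i := by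
    intro n
    refine ξ.ext_inner fun i => ?_
    rw [← inner_basisProj, basisProj_apply, inner_sum]
    simp only [inner_smul_right, ξ.inner_eq, mul_ite, mul_one, mul_zero, ξ.repr_apply_apply]
    rw [Finset.sum_ite_eq]
    simp only [Set.mem_Iio, Finset.mem_range]
    split_ifs <;> simp
  simp only [h]
  exact (ξ.hasSum_repr x).tendsto_sum_nat

/-! ### Compact operators -/

theorem Orthonormal.tendsto_inner_zero {x : ℕ → H} (hx : Orthonormal ℂ x) (y : H) :
    Tendsto (fun n => ⟪y, x n⟫_ℂ) atTop (𝓝 0) := by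
  have h := (hx.inner_products_summable y).tendsto_atTop_zero
  have h2 : Tendsto (fun n => ‖⟪x n, y⟫_ℂ‖) atTop (𝓝 0) := by
    have := h.sqrt
    simpa [Real.sqrt_sq] using this
  refine tendsto_zero_iff_norm_tendsto_zero.2 ?_
  simpa only [norm_inner_symm] using h2

/-- Orthonormal sequences tend weakly to zero. Any norm limit y of a subsequence of K (x n)
therefore satisfies ⟪y, y⟫ = lim ⟪K* y, x n⟫ = 0, and compactness supplies such subsequences. -/
theorem tendsto_zero_of_mem_compactIdeal {K : H →L[ℂ] H} (hK : K ∈ compactIdeal H) {x : ℕ → H}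
    (hx : Orthonormal ℂ x) : Tendsto (fun n => K (x n)) atTop (𝓝 0) := by
  have hK' : IsCompactOperator K := hK
  have hcpt := hK'.isCompact_closure_image_closedBall (f := (K : H →ₗ[ℂ] H)) 1
  refine tendsto_of_subseq_tendsto fun ns hns => ?_
  obtain ⟨y, -, ms, hms, hy⟩ := hcpt.tendsto_subseq (x := fun n => K (x (ns n))) fun n =>
    subset_closure ⟨x (ns n), by simp [hx.1], rfl⟩
  refine ⟨ms, ?_⟩
  have h1 : Tendsto (fun n => ⟪y, K (x (ns (ms n)))⟫_ℂ) atTop (𝓝 ⟪y, y⟫_ℂ) :=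
    tendsto_const_nhds.inner hy
  have h2 : Tendsto (fun n => ⟪y, K (x (ns (ms n)))⟫_ℂ) atTop (𝓝 0) := by
    have := ((hx.tendsto_inner_zero (star K y)).comp hns).comp hms.tendsto_atTop
    refine this.congr fun n => ?_
    rw [ContinuousLinearMap.star_eq_adjoint]
    exact ContinuousLinearMap.adjoint_inner_left _ _ _
  have : y = 0 := inner_self_eq_zero.1 (tendsto_nhds_unique h1 h2)
  rw [this] at hy
  exact hy

theorem isClosed_compactIdeal : IsClosed (compactIdeal H : Set (H →L[ℂ] H)) :=
  isClosed_setOfPred_isCompactOperator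

theorem mem_compactIdeal_of_forall_norm_le {T : H →L[ℂ] H}
    (h : ∀ ε > 0, ∃ K ∈ compactIdeal H, ‖T - K‖ ≤ ε) : T ∈ compactIdeal H := by
  have : T ∈ closure (compactIdeal H : Set (H →L[ℂ] H)) := by
    rw [Metric.mem_closure_iff]
    intro ε hε
    obtain ⟨K, hK, hle⟩ := h (ε / 2) (half_pos hε)
    exact ⟨K, hK, by rw [dist_eq_norm]; linarith⟩
  rwa [isClosed_compactIdeal.closure_eq] at this

theorem basisProj_mem_compactIdeal (ξ : HilbertBasis ℕ ℂ H) {M : Set ℕ} (hM : M.Finite) :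
    basisProj ξ M ∈ compactIdeal H := by
  have : FiniteDimensional ℂ (Submodule.span ℂ (ξ '' M)).topologicalClosure := by
    have h1 : FiniteDimensional ℂ (Submodule.span ℂ (ξ '' M)) :=
      FiniteDimensional.span_of_finite ℂ (hM.image _)
    rw [(Submodule.closed_of_finiteDimensional _).submodule_topologicalClosure_eq]
    exact h1
  let V := (Submodule.span ℂ (ξ '' M)).topologicalClosure
  have : ProperSpace V := FiniteDimensional.proper ℂ V
  have h2 : IsCompactOperator V.orthogonalProjectionOnto :=
    isCompactOperator_of_locallyCompactSpace_dom V.orthogonalProjectionOnto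
  exact h2.clm_comp V.subtypeL

theorem diagOp_mem_compactIdeal (ξ : HilbertBasis ℕ ℂ H) {c : ℕ → ℂ}
    (hc : Tendsto c atTop (𝓝 0)) : diagOp ξ c ∈ compactIdeal H := by
  classical
  obtain ⟨C, hC⟩ : ∃ C, ∀ i, ‖c i‖ ≤ C := by
    obtain ⟨C, hC⟩ := hc.norm.bddAbove_range
    exact ⟨C, fun i => hC ⟨i, rfl⟩⟩
  refine mem_compactIdeal_of_forall_norm_le fun ε hε => ?_
  obtain ⟨N, hN⟩ := Metric.tendsto_atTop.1 hc ε hε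
  refine ⟨diagOp ξ c * basisProj ξ (Set.Iio N),
    (compactIdeal H).mul_mem_left _ (basisProj_mem_compactIdeal ξ (Set.finite_Iio N)), ?_⟩
  have hd : ∀ i, ‖if i < N then 0 else c i‖ ≤ ε := by
    intro i
    split_ifs with h
    · simpa using hε.le
    · simpa using (hN i (not_lt.1 h)).le
  have : diagOp ξ c - diagOp ξ c * basisProj ξ (Set.Iio N) =
      diagOp ξ (fun i => if i < N then 0 else c i) := by
    refine ξ.clm_ext fun i => ?_
    rw [sub_apply, mul_apply_eq_comp, diagOp_apply ξ hd,
      basisProj_apply]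
    by_cases h : i < N <;> simp [h, diagOp_apply ξ hC]
  rw [this]
  exact diagOp_norm_le ξ hd

theorem tendsto_of_diagOp_mem_compactIdeal (ξ : HilbertBasis ℕ ℂ H) {c : ℕ → ℂ} {C : ℝ}
    (hC : ∀ i, ‖c i‖ ≤ C) (h : diagOp ξ c ∈ compactIdeal H) : Tendsto c atTop (𝓝 0) := by
  have := (tendsto_zero_of_mem_compactIdeal h ξ.orthonormal).norm
  simp only [diagOp_apply ξ hC, norm_smul, ξ.norm_eq_one, mul_one, norm_zero] at this
  exact tendsto_zero_iff_norm_tendsto_zero.2 this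

theorem one_notMem_compactIdeal (ξ : HilbertBasis ℕ ℂ H) : (1 : H →L[ℂ] H) ∉ compactIdeal H := by
  intro h
  have := (tendsto_zero_of_mem_compactIdeal h ξ.orthonormal).norm
  simp [ξ.norm_eq_one] at this

theorem q_eq_q_iff {S T : H →L[ℂ] H} :
    Calkin.q H S = Calkin.q H T ↔ S - T ∈ compactIdeal H := Ideal.Quotient.eq

theorem q_eq_zero_iff {T : H →L[ℂ] H} : Calkin.q H T = 0 ↔ T ∈ compactIdeal H :=
  Ideal.Quotient.eq_zero_iff_mem

theorem q_surjective : Function.Surjective (Calkin.q H) := Ideal.Quotient.mk_surjective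

end Operators

/-! ### Operators which commute with the diagonal operators modulo the compact operators -/

section EssentialCommutant

open Filter Topology

set_option linter.unusedSectionVars false

variable {H : Type*} [NormedAddCommGroup H] [InnerProductSpace ℂ H] [CompleteSpace H]

theorem tendsto_basisProj_comp (ξ : HilbertBasis ℕ ℂ H) (A : H →L[ℂ] H) (x : H) :
    Tendsto (fun n => basisProj ξ (Set.Iio n) (A (basisProj ξ (Set.Iio n) x))) atTop
      (𝓝 (A x)) := by
  have h1 : Tendsto (fun n => A (basisProj ξ (Set.Iio n) x)) atTop (𝓝 (A x)) :=
    (A.continuous.tendsto x).comp (tendsto_basisProj_Iio ξ x)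
  have h2 : Tendsto (fun n => basisProj ξ (Set.Iio n) (A (basisProj ξ (Set.Iio n) x) - A x)) atTop
      (𝓝 0) := by
    refine squeeze_zero_norm (fun n => norm_basisProj_apply_le ξ _ _) ?_
    simpa using (h1.sub_const (A x)).norm
  simpa using h2.add (tendsto_basisProj_Iio ξ (A x))

/-- Removing a finite corner changes A by a compact operator. The tail that remains is a strong
limit of compressions to finite sets beyond n, so its norm is at most ε. -/
theorem mem_compactIdeal_of_forall_finset (ξ : HilbertBasis ℕ ℂ H) {A : H →L[ℂ] H}
    (h : ∀ ε > 0, ∃ n, ∀ J : Finset ℕ, (∀ i ∈ J, n ≤ i) →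
      ‖basisProj ξ J * A * basisProj ξ J‖ ≤ ε) : A ∈ compactIdeal H := by
  refine mem_compactIdeal_of_forall_norm_le fun ε hε => ?_
  obtain ⟨n, hn⟩ := h ε hε
  let P := basisProj ξ (Set.Iio n)
  have hP : P ∈ compactIdeal H := basisProj_mem_compactIdeal ξ (Set.finite_Iio n)
  refine ⟨A - (1 - P) * A * (1 - P), ?_, ?_⟩
  · have : A - (1 - P) * A * (1 - P) = P * A + (1 - P) * A * P := by noncomm_ring
    rw [this]
    exact (compactIdeal H).add_mem ((compactIdeal H).mul_mem_right _ hP)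
      ((compactIdeal H).mul_mem_left _ hP)
  · rw [sub_sub_cancel]
    refine ContinuousLinearMap.opNorm_le_bound _ hε.le fun x => ?_
    refine le_of_tendsto (tendsto_basisProj_comp ξ _ x).norm ?_
    filter_upwards [eventually_ge_atTop n] with N hN
    have hJ : basisProj ξ (Set.Iio N) * (1 - P) = basisProj ξ (Finset.Ico n N : Finset ℕ) := by
      rw [← basisProj_compl, basisProj_mul]
      congr 1
      ext i; simp; omega
    have hJ' : (1 - P) * basisProj ξ (Set.Iio N) = basisProj ξ (Finset.Ico n N : Finset ℕ) := by
      rw [← basisProj_compl, basisProj_mul]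
      congr 1
      ext i; simp
    have := (ContinuousLinearMap.le_opNorm (basisProj ξ (Finset.Ico n N : Finset ℕ) * A *
      basisProj ξ (Finset.Ico n N : Finset ℕ)) x).trans
      (mul_le_mul_of_nonneg_right (hn (Finset.Ico n N) fun i hi => (Finset.mem_Ico.1 hi).1)
        (norm_nonneg x))
    refine le_trans (le_of_eq ?_) this
    rw [← hJ]
    nth_rewrite 2 [hJ]
    rw [← hJ']
    rfl

/-- A sequence of signs. -/
def IsSign (s : ℕ → ℂ) : Prop := ∀ i, s i = 1 ∨ s i = -1

theorem IsSign.norm_le {s : ℕ → ℂ} (hs : IsSign s) (i : ℕ) : ‖s i‖ ≤ 1 := by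
  rcases hs i with h | h <;> simp [h]

theorem IsSign.mul_self {s : ℕ → ℂ} (hs : IsSign s) (i : ℕ) : s i * s i = 1 := by
  rcases hs i with h | h <;> simp [h]

theorem IsSign.mul {s t : ℕ → ℂ} (hs : IsSign s) (ht : IsSign t) : IsSign fun i => s i * t i := by
  intro i
  rcases hs i with h | h <;> rcases ht i with h' | h' <;> simp [h, h']

theorem IsSign.star_eq {s : ℕ → ℂ} (hs : IsSign s) (i : ℕ) : star (s i) = s i := by
  rcases hs i with h | h <;> simp [h]

theorem IsSign.diagOp_mul_self (ξ : HilbertBasis ℕ ℂ H) {s : ℕ → ℂ} (hs : IsSign s) :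
    diagOp ξ s * diagOp ξ s = 1 := by
  rw [diagOp_mul ξ hs.norm_le hs.norm_le]
  simp only [hs.mul_self]
  rw [diagOp_const, one_smul]

theorem inner_diagOp_conj (ξ : HilbertBasis ℕ ℂ H) {s : ℕ → ℂ} (hs : IsSign s) (B : H →L[ℂ] H)
    (i j : ℕ) : ⟪ξ i, (diagOp ξ s * B * diagOp ξ s) (ξ j)⟫_ℂ = s i * s j * ⟪ξ i, B (ξ j)⟫_ℂ := by
  have h1 : star (diagOp ξ s) = diagOp ξ s := by
    rw [star_diagOp ξ hs.norm_le]; simp only [hs.star_eq]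
  have h2 : ∀ x y : H, ⟪x, diagOp ξ s y⟫_ℂ = ⟪diagOp ξ s x, y⟫_ℂ := fun x y => by
    nth_rewrite 1 [← h1]
    exact ContinuousLinearMap.adjoint_inner_right _ _ _
  rw [mul_assoc, mul_apply_eq_comp, mul_apply_eq_comp, h2, diagOp_apply ξ hs.norm_le,
    diagOp_apply ξ hs.norm_le, map_smul, inner_smul_left, inner_smul_right]
  have := hs.star_eq i
  rw [← starRingEnd_apply] at this
  rw [this, mul_assoc]

/-- Averaging with the conjugate by the sign flip at k kills the off-diagonal entries in row and
column k. The bound survives the induction because it is convex and quantified over all signs, which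
form a group. -/
theorem exists_average (ξ : HilbertBasis ℕ ℂ H) {B : H →L[ℂ] H} {ε : ℝ}
    (h : ∀ s, IsSign s → ‖diagOp ξ s * B * diagOp ξ s - B‖ ≤ ε) (F : Finset ℕ) :
    ∃ B' : H →L[ℂ] H, (∀ s, IsSign s → ‖diagOp ξ s * B' * diagOp ξ s - B‖ ≤ ε) ∧
      ∀ i j, ⟪ξ i, B' (ξ j)⟫_ℂ = if i ≠ j ∧ (i ∈ F ∨ j ∈ F) then 0 else ⟪ξ i, B (ξ j)⟫_ℂ := by
  classical
  induction F using Finset.induction_on with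
  | empty => exact ⟨B, h, by simp⟩
  | insert k F hk ih =>
    obtain ⟨B', h1, h2⟩ := ih
    let t : ℕ → ℂ := fun i => if i = k then -1 else 1
    have ht : IsSign t := fun i => by
      by_cases hi : i = k <;> simp [t, hi]
    refine ⟨(1 / 2 : ℂ) • (B' + diagOp ξ t * B' * diagOp ξ t), fun s hs => ?_, fun i j => ?_⟩
    · have hst : diagOp ξ (fun i => s i * t i) = diagOp ξ s * diagOp ξ t :=
        (diagOp_mul ξ hs.norm_le ht.norm_le).symm
      have hts : diagOp ξ (fun i => s i * t i) = diagOp ξ t * diagOp ξ s := by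
        rw [diagOp_mul ξ ht.norm_le hs.norm_le]; simp only [mul_comm]
      have e1 := h1 s hs
      have e2 := h1 _ (hs.mul ht)
      nth_rewrite 1 [hst] at e2
      rw [hts] at e2
      have key : diagOp ξ s * ((1 / 2 : ℂ) • (B' + diagOp ξ t * B' * diagOp ξ t)) * diagOp ξ s - B
          = (1 / 2 : ℂ) • ((diagOp ξ s * B' * diagOp ξ s - B) +
            (diagOp ξ s * diagOp ξ t * B' * (diagOp ξ t * diagOp ξ s) - B)) := by
        simp only [mul_smul_comm, smul_mul_assoc, mul_add, add_mul, mul_assoc, smul_add, smul_sub]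
        have : (1 / 2 : ℂ) • B + (1 / 2 : ℂ) • B = B := by rw [← add_smul]; norm_num
        conv_lhs => rw [← this]
        abel
      rw [key, norm_smul]
      have := norm_add_le (diagOp ξ s * B' * diagOp ξ s - B)
        (diagOp ξ s * diagOp ξ t * B' * (diagOp ξ t * diagOp ξ s) - B)
      norm_num
      linarith
    · rw [smul_apply, inner_smul_right, add_apply, inner_add_right, inner_diagOp_conj ξ ht, h2]
      by_cases hij : i = j
      · subst hij
        simp only [ne_eq, not_true_eq_false, false_and, if_false, ht.mul_self]
        ring
      · by_cases hi : i = k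
        · have hj : j ≠ k := fun h => hij (hi.trans h.symm)
          have e1 : t i * t j = -1 := by simp [t, hi, hj]
          rw [e1, if_pos (c := i ≠ j ∧ (i ∈ insert k F ∨ j ∈ insert k F))
            ⟨hij, Or.inl (by simp [hi])⟩]
          ring
        · by_cases hj : j = k
          · have e1 : t i * t j = -1 := by simp [t, hi, hj]
            rw [e1, if_pos (c := i ≠ j ∧ (i ∈ insert k F ∨ j ∈ insert k F))
              ⟨hij, Or.inr (by simp [hj])⟩]
            ring
          · simp only [t, hi, hj, if_false, Finset.mem_insert, false_or]
            split_ifs <;> ring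

/-- The diagonal entries of an operator. -/
noncomputable def diagEntries (ξ : HilbertBasis ℕ ℂ H) (T : H →L[ℂ] H) (i : ℕ) : ℂ := ⟪ξ i, T (ξ i)⟫_ℂ

theorem norm_diagEntries_le (ξ : HilbertBasis ℕ ℂ H) (T : H →L[ℂ] H) (i : ℕ) :
    ‖diagEntries ξ T i‖ ≤ ‖T‖ := by
  refine (norm_inner_le_norm _ _).trans ?_
  have := T.le_opNorm (ξ i)
  rw [ξ.norm_eq_one] at *
  linarith

/-- Averaging over all flips in J turns the compression of T into its diagonal part, at distance at
most ε. -/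
theorem norm_sub_diag_le (ξ : HilbertBasis ℕ ℂ H) (T : H →L[ℂ] H) (J : Finset ℕ) {ε : ℝ}
    (h : ∀ s, IsSign s → ‖diagOp ξ s * (basisProj ξ J * T * basisProj ξ J) * diagOp ξ s -
      basisProj ξ J * T * basisProj ξ J‖ ≤ ε) :
    ‖basisProj ξ J * (T - diagOp ξ (diagEntries ξ T)) * basisProj ξ J‖ ≤ ε := by
  classical
  obtain ⟨B', h1, h2⟩ := exists_average ξ h J
  have hone := h1 (fun _ => 1) fun _ => Or.inl rfl
  rw [diagOp_const, one_smul, one_mul, mul_one, ← norm_neg] at hone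
  refine le_trans (le_of_eq (congrArg norm ?_)) hone
  refine ξ.clm_ext_inner fun i j => ?_
  rw [neg_sub, sub_apply, inner_sub_right, h2]
  simp only [mul_assoc, mul_apply_eq_comp, ← inner_basisProj, basisProj_apply]
  by_cases hi : i ∈ (J : Set ℕ) <;> by_cases hj : j ∈ (J : Set ℕ)
  · simp only [hi, hj, if_true, sub_apply, inner_sub_right,
      diagOp_apply ξ (norm_diagEntries_le ξ T), inner_smul_right, ξ.inner_eq]
    by_cases hij : i = j
    · subst hij; simp [diagEntries]
    · have : i ∈ J := hi
      simp [hij, this]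
  all_goals simp [hi, hj]

/-- The contrapositive of `norm_sub_diag_le` with a witness localized in J: for a sign operator D,
conjugation of P T P differs from P T P by −P (T D − D T) P D. The localized witness is what a
gliding hump needs. -/
theorem exists_unit_of_lt_norm (ξ : HilbertBasis ℕ ℂ H) (T : H →L[ℂ] H) (J : Finset ℕ) {ε : ℝ}
    (hε : 0 < ε) (h : ε < ‖basisProj ξ J * (T - diagOp ξ (diagEntries ξ T)) * basisProj ξ J‖) :
    ∃ s, IsSign s ∧ ∃ u : H, ‖u‖ = 1 ∧ basisProj ξ J u = u ∧
      ε < ‖basisProj ξ J ((T * diagOp ξ s - diagOp ξ s * T) u)‖ := by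
  by_contra! hcon
  refine absurd h (not_lt.2 (norm_sub_diag_le ξ T J fun s hs => ?_))
  refine ContinuousLinearMap.opNorm_le_bound _ hε.le fun x => ?_
  set P := basisProj ξ J with hP
  set D := diagOp ξ s with hD
  have hPP : P * P = P := by rw [hP, basisProj_mul, Set.inter_self]
  have hDD : D * D = 1 := hs.diagOp_mul_self ξ
  have hPD : P * D = D * P := by
    classical
    refine ξ.clm_ext fun i => ?_
    simp only [mul_apply_eq_comp, hP, hD, diagOp_apply ξ hs.norm_le,
      basisProj_apply, map_smul]
    split_ifs <;> simp [diagOp_apply ξ hs.norm_le]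
  have hid : D * (P * T * P) * D - P * T * P = -(P * (T * D - D * T) * (P * D)) := by
    have e1 : P * (T * D - D * T) * (P * D) = P * T * (D * P) * D - (P * D) * T * P * D := by
      noncomm_ring
    rw [e1, ← hPD, hPD]
    have e2 : P * T * (D * P) * D = P * T * P := by
      rw [← hPD, mul_assoc, mul_assoc P D D, hDD, mul_one]
    rw [e2]
    noncomm_ring
  rw [hid, neg_apply, norm_neg]
  set y := (P * D) x with hy
  have hyx : ‖y‖ ≤ ‖x‖ := by
    have h1 : ‖D x‖ ≤ 1 * ‖x‖ := (D.le_opNorm x).trans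
      (mul_le_mul_of_nonneg_right (diagOp_norm_le ξ hs.norm_le) (norm_nonneg _))
    rw [one_mul] at h1
    exact (norm_basisProj_apply_le ξ _ _).trans h1
  have hPy : P y = y := by
    rw [hy, ← mul_apply_eq_comp, ← mul_assoc, hPP]
  refine le_trans ?_ (mul_le_mul_of_nonneg_left hyx hε.le)
  change ‖P ((T * D - D * T) y)‖ ≤ ε * ‖y‖
  by_cases hy0 : y = 0
  · simp [hy0]
  · have hn : ‖y‖ ≠ 0 := norm_ne_zero_iff.2 hy0
    have key := hcon s hs (((‖y‖ : ℂ)⁻¹) • y) (by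
      rw [norm_smul, norm_inv, Complex.norm_real, norm_norm, inv_mul_cancel₀ hn])
      (by rw [map_smul, hPy])
    rw [map_smul, map_smul, norm_smul, norm_inv, Complex.norm_real, norm_norm,
      inv_mul_le_iff₀ (by positivity)] at key
    linarith

/-- An operator that commutes modulo the compact operators with all diagonal operators is diagonal
modulo the compact operators. -/
theorem sub_diagOp_mem_compactIdeal (ξ : HilbertBasis ℕ ℂ H) {T : H →L[ℂ] H}
    (hT : ∀ s, IsSign s → T * diagOp ξ s - diagOp ξ s * T ∈ compactIdeal H) :
    T - diagOp ξ (diagEntries ξ T) ∈ compactIdeal H := by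
  classical
  refine mem_compactIdeal_of_forall_finset ξ fun ε hε => ?_
  by_contra! hcon
  choose J hJ hJε using hcon
  choose s hs u hu1 huJ hlt using fun n => exists_unit_of_lt_norm ξ T (J n) hε (hJε n)
  -- Gliding hump: the sets J (A.endpoint k) lie in distinct intervals of A.
  obtain ⟨E, hE⟩ := IntervalPartition.exists_lt_endpoint fun i => (J i).sup id
  let A := E.evenPairs
  have hJA : ∀ k, ∀ i ∈ J (A.endpoint k), A.idx i = k := by
    intro k i hi
    refine A.idx_eq_iff.2 ⟨hJ _ i hi, ?_⟩
    have h1 := hE (2 * k + 1) (A.endpoint k) (E.strictMono (Nat.lt_succ_self _))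
    exact (Finset.le_sup (f := id) hi).trans_lt h1
  -- One sign sequence agreeing with the k-th witness on the k-th set. Its compact commutator would
  -- have to tend to zero on the orthonormal vectors u' k, yet it stays above ε there.
  let s' : ℕ → ℂ := fun i => s (A.endpoint (A.idx i)) i
  have hs' : IsSign s' := fun i => hs _ i
  let u' : ℕ → H := fun k => u (A.endpoint k)
  have hu' : Orthonormal ℂ u' := by
    refine ⟨fun k => hu1 _, fun k l hkl => ?_⟩
    change ⟪u (A.endpoint k), u (A.endpoint l)⟫_ℂ = 0
    rw [← huJ (A.endpoint k), ← huJ (A.endpoint l), inner_basisProj, ← mul_apply_eq_comp,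
      basisProj_mul]
    have : (J (A.endpoint k) : Set ℕ) ∩ J (A.endpoint l) = ∅ := by
      ext i
      simp only [Set.mem_inter_iff, Finset.mem_coe, Set.mem_empty_iff_false, iff_false]
      exact fun h => hkl ((hJA k i h.1).symm.trans (hJA l i h.2))
    rw [this, basisProj_empty]
    simp
  have hlim := (tendsto_zero_of_mem_compactIdeal (hT s' hs') hu').norm
  rw [norm_zero] at hlim
  obtain ⟨k, hk⟩ := (hlim.eventually (gt_mem_nhds hε)).exists
  have hlt' := hlt (A.endpoint k)
  set P := basisProj ξ (J (A.endpoint k)) with hP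
  have hDP : ∀ i ∈ J (A.endpoint k), s' i = s (A.endpoint k) i := fun i hi => by
    simp only [s', hJA k i hi]
  have e1 : diagOp ξ s' * P = diagOp ξ (s (A.endpoint k)) * P := by
    refine ξ.clm_ext fun i => ?_
    rw [mul_apply_eq_comp, mul_apply_eq_comp, hP, basisProj_apply]
    split_ifs with hi
    · rw [diagOp_apply ξ hs'.norm_le, diagOp_apply ξ (hs _).norm_le, hDP i hi]
    · simp
  have e2 : P * diagOp ξ s' = P * diagOp ξ (s (A.endpoint k)) := by
    refine ξ.clm_ext fun i => ?_
    rw [mul_apply_eq_comp, mul_apply_eq_comp, diagOp_apply ξ hs'.norm_le,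
      diagOp_apply ξ (hs _).norm_le, map_smul, map_smul, hP, basisProj_apply]
    split_ifs with hi
    · rw [hDP i hi]
    · simp
  have e3 : P ((T * diagOp ξ (s (A.endpoint k)) - diagOp ξ (s (A.endpoint k)) * T)
      (u (A.endpoint k))) = P ((T * diagOp ξ s' - diagOp ξ s' * T) (u' k)) := by
    change _ = P ((T * diagOp ξ s' - diagOp ξ s' * T) (u (A.endpoint k)))
    rw [← huJ (A.endpoint k), ← hP]
    have : P * (T * diagOp ξ (s (A.endpoint k)) - diagOp ξ (s (A.endpoint k)) * T) * P =
        P * (T * diagOp ξ s' - diagOp ξ s' * T) * P := by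
      have e4 : ∀ D : H →L[ℂ] H, P * (T * D - D * T) * P = P * T * (D * P) - P * D * T * P :=
        fun D => by noncomm_ring
      rw [e4, e4, e1, e2]
    exact congrArg (fun B : H →L[ℂ] H => B (u (A.endpoint k))) this
  rw [e3] at hlt'
  exact absurd (hlt'.trans_le (norm_basisProj_apply_le ξ _ _)) (not_lt.2 hk.le)

end EssentialCommutant

/-! ### Ranks of projections under strongly continuous homomorphisms -/

section Ranks

open Filter Topology

set_option linter.unusedSectionVars false

variable {H : Type*} [NormedAddCommGroup H] [InnerProductSpace ℂ H] [CompleteSpace H]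

/-- A strongly continuous projection-valued measure on `ℕ` whose atoms are compact. -/
structure IsCompactMeasure (Q : Set ℕ → H →L[ℂ] H) : Prop where
  star_eq : ∀ M, star (Q M) = Q M
  mul_eq : ∀ M N, Q M * Q N = Q (M ∩ N)
  add_eq : ∀ M N, Disjoint M N → Q M + Q N = Q (M ∪ N)
  tendsto : ∀ x, Tendsto (fun n => Q (Set.Iio n) x) atTop (𝓝 (Q Set.univ x))
  compact : ∀ i, Q {i} ∈ compactIdeal H

namespace IsCompactMeasure

variable {Q Q' : Set ℕ → H →L[ℂ] H} (hQ : IsCompactMeasure Q)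

include hQ

theorem inner_eq (M : Set ℕ) (x y : H) : ⟪Q M x, y⟫_ℂ = ⟪x, Q M y⟫_ℂ := by
  nth_rewrite 1 [← hQ.star_eq M]
  exact ContinuousLinearMap.adjoint_inner_left _ _ _

theorem norm_apply_le (M : Set ℕ) (x : H) : ‖Q M x‖ ≤ ‖x‖ := by
  have h1 : ‖Q M x‖ ^ 2 ≤ ‖x‖ * ‖Q M x‖ := by
    have h2 : ⟪Q M x, Q M x⟫_ℂ = ⟪x, Q M x⟫_ℂ := by
      rw [hQ.inner_eq, ← mul_apply_eq_comp, hQ.mul_eq, Set.inter_self]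
    have h3 : ‖Q M x‖ ^ 2 = ‖⟪x, Q M x⟫_ℂ‖ := by
      rw [← h2, inner_self_eq_norm_sq_to_K]; simp
    rw [h3]
    exact norm_inner_le_norm _ _
  rcases (norm_nonneg (Q M x)).eq_or_lt with h | h
  · rw [← h]; exact norm_nonneg x
  · nlinarith

theorem empty_eq : Q ∅ = 0 := by
  have := hQ.add_eq ∅ ∅ (by simp)
  simpa using this

theorem norm_apply_le_of_subset {M N : Set ℕ} (h : M ⊆ N) (x : H) : ‖Q M x‖ ≤ ‖Q N x‖ := by
  have : Q M = Q M * Q N := by rw [hQ.mul_eq, Set.inter_eq_left.2 h]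
  rw [this, mul_apply_eq_comp]
  exact hQ.norm_apply_le _ _

theorem Iio_add_Ici (n : ℕ) : Q (Set.Iio n) + Q (Set.Ici n) = Q Set.univ := by
  rw [hQ.add_eq _ _ (Set.Iio_disjoint_Ici le_rfl), Set.Iio_union_Ici]

theorem tendsto_Ici (x : H) : Tendsto (fun n => Q (Set.Ici n) x) atTop (𝓝 0) := by
  have h1 := (tendsto_const_nhds (x := Q Set.univ x)).sub (hQ.tendsto x)
  rw [sub_self] at h1
  refine h1.congr fun n => ?_
  rw [← hQ.Iio_add_Ici n, add_apply, add_sub_cancel_left]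

theorem Iio_mem (n : ℕ) : Q (Set.Iio n) ∈ compactIdeal H := by
  induction n with
  | zero =>
    have : Set.Iio 0 = (∅ : Set ℕ) := by ext; simp
    rw [this, hQ.empty_eq]; exact zero_mem _
  | succ n ih =>
    have : Set.Iio (n + 1) = Set.Iio n ∪ {n} := by ext; simp
    rw [this, ← hQ.add_eq _ _ (by simp)]
    exact add_mem ih (hQ.compact n)

theorem apply_of_mem_range {M : Set ℕ} {x : H} (hx : x ∈ (Q M).range) : Q M x = x := by
  obtain ⟨y, rfl⟩ := hx
  change Q M (Q M y) = Q M y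
  rw [← mul_apply_eq_comp, hQ.mul_eq, Set.inter_self]

/-- On its closed range the compact projection Q {i} is the identity, so the range has compact
identity. -/
theorem finiteDimensional (i : ℕ) : FiniteDimensional ℂ (Q {i}).range := by
  refine FiniteDimensional.of_isCompactOperator_id (𝕜 := ℂ) ?_
  let V := (Q {i}).range
  have hcl : IsClosed (V : Set H) := by
    have : (V : Set H) = {x | Q {i} x = x} := by
      ext x
      exact ⟨fun hx => hQ.apply_of_mem_range hx, fun hx => ⟨x, hx⟩⟩
    rw [this]
    exact isClosed_eq (Q {i}).continuous continuous_id
  have hK : IsCompactOperator (Q {i} ∘ V.subtypeL) :=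
    IsCompactOperator.comp_clm (hQ.compact i) V.subtypeL
  have := hK.codRestrict (V := V) (fun x => ⟨x, rfl⟩) hcl
  have he : Set.codRestrict (Q {i} ∘ V.subtypeL) V (fun x => ⟨x, rfl⟩) = id :=
    funext fun x => Subtype.ext (hQ.apply_of_mem_range x.2)
  rw [he] at this
  exact this

/-- The rank of an atom. -/
noncomputable def _root_.atomRank (Q : Set ℕ → H →L[ℂ] H) (i : ℕ) : ℕ :=
  Module.finrank ℂ (Q {i}).range

/-- By dimension count, Q {i} W has a kernel on the range of Q' {i}. -/
theorem exists_unit (hQ' : IsCompactMeasure Q') (W : H →L[ℂ] H) {i : ℕ}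
    (h : atomRank Q i < atomRank Q' i) :
    ∃ x : H, ‖x‖ = 1 ∧ Q' {i} x = x ∧ Q {i} (W x) = 0 := by
  have := hQ.finiteDimensional i
  have := hQ'.finiteDimensional i
  let f : (Q' {i}).range →ₗ[ℂ] (Q {i}).range :=
    ((Q {i} : H →ₗ[ℂ] H).rangeRestrict ∘ₗ (W : H →ₗ[ℂ] H)) ∘ₗ (Q' {i}).range.subtype
  have hker : LinearMap.ker f ≠ ⊥ := LinearMap.ker_ne_bot_of_finrank_lt h
  obtain ⟨y, hy, hy0⟩ := (Submodule.ne_bot_iff _).1 hker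
  have hy1 : Q {i} (W y) = 0 := congrArg Subtype.val (LinearMap.mem_ker.1 hy)
  have hn : ‖(y : H)‖ ≠ 0 := norm_ne_zero_iff.2 fun h => hy0 (Subtype.ext h)
  refine ⟨((‖(y : H)‖ : ℂ)⁻¹) • (y : H), ?_, ?_, ?_⟩
  · rw [norm_smul, norm_inv, Complex.norm_real, norm_norm, inv_mul_cancel₀ hn]
  · rw [map_smul, hQ'.apply_of_mem_range y.2]
  · rw [map_smul, map_smul, hy1, smul_zero]

end IsCompactMeasure

theorem tendsto_norm_apply_one {W : H →L[ℂ] H} (hW : star W * W - 1 ∈ compactIdeal H) {x : ℕ → H}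
    (hx : Orthonormal ℂ x) : Tendsto (fun n => ‖W (x n)‖ ^ 2) atTop (𝓝 1) := by
  have h1 : Tendsto (fun n => ⟪x n, (star W * W - 1) (x n)⟫_ℂ) atTop (𝓝 0) := by
    refine squeeze_zero_norm (fun n => norm_inner_le_norm _ _) ?_
    simp only [hx.1, one_mul]
    simpa using (tendsto_zero_of_mem_compactIdeal hW hx).norm
  have h2 : ∀ n, ⟪x n, (star W * W - 1) (x n)⟫_ℂ = ((‖W (x n)‖ ^ 2 - 1 : ℝ) : ℂ) := by
    intro n
    have e1 : ⟪x n, (star W * W) (x n)⟫_ℂ = ((‖W (x n)‖ ^ 2 : ℝ) : ℂ) := by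
      rw [mul_apply_eq_comp, ContinuousLinearMap.star_eq_adjoint,
        ContinuousLinearMap.adjoint_inner_right, inner_self_eq_norm_sq_to_K]
      simp
    have e2 : ⟪x n, (1 : H →L[ℂ] H) (x n)⟫_ℂ = 1 := by
      rw [one_apply_eq_self, inner_self_eq_norm_sq_to_K, hx.1]; simp
    rw [sub_apply, inner_sub_right, e1, e2]
    push_cast; ring
  simp only [h2] at h1
  have h3 : Tendsto (fun n => ‖W (x n)‖ ^ 2 - 1) atTop (𝓝 0) := by
    have := (Complex.continuous_re.tendsto _).comp h1
    simpa [Function.comp_def, ← Complex.ofReal_pow] using this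
  simpa using h3.add_const 1

theorem exists_strictMono_succ {R : ℕ → ℕ → Prop} (h : ∀ n, ∀ᶠ k in atTop, R n k) :
    ∃ b : ℕ → ℕ, StrictMono b ∧ ∀ k, R (b k) (b (k + 1)) := by
  choose g hg using fun n => ((h n).and (eventually_gt_atTop n)).exists
  let b : ℕ → ℕ := fun k => Nat.rec 0 (fun _ n => g n) k
  exact ⟨b, strictMono_nat_of_lt_succ fun k => (hg (b k)).2, fun k => (hg (b k)).1⟩

/-- If `Q'` is essentially conjugate to `Q`, then the atoms of `Q'` have eventually at most the rank
of the atoms of `Q`. -/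
theorem IsCompactMeasure.eventually_atomRank_le {Q Q' : Set ℕ → H →L[ℂ] H}
    (hQ : IsCompactMeasure Q) (hQ' : IsCompactMeasure Q') {W : H →L[ℂ] H}
    (hW : star W * W - 1 ∈ compactIdeal H)
    (hWQ : ∀ M, W * Q' M - Q M * W ∈ compactIdeal H) :
    ∀ᶠ i in atTop, atomRank Q' i ≤ atomRank Q i := by
  by_contra hcon
  have hfreq : ∃ᶠ i in atTop, atomRank Q i < atomRank Q' i := by
    simpa [Filter.Frequently, not_lt] using hcon
  obtain ⟨a, ha, hlt⟩ := extraction_of_frequently_atTop hfreq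
  choose x hx1 hxQ' hxQ using fun k => hQ.exists_unit hQ' W (hlt k)
  have hx : Orthonormal ℂ x := by
    refine ⟨hx1, fun k l hkl => ?_⟩
    change ⟪x k, x l⟫_ℂ = 0
    have : ({a k} : Set ℕ) ∩ {a l} = ∅ := by
      ext i
      simp only [Set.mem_inter_iff, Set.mem_singleton_iff, Set.mem_empty_iff_false, iff_false]
      rintro ⟨rfl, h⟩
      exact hkl (ha.injective h)
    rw [← hxQ' k, ← hxQ' l, hQ'.inner_eq, ← mul_apply_eq_comp, hQ'.mul_eq, this, hQ'.empty_eq]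
    simp
  -- Thin out so that W (x (b (k + 1))) is nearly invisible to Q on indices up to a (b k) and from a
  -- (b (k + 2)) on. The first uses compactness of Q (Iio n) W, the second strong continuity of Q.
  obtain ⟨b, hb, hR⟩ := exists_strictMono_succ
    (R := fun j k => ‖Q (Set.Iio (a j + 1)) (W (x k))‖ < 1 / 4 ∧
      ‖Q (Set.Ici (a k)) (W (x j))‖ < 1 / 4) fun j => by
    have h1 : Tendsto (fun k => ‖Q (Set.Iio (a j + 1)) (W (x k))‖) atTop (𝓝 0) := by
      have := tendsto_zero_of_mem_compactIdeal
        ((compactIdeal H).mul_mem_right W (hQ.Iio_mem (a j + 1))) hx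
      simpa using this.norm
    have h2 : Tendsto (fun k => ‖Q (Set.Ici (a k)) (W (x j))‖) atTop (𝓝 0) := by
      simpa using ((hQ.tendsto_Ici (W (x j))).comp ha.tendsto_atTop).norm
    exact (h1.eventually (gt_mem_nhds (by norm_num))).and
      (h2.eventually (gt_mem_nhds (by norm_num)))
  let M : Set ℕ := Set.range (a ∘ b)
  have hab : StrictMono (a ∘ b) := ha.comp hb
  have hxb : Orthonormal ℂ (x ∘ b) := hx.comp b hb.injective
  have hbound : ∀ k, ‖Q M (W (x (b (k + 1))))‖ ≤ 1 / 2 := by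
    intro k
    set y := W (x (b (k + 1)))
    set c := a (b (k + 1)) with hc
    have hM : M = ((M ∩ Set.Iio c) ∪ {c}) ∪ (M ∩ Set.Ioi c) := by
      ext i
      have : c ∈ M := ⟨k + 1, rfl⟩
      simp only [Set.mem_union, Set.mem_inter_iff, Set.mem_Iio, Set.mem_singleton_iff, Set.mem_Ioi]
      constructor
      · intro hi
        rcases lt_trichotomy i c with h | h | h <;> simp [hi, h]
      · rintro ((h | rfl) | h)
        exacts [h.1, this, h.1]
    have hd1 : Disjoint (M ∩ Set.Iio c) {c} := by simp
    have hd2 : Disjoint ((M ∩ Set.Iio c) ∪ {c}) (M ∩ Set.Ioi c) := by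
      rw [Set.disjoint_left]
      rintro i (hi | hi) hi'
      · exact absurd (Set.mem_Iio.1 hi.2) (not_lt.2 (le_of_lt (Set.mem_Ioi.1 hi'.2)))
      · rw [Set.mem_singleton_iff.1 hi] at hi'
        exact lt_irrefl _ (Set.mem_Ioi.1 hi'.2)
    rw [hM, ← hQ.add_eq _ _ hd2, ← hQ.add_eq _ _ hd1]
    have e1 : ‖Q (M ∩ Set.Iio c) y‖ ≤ 1 / 4 := by
      refine (hQ.norm_apply_le_of_subset ?_ y).trans (hR k).1.le
      rintro _ ⟨⟨l, rfl⟩, hl⟩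
      have h1 : l < k + 1 := hab.lt_iff_lt.1 (show (a ∘ b) l < (a ∘ b) (k + 1) from hl)
      have h2 : (a ∘ b) l ≤ (a ∘ b) k := hab.monotone (by omega)
      exact Nat.lt_succ_of_le h2
    have e2 : ‖Q (M ∩ Set.Ioi c) y‖ ≤ 1 / 4 := by
      refine (hQ.norm_apply_le_of_subset ?_ y).trans (hR (k + 1)).2.le
      rintro _ ⟨⟨l, rfl⟩, hl⟩
      have h1 : k + 1 < l := hab.lt_iff_lt.1 (show (a ∘ b) (k + 1) < (a ∘ b) l from hl)
      exact hab.monotone (show k + 1 + 1 ≤ l by omega)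
    have e3 : Q {c} y = 0 := hxQ _
    rw [add_apply, add_apply, e3, add_zero]
    exact (norm_add_le _ _).trans (by linarith)
  have hfix : ∀ k, Q' M (x (b k)) = x (b k) := by
    intro k
    have : ({a (b k)} : Set ℕ) = M ∩ {a (b k)} := by
      rw [Set.inter_eq_right.2]
      simp only [Set.singleton_subset_iff]
      exact ⟨k, rfl⟩
    rw [← hxQ' (b k), ← mul_apply_eq_comp, hQ'.mul_eq, ← this]
  -- Contradiction: Q' M fixes the vectors, so W x is within 1/4 of Q M W x, whose norm is at most
  -- 1/2. This gives ‖W x‖ < 3/4, while ‖W x‖² tends to 1 and exceeds 9/16 = (3/4)².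
  have l1 := (tendsto_zero_of_mem_compactIdeal (hWQ M) hxb).norm
  have l2 := tendsto_norm_apply_one hW hxb
  rw [norm_zero] at l1
  have ev := (tendsto_add_atTop_nat 1).eventually
    ((l1.eventually (gt_mem_nhds (show (0 : ℝ) < 1 / 4 by norm_num))).and
      (l2.eventually (lt_mem_nhds (show (9 / 16 : ℝ) < 1 by norm_num))))
  obtain ⟨k, h1, h2⟩ := ev.exists
  simp only [Function.comp_apply, sub_apply, mul_apply_eq_comp, hfix] at h1 h2
  have h3 := hbound k
  have h4 : ‖W (x (b (k + 1)))‖ < 3 / 4 := by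
    have := norm_sub_norm_le (W (x (b (k + 1)))) (Q M (W (x (b (k + 1)))))
    linarith
  nlinarith [norm_nonneg (W (x (b (k + 1))))]

end Ranks

/-! ### Strongly continuous homomorphisms of block algebras -/

section Representations

open Filter Topology InnerProductSpace

set_option linter.unusedSectionVars false

variable {H : Type*} [NormedAddCommGroup H] [InnerProductSpace ℂ H] [CompleteSpace H]

theorem StronglyContinuousOn.tendsto {A : StarSubalgebra ℂ (H →L[ℂ] H)} {Φ : A → (H →L[ℂ] H)}
    (hΦ : StronglyContinuousOn A Φ) {a : ℕ → A} {b : A}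
    (h : ∀ x, Tendsto (fun n => (a n : H →L[ℂ] H) x) atTop (𝓝 ((b : H →L[ℂ] H) x))) (x : H) :
    Tendsto (fun n => Φ (a n) x) atTop (𝓝 (Φ b x)) := by
  let τ := strongTopology H
  let τA : TopologicalSpace A := τ.induced Subtype.val
  have h1 : Tendsto a atTop (@nhds _ τA b) := by
    rw [nhds_induced, tendsto_comap_iff, nhds_induced, tendsto_comap_iff]
    exact PointwiseConvergenceCLM.tendsto_iff_forall_tendsto.2 h
  have h2 : Tendsto (fun n => Φ (a n)) atTop (@nhds _ τ (Φ b)) :=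
    ((@Continuous.tendsto _ _ τA τ _ hΦ b)).comp h1
  rw [nhds_induced, tendsto_comap_iff] at h2
  exact PointwiseConvergenceCLM.tendsto_iff_forall_tendsto.1 h2 x

variable {ξ : HilbertBasis ℕ ℂ H} {E : IntervalPartition}

variable (ξ E) in
/-- A coordinate projection, as an element of the block algebra. -/
noncomputable def blockProj (M : Set ℕ) : blockAlgebra ξ E :=
  ⟨basisProj ξ M, basisProj_mem_blockAlgebra ξ E M⟩

theorem rankOne_mem_blockAlgebra {i j : ℕ} (h : E.idx i = E.idx j) :
    rankOne ℂ (ξ i) (ξ j) ∈ blockAlgebra ξ E := by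
  rw [mem_blockAlgebra_iff]
  intro k l hkl
  rw [rankOne_apply, inner_smul_right, ξ.inner_eq, ξ.inner_eq]
  by_cases hj : j = l
  · by_cases hi : k = i
    · subst hj hi; exact absurd h hkl
    · simp [hi]
  · simp [hj]

variable (ξ E) in
/-- The matrix unit `ξ i ⊗ ξ j`, as an element of the block algebra. -/
noncomputable def blockUnit (i j : ℕ) (h : E.idx i = E.idx j) : blockAlgebra ξ E :=
  ⟨rankOne ℂ (ξ i) (ξ j), rankOne_mem_blockAlgebra h⟩

theorem rankOne_self_eq (i : ℕ) : rankOne ℂ (ξ i) (ξ i) = basisProj ξ {i} := by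
  classical
  refine ξ.clm_ext fun j => ?_
  rw [rankOne_apply, basisProj_apply, ξ.inner_eq]
  by_cases h : i = j
  · simp [h]
  · simp [h, Ne.symm h]

theorem blockUnit_mul_blockUnit {i j k : ℕ} (h : E.idx i = E.idx j) (h' : E.idx j = E.idx k) :
    blockUnit ξ E i j h * blockUnit ξ E j k h' = blockUnit ξ E i k (h.trans h') := by
  refine Subtype.ext (ContinuousLinearMap.ext fun x => ?_)
  change rankOne ℂ (ξ i) (ξ j) (rankOne ℂ (ξ j) (ξ k) x) = rankOne ℂ (ξ i) (ξ k) x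
  simp only [rankOne_apply, inner_smul_right, ξ.inner_eq, if_true, mul_one]

theorem blockUnit_self (i : ℕ) : blockUnit ξ E i i rfl = blockProj ξ E {i} :=
  Subtype.ext (rankOne_self_eq i)

theorem star_blockUnit {i j : ℕ} (h : E.idx i = E.idx j) :
    star (blockUnit ξ E i j h) = blockUnit ξ E j i h.symm := by
  refine Subtype.ext ?_
  change star (rankOne ℂ (ξ i) (ξ j)) = _
  rw [ContinuousLinearMap.star_eq_adjoint, adjoint_rankOne]
  rfl

variable {Φ : blockAlgebra ξ E →⋆ₙₐ[ℂ] (H →L[ℂ] H)}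

theorem isCompactMeasure_of_stronglyContinuousOn (hΦ : StronglyContinuousOn (blockAlgebra ξ E) Φ)
    (hK : ∀ a : blockAlgebra ξ E, (a : H →L[ℂ] H) ∈ compactIdeal H → Φ a ∈ compactIdeal H) :
    IsCompactMeasure fun M => Φ (blockProj ξ E M) where
  star_eq M := by
    rw [← map_star]
    exact congrArg Φ (Subtype.ext (star_basisProj ξ M))
  mul_eq M N := by
    rw [← map_mul]
    exact congrArg Φ (Subtype.ext (basisProj_mul ξ M N))
  add_eq M N h := by
    rw [← map_add]
    exact congrArg Φ (Subtype.ext (basisProj_add_of_disjoint ξ h))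
  tendsto := hΦ.tendsto fun x => by
    change Tendsto (fun n => basisProj ξ (Set.Iio n) x) atTop (𝓝 (basisProj ξ Set.univ x))
    rw [basisProj_univ]
    exact tendsto_basisProj_Iio ξ x
  compact i := hK _ (basisProj_mem_compactIdeal ξ (Set.finite_singleton i))

theorem map_blockUnit_mul {i j k : ℕ} (h : E.idx i = E.idx j) (h' : E.idx j = E.idx k) :
    Φ (blockUnit ξ E i j h) * Φ (blockUnit ξ E j k h') = Φ (blockUnit ξ E i k (h.trans h')) := by
  rw [← map_mul, blockUnit_mul_blockUnit]

theorem inner_map_blockUnit {i j : ℕ} (h : E.idx i = E.idx j) (x y : H) :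
    ⟪Φ (blockUnit ξ E i j h) x, y⟫_ℂ = ⟪x, Φ (blockUnit ξ E j i h.symm) y⟫_ℂ := by
  rw [← star_blockUnit h, map_star]
  exact (ContinuousLinearMap.adjoint_inner_right _ _ _).symm

/-- The image of the matrix unit from j to i maps the range of one atom injectively into the other,
the reverse unit being a left inverse. -/
theorem atomRank_le_of_idx_eq (hQ : IsCompactMeasure fun M => Φ (blockProj ξ E M)) {i j : ℕ}
    (h : E.idx i = E.idx j) :
    atomRank (fun M => Φ (blockProj ξ E M)) j ≤ atomRank (fun M => Φ (blockProj ξ E M)) i := by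
  have h1 := hQ.finiteDimensional i
  have h2 := hQ.finiteDimensional j
  have hrange : ∀ x, Φ (blockUnit ξ E i j h) x ∈ (Φ (blockProj ξ E {i})).range := fun x =>
    ⟨Φ (blockUnit ξ E i j h) x, by
      change Φ (blockProj ξ E {i}) (Φ (blockUnit ξ E i j h) x) = _
      rw [← blockUnit_self, ← mul_apply_eq_comp, map_blockUnit_mul]⟩
  let f : (Φ (blockProj ξ E {j})).range →ₗ[ℂ] (Φ (blockProj ξ E {i})).range :=
    ((Φ (blockUnit ξ E i j h) : H →ₗ[ℂ] H).codRestrict _ hrange) ∘ₗ Submodule.subtype _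
  refine LinearMap.finrank_le_finrank_of_injective (f := f) ?_
  rw [← LinearMap.ker_eq_bot, LinearMap.ker_eq_bot']
  intro x hx
  have hx1 : Φ (blockUnit ξ E i j h) x = 0 := congrArg Subtype.val hx
  have hx2 : Φ (blockProj ξ E {j}) (x : H) = x := hQ.apply_of_mem_range x.2
  refine Subtype.ext ?_
  rw [← hx2, ← blockUnit_self, ← map_blockUnit_mul h.symm h, mul_apply_eq_comp, hx1, map_zero]
  rfl

/-! ### Amplifications -/

/-- A finite family of isometries with orthogonal ranges that add up to the whole space. -/
structure IsCuntzFamily {m : ℕ} (S : Fin m → H →L[ℂ] H) : Prop where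
  star_mul : ∀ a b, star (S a) * S b = if a = b then 1 else 0
  sum_mul_star : ∑ a, S a * star (S a) = 1

/-- A bijection ℕ × Fin m ≃ ℕ splits the basis into m infinite pieces. -/
theorem exists_isCuntzFamily (ξ : HilbertBasis ℕ ℂ H) {m : ℕ} (hm : 0 < m) :
    ∃ S : Fin m → H →L[ℂ] H, IsCuntzFamily S := by
  have : Nonempty (Fin m) := ⟨⟨0, hm⟩⟩
  obtain ⟨e⟩ : Nonempty (ℕ × Fin m ≃ ℕ) := inferInstance
  have horth : ∀ a, ∀ i j, i ≠ j → ⟪ξ (e (i, a)), ξ (e (j, a))⟫_ℂ = 0 := by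
    intro a i j hij
    rw [ξ.inner_eq, if_neg]
    intro h
    exact hij (congrArg Prod.fst (e.injective h))
  let S : Fin m → H →L[ℂ] H := fun a => basisMap ξ fun i => ξ (e (i, a))
  have hS : ∀ a i, S a (ξ i) = ξ (e (i, a)) := fun a i =>
    basisMap_apply ξ (horth a) (C := 1) (fun i => (ξ.norm_eq_one _).le) i
  have hadj : ∀ a x y, ⟪x, star (S a) y⟫_ℂ = ⟪S a x, y⟫_ℂ := fun a x y =>
    ContinuousLinearMap.adjoint_inner_right _ _ _
  have hS' : ∀ a i b, star (S a) (ξ (e (i, b))) = if a = b then ξ i else 0 := by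
    intro a i b
    refine ξ.ext_inner fun j => ?_
    rw [hadj, hS, ξ.inner_eq]
    by_cases hab : a = b
    · subst hab
      rw [if_pos rfl, ξ.inner_eq]
      simp
    · simp [hab]
  refine ⟨S, ⟨fun a b => ξ.clm_ext fun i => ?_, ξ.clm_ext fun k => ?_⟩⟩
  · rw [mul_apply_eq_comp, hS, hS']
    split_ifs <;> rfl
  · obtain ⟨⟨i, b⟩, rfl⟩ := e.surjective k
    rw [sum_apply]
    simp only [mul_apply_eq_comp, hS']
    rw [Finset.sum_eq_single b]
    · simp [hS]
    · intro a _ hab; simp [hab]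
    · simp

/-- The amplification `T ↦ T ⊗ 1`. -/
noncomputable def ampl {m : ℕ} (S : Fin m → H →L[ℂ] H) (T : H →L[ℂ] H) : H →L[ℂ] H :=
  ∑ a, S a * T * star (S a)

namespace IsCuntzFamily

variable {m : ℕ} {S : Fin m → H →L[ℂ] H} (hS : IsCuntzFamily S)

include hS

theorem star_mul_mul (a b : Fin m) (T : H →L[ℂ] H) :
    star (S a) * (S b * T) = if a = b then T else 0 := by
  rw [← mul_assoc, hS.star_mul]
  split_ifs <;> simp

theorem ampl_mul (T T' : H →L[ℂ] H) : ampl S (T * T') = ampl S T * ampl S T' := by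
  unfold ampl
  rw [Finset.sum_mul_sum]
  refine Finset.sum_congr rfl fun a _ => ?_
  rw [Finset.sum_eq_single a]
  · simp only [mul_assoc, hS.star_mul_mul, if_true]
  · intro b _ hab
    simp [mul_assoc, hS.star_mul_mul, hab.symm]
  · simp

theorem ampl_one : ampl S 1 = 1 := by
  unfold ampl
  simpa using hS.sum_mul_star

end IsCuntzFamily

section

variable {m : ℕ} (S : Fin m → H →L[ℂ] H)

theorem ampl_add (T T' : H →L[ℂ] H) : ampl S (T + T') = ampl S T + ampl S T' := by
  unfold ampl
  simp only [mul_add, add_mul, Finset.sum_add_distrib]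

theorem ampl_smul (c : ℂ) (T : H →L[ℂ] H) : ampl S (c • T) = c • ampl S T := by
  unfold ampl
  simp only [mul_smul_comm, smul_mul_assoc, Finset.smul_sum]

theorem ampl_zero : ampl S 0 = 0 := by simp [ampl]

theorem ampl_sub (T T' : H →L[ℂ] H) : ampl S (T - T') = ampl S T - ampl S T' := by
  unfold ampl
  simp only [mul_sub, sub_mul, Finset.sum_sub_distrib]

theorem star_ampl (T : H →L[ℂ] H) : star (ampl S T) = ampl S (star T) := by
  unfold ampl
  simp only [star_sum, star_mul, star_star, mul_assoc]

theorem ampl_mem_compactIdeal {T : H →L[ℂ] H} (hT : T ∈ compactIdeal H) :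
    ampl S T ∈ compactIdeal H :=
  sum_mem fun _ _ => (compactIdeal H).mul_mem_right _ ((compactIdeal H).mul_mem_left _ hT)

theorem ampl_apply (T : H →L[ℂ] H) (x : H) : ampl S T x = ∑ a, S a (T (star (S a) x)) := by
  simp [ampl, sum_apply, mul_apply_eq_comp]

end

end Representations

/-! ### The intertwiner with an amplification -/

section Intertwiner

open Filter Topology InnerProductSpace

set_option linter.unusedSectionVars false

variable {H : Type*} [NormedAddCommGroup H] [InnerProductSpace ℂ H] [CompleteSpace H]
variable {ξ : HilbertBasis ℕ ℂ H} {E : IntervalPartition}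
variable {Φ : blockAlgebra ξ E →⋆ₙₐ[ℂ] (H →L[ℂ] H)}

theorem apply_basis_eq_sum {T : H →L[ℂ] H} (hT : T ∈ blockAlgebra ξ E) (j : ℕ) :
    T (ξ j) = ∑ i ∈ Finset.Ico (E.endpoint (E.idx j)) (E.endpoint (E.idx j + 1)),
      ⟪ξ i, T (ξ j)⟫_ℂ • ξ i := by
  refine ξ.ext_inner fun k => ?_
  rw [inner_sum]
  simp only [inner_smul_right, ξ.inner_eq, mul_ite, mul_one, mul_zero]
  rw [Finset.sum_ite_eq]
  split_ifs with h
  · rfl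
  · refine (mem_blockAlgebra_iff ξ E T).1 hT k j fun hkj => h ?_
    rw [← hkj]
    exact Finset.mem_Ico.2 ⟨E.endpoint_idx_le k, E.lt_endpoint_idx_succ k⟩

/-- Within a block, T times the unit (j, t) is the finite combination of units (i, t) with
coefficients the j-th column of T. Applying Φ gives the intertwining relation for Z on ξ j. -/
theorem map_mul_blockUnit_apply (T : blockAlgebra ξ E) {j t : ℕ} (h : E.idx j = E.idx t) (y : H)
    {z : ℕ → H} (hz : ∀ i (hi : E.idx i = E.idx t), z i = Φ (blockUnit ξ E i t hi) y)
    {Z : H →L[ℂ] H} (hZ : ∀ i, E.idx i = E.idx t → Z (ξ i) = z i) :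
    Φ T (z j) = Z ((T : H →L[ℂ] H) (ξ j)) := by
  classical
  let s := Finset.Ico (E.endpoint (E.idx j)) (E.endpoint (E.idx j + 1))
  have hs : ∀ i ∈ s, E.idx i = E.idx t := fun i hi =>
    (E.idx_eq_iff.2 (Finset.mem_Ico.1 hi)).trans h
  have key : T * blockUnit ξ E j t h = ∑ i ∈ s.attach,
      ⟪ξ i, (T : H →L[ℂ] H) (ξ j)⟫_ℂ • blockUnit ξ E i t (hs i i.2) := by
    refine Subtype.ext (ContinuousLinearMap.ext fun x => ?_)
    rw [AddSubmonoidClass.coe_finsetSum, sum_apply]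
    change (T : H →L[ℂ] H) (⟪ξ t, x⟫_ℂ • ξ j) = ∑ i ∈ s.attach,
      ⟪ξ i, (T : H →L[ℂ] H) (ξ j)⟫_ℂ • (⟪ξ t, x⟫_ℂ • ξ i)
    rw [map_smul]
    nth_rewrite 1 [apply_basis_eq_sum T.2 j]
    rw [Finset.sum_attach s (fun i => ⟪ξ i, (T : H →L[ℂ] H) (ξ j)⟫_ℂ • (⟪ξ t, x⟫_ℂ • ξ i)),
      Finset.smul_sum]
    exact Finset.sum_congr rfl fun i _ => smul_comm _ _ _
  have h1 : Φ T (z j) = Φ (T * blockUnit ξ E j t h) y := by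
    rw [map_mul, mul_apply_eq_comp, hz j h]
  rw [h1, key, map_sum, sum_apply]
  nth_rewrite 2 [apply_basis_eq_sum T.2 j]
  rw [map_sum, ← Finset.sum_attach s]
  refine Finset.sum_congr rfl fun i _ => ?_
  rw [map_smul, map_smul, smul_apply, hZ i (hs i i.2), hz i (hs i i.2)]

/-- Choose an orthonormal basis of the range of the atom at the first index of each late interval
and move it by matrix units to the other indices. For each a this gives a partial isometry Z a
intertwining T with Φ T, and Y = ∑ Z a (S a)*. Early intervals, where the rank may be wrong, cost
only a compact error in unitarity; the intertwining relation is exact. -/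
theorem exists_intertwiner (hQ : IsCompactMeasure fun M => Φ (blockProj ξ E M))
    (hunit : Φ (blockProj ξ E Set.univ) - 1 ∈ compactIdeal H) {m : ℕ}
    (hm : ∀ᶠ i in atTop, atomRank (fun M => Φ (blockProj ξ E M)) i = m)
    {S : Fin m → H →L[ℂ] H} (hS : IsCuntzFamily S) :
    ∃ Y : H →L[ℂ] H, star Y * Y - 1 ∈ compactIdeal H ∧ Y * star Y - 1 ∈ compactIdeal H ∧
      ∀ T : blockAlgebra ξ E, Φ T * Y = Y * ampl S T := by
  classical
  obtain ⟨n₀, hn₀⟩ := eventually_atTop.1 hm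
  let t : ℕ → ℕ := fun i => E.endpoint (E.idx i)
  have ht : ∀ i, E.idx i = E.idx (t i) := fun i => (E.idx_endpoint _).symm
  have hy : ∀ n, ∃ y : Fin m → H, n₀ ≤ n → Orthonormal ℂ y ∧
      (∀ a, Φ (blockProj ξ E {E.endpoint n}) (y a) = y a) ∧
      ∀ x, Φ (blockProj ξ E {E.endpoint n}) x ∈ Submodule.span ℂ (Set.range y) := by
    intro n
    by_cases hn : n₀ ≤ n
    · have hfd := hQ.finiteDimensional (E.endpoint n)
      have hr := hn₀ (E.endpoint n) (hn.trans (E.strictMono.id_le n))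
      let V := (Φ (blockProj ξ E {E.endpoint n})).range
      let b : OrthonormalBasis (Fin m) ℂ V := (stdOrthonormalBasis ℂ V).reindex (finCongr hr)
      refine ⟨fun a => (b a : H), fun _ => ⟨?_, fun a => hQ.apply_of_mem_range (b a).2,
        fun x => ?_⟩⟩
      · exact b.orthonormal.comp_linearIsometry V.subtypeₗᵢ
      · have h1 : (⟨_, x, rfl⟩ : V) ∈ Submodule.span ℂ (Set.range b) := by
          rw [← b.coe_toBasis, b.toBasis.span_eq]; trivial
        have h2 := Submodule.mem_map_of_mem (f := V.subtype) h1
        rw [Submodule.map_span, ← Set.range_comp] at h2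
        exact h2
    · exact ⟨0, fun h => absurd h hn⟩
  choose y hy using hy
  let L : Set ℕ := {i | n₀ ≤ E.idx i}
  -- Intervals before n₀ go to zero as a whole, so the relation holds trivially on them.
  let z : Fin m → ℕ → H := fun a i =>
    if n₀ ≤ E.idx i then Φ (blockUnit ξ E i (t i) (ht i)) (y (E.idx i) a) else 0
  have hzin : ∀ a b i j, ⟪z a i, z b j⟫_ℂ = if a = b ∧ i = j ∧ n₀ ≤ E.idx i then 1 else 0 := by
    intro a b i j
    by_cases hi : n₀ ≤ E.idx i
    · by_cases hj : n₀ ≤ E.idx j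
      · simp only [z, hi, hj, if_true]
        by_cases hij : i = j
        · subst hij
          rw [inner_map_blockUnit, ← mul_apply_eq_comp, map_blockUnit_mul, blockUnit_self]
          rw [(hy _ hi).2.1, orthonormal_iff_ite.1 (hy _ hi).1]
          simp
        · have e1 : ∀ k, Φ (blockUnit ξ E k (t k) (ht k)) =
              Φ (blockProj ξ E {k}) * Φ (blockUnit ξ E k (t k) (ht k)) := fun k => by
            rw [← blockUnit_self, map_blockUnit_mul]
          have e2 : ({i} : Set ℕ) ∩ {j} = ∅ := by simpa using Ne.symm hij
          have e3 := hQ.mul_eq {i} {j}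
          have e4 := hQ.inner_eq {i}
          have e5 := hQ.empty_eq
          rw [e1 i, e1 j, mul_apply_eq_comp, mul_apply_eq_comp, e4, ← mul_apply_eq_comp, e3, e2, e5]
          simp [hij]
      · have hij : i ≠ j := fun h => hj (h ▸ hi)
        simp [z, hj, hij]
    · simp [z, hi]
  have horth : ∀ a i j, i ≠ j → ⟪z a i, z a j⟫_ℂ = 0 := fun a i j hij => by
    rw [hzin, if_neg (fun h => hij h.2.1)]
  have hnorm : ∀ a i, ‖z a i‖ ≤ 1 := by
    intro a i
    have h1 := hzin a a i i
    rw [inner_self_eq_norm_sq_to_K] at h1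
    have h2 : ‖z a i‖ ^ 2 ≤ 1 := by
      have h3 : ((‖z a i‖ ^ 2 : ℝ) : ℂ) = if a = a ∧ i = i ∧ n₀ ≤ E.idx i then 1 else 0 := by
        rw [← h1]; simp
      split_ifs at h3
      · exact (by exact_mod_cast h3 : ‖z a i‖ ^ 2 = 1).le
      · have : ‖z a i‖ ^ 2 = 0 := by exact_mod_cast h3
        rw [this]; norm_num
    exact (sq_le_one_iff₀ (norm_nonneg _)).1 h2
  let Z : Fin m → H →L[ℂ] H := fun a => basisMap ξ (z a)
  have hZ : ∀ a i, Z a (ξ i) = z a i := fun a i => basisMap_apply ξ (horth a) (hnorm a) i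
  have hZZ : ∀ a b, star (Z a) * Z b = if a = b then basisProj ξ L else 0 := by
    intro a b
    refine ξ.clm_ext_inner fun i j => ?_
    rw [mul_apply_eq_comp, ContinuousLinearMap.star_eq_adjoint,
      ContinuousLinearMap.adjoint_inner_right, hZ, hZ, hzin]
    by_cases hab : a = b
    · simp only [hab, true_and, if_true]
      rw [basisProj_apply]
      by_cases hij : i = j
      · subst hij
        by_cases hi : n₀ ≤ E.idx i
        · simp only [L, hi, Set.mem_ofPred_eq, ξ.inner_eq, and_self, if_true]
        · simp [L, hi]
      · by_cases hj : j ∈ L <;> simp [hij, hj, ξ.inner_eq]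
    · simp [hab]
  have hZL : ∀ a, Z a * basisProj ξ L = Z a := by
    intro a
    refine ξ.clm_ext fun i => ?_
    rw [mul_apply_eq_comp, basisProj_apply, hZ]
    by_cases hi : n₀ ≤ E.idx i
    · rw [if_pos (show i ∈ L from hi), hZ]
    · rw [if_neg (show i ∉ L from hi), map_zero]; simp [z, hi]
  have hLc : basisProj ξ L - 1 ∈ compactIdeal H := by
    have h1 : Lᶜ.Finite := (Set.finite_Iio (E.endpoint n₀)).subset fun i hi => by
      have h2 : E.idx i < n₀ := not_le.1 hi
      exact (E.lt_endpoint_idx_succ i).trans_le (E.strictMono.monotone h2)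
    have h2 := basisProj_mem_compactIdeal ξ h1
    rw [basisProj_compl] at h2
    rw [← neg_sub]
    exact neg_mem h2
  let Y : H →L[ℂ] H := ∑ a, Z a * star (S a)
  have hYS : ∀ a, Y * S a = Z a := by
    intro a
    simp only [Y, Finset.sum_mul, mul_assoc, hS.star_mul]
    simp
  have hYY : star Y * Y = ampl S (basisProj ξ L) := by
    simp only [Y, star_sum, star_mul, star_star, Finset.sum_mul_sum, ampl]
    refine Finset.sum_congr rfl fun a _ => ?_
    rw [Finset.sum_eq_single a]
    · rw [mul_assoc, ← mul_assoc (star (Z a)), hZZ, if_pos rfl, mul_assoc]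
    · intro b _ hb
      rw [mul_assoc, ← mul_assoc (star (Z a)), hZZ, if_neg hb.symm]; simp
    · simp
  have hYL : Y * ampl S (basisProj ξ L) = Y := by
    unfold ampl
    rw [Finset.mul_sum]
    refine Finset.sum_congr rfl fun a _ => ?_
    rw [← mul_assoc, ← mul_assoc, hYS, hZL]
  refine ⟨Y, ?_, ?_, fun T => ?_⟩
  · rw [hYY]
    rw [← hS.ampl_one, ← ampl_sub]
    exact ampl_mem_compactIdeal S hLc
  · -- the range projection of `Y` dominates the atoms of high index
    have hatom : ∀ i ∈ L, Y * star Y * Φ (blockProj ξ E {i}) = Φ (blockProj ξ E {i}) := by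
      intro i hi
      refine ContinuousLinearMap.ext fun x => ?_
      -- Move the vector to the reference index t i, expand it there in y, and move back: it lies in
      -- the range of Y.
      obtain ⟨w, hw⟩ : ∃ w, Φ (blockProj ξ E {i}) x = Y w := by
        have h1 : Φ (blockUnit ξ E (t i) i (ht i).symm) x ∈
            Submodule.span ℂ (Set.range (y (E.idx i))) := by
          have := (hy _ hi).2.2 (Φ (blockUnit ξ E (t i) i (ht i).symm) x)
          rw [← mul_apply_eq_comp, ← blockUnit_self] at this
          rwa [map_blockUnit_mul (i := t i) (j := t i)] at this
        have h2 : ∀ u ∈ Submodule.span ℂ (Set.range (y (E.idx i))),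
            Φ (blockUnit ξ E i (t i) (ht i)) u ∈ Y.range := by
          intro u hu
          induction hu using Submodule.span_induction with
          | mem u hu =>
            obtain ⟨a, rfl⟩ := hu
            refine ⟨S a (ξ i), ?_⟩
            change Y (S a (ξ i)) = _
            rw [← mul_apply_eq_comp, hYS, hZ]
            exact if_pos hi
          | zero => simp
          | add u v _ _ hu hv => rw [map_add]; exact add_mem hu hv
          | smul c u _ hu => rw [map_smul]; exact Submodule.smul_mem _ _ hu
        obtain ⟨w, hw⟩ := h2 _ h1
        refine ⟨w, ?_⟩
        change Y w = _ at hw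
        rw [hw, ← mul_apply_eq_comp, map_blockUnit_mul, blockUnit_self]
      rw [mul_apply_eq_comp, hw, ← mul_apply_eq_comp, mul_assoc, hYY, hYL]
    set c := E.endpoint n₀
    have hall : Y * star Y * Φ (blockProj ξ E (Set.Ici c)) = Φ (blockProj ξ E (Set.Ici c)) := by
      have hfin : ∀ n, Y * star Y * Φ (blockProj ξ E (Set.Ico c (c + n))) =
          Φ (blockProj ξ E (Set.Ico c (c + n))) := by
        intro n
        induction n with
        | zero =>
          have := hQ.empty_eq
          simp [this]
        | succ n ih =>
          have h1 : Set.Ico c (c + (n + 1)) = Set.Ico c (c + n) ∪ {c + n} := by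
            ext k; simp; omega
          have h2 := hQ.add_eq (Set.Ico c (c + n)) {c + n} (by simp)
          rw [h1, ← h2, mul_add, ih, hatom]
          have : E.idx c ≤ E.idx (c + n) := E.idx_mono (by omega)
          rwa [E.idx_endpoint] at this
      refine ContinuousLinearMap.ext fun x => ?_
      have h1 : Tendsto (fun n => Φ (blockProj ξ E (Set.Ico c (c + n))) x) atTop
          (𝓝 (Φ (blockProj ξ E (Set.Ici c)) x)) := by
        have h2 := (hQ.tendsto (Φ (blockProj ξ E (Set.Ici c)) x)).comp (tendsto_add_atTop_nat c)
        have h3 := hQ.mul_eq Set.univ (Set.Ici c)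
        rw [← mul_apply_eq_comp, h3, Set.univ_inter] at h2
        refine h2.congr fun n => ?_
        have h4 := hQ.mul_eq (Set.Iio (n + c)) (Set.Ici c)
        rw [Function.comp_apply, ← mul_apply_eq_comp, h4, Set.Iio_inter_Ici, add_comm]
      refine tendsto_nhds_unique (((Y * star Y).continuous.tendsto _).comp h1) (h1.congr fun n => ?_)
      rw [Function.comp_apply, ← mul_apply_eq_comp, hfin]
    have h1 : Φ (blockProj ξ E (Set.Ici c)) - 1 ∈ compactIdeal H := by
      have h2 := hQ.Iio_add_Ici c
      have h3 := hQ.Iio_mem c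
      rw [← h2] at hunit
      have := sub_mem hunit h3
      rwa [show ∀ A B : H →L[ℂ] H, A + B - 1 - A = B - 1 from fun A B => by abel] at this
    have h2 : Y * star Y - 1 = (Φ (blockProj ξ E (Set.Ici c)) - 1) -
        Y * star Y * (Φ (blockProj ξ E (Set.Ici c)) - 1) := by
      rw [mul_sub, hall]; simp
    rw [h2]
    exact sub_mem h1 ((compactIdeal H).mul_mem_left _ h1)
  · have key : ∀ a, Φ T * Z a = Z a * T := by
      intro a
      refine ξ.clm_ext fun j => ?_
      rw [mul_apply_eq_comp, mul_apply_eq_comp, hZ]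
      by_cases hj : n₀ ≤ E.idx j
      · refine map_mul_blockUnit_apply T (ht j) (y (E.idx j) a) (fun i hi => ?_) (fun i _ => hZ a i)
        have hij : E.idx i = E.idx j := hi.trans (ht j).symm
        have hti : t i = t j := by simp only [t, hij]
        simp only [z]
        rw [if_pos (hij ▸ hj)]
        congr 2
        simp only [hti]
      · have h1 : z a j = 0 := if_neg hj
        rw [h1, map_zero, apply_basis_eq_sum T.2 j, map_sum]
        refine (Finset.sum_eq_zero fun i hi => ?_).symm
        have hi' : E.idx i = E.idx j := E.idx_eq_iff.2 (Finset.mem_Ico.1 hi)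
        have h2 : z a i = 0 := if_neg (hi' ▸ hj)
        rw [map_smul, hZ, h2, smul_zero]
    unfold ampl
    rw [Finset.mul_sum, Finset.mul_sum]
    refine Finset.sum_congr rfl fun a _ => ?_
    rw [← mul_assoc, key, ← mul_assoc, ← mul_assoc, hYS]

end Intertwiner

/-! ### Locally trivial endomorphisms are locally conjugate to an amplification -/

section LocalForm

open Filter Topology InnerProductSpace

set_option linter.unusedSectionVars false

variable {H : Type*} [NormedAddCommGroup H] [InnerProductSpace ℂ H] [CompleteSpace H]
variable {ξ : HilbertBasis ℕ ℂ H}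

/-- `Φ` is a strongly continuous lift of `Ad v ∘ φ` on the block algebra of `E`. -/
structure IsLocalLift (φ : Calkin H →⋆ₙₐ[ℂ] Calkin H) (E : IntervalPartition) (v : Calkin H)
    (Φ : blockAlgebra ξ E →⋆ₙₐ[ℂ] (H →L[ℂ] H)) : Prop where
  mem_unitary : v ∈ unitary (Calkin H)
  continuous : StronglyContinuousOn (blockAlgebra ξ E) Φ
  q_eq : ∀ a : blockAlgebra ξ E, Calkin.q H (Φ a) = v * φ (Calkin.q H a) * star v

theorem IsLocallyTrivial.exists_isLocalLift {φ : Calkin H →⋆ₙₐ[ℂ] Calkin H}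
    (hφ : IsLocallyTrivial ξ φ) (E : IntervalPartition) :
    ∃ v, ∃ Φ : blockAlgebra ξ E →⋆ₙₐ[ℂ] (H →L[ℂ] H), IsLocalLift φ E v Φ := by
  obtain ⟨v, hv, Φ, hΦ, h⟩ := hφ E
  exact ⟨v, Φ, hv, hΦ, h⟩

namespace IsLocalLift

variable {φ : Calkin H →⋆ₙₐ[ℂ] Calkin H} {E F : IntervalPartition} {v w : Calkin H}
  {Φ : blockAlgebra ξ E →⋆ₙₐ[ℂ] (H →L[ℂ] H)} {Φ' : blockAlgebra ξ F →⋆ₙₐ[ℂ] (H →L[ℂ] H)}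

theorem isCompactMeasure (h : IsLocalLift φ E v Φ) :
    IsCompactMeasure fun M => Φ (blockProj ξ E M) :=
  isCompactMeasure_of_stronglyContinuousOn h.continuous fun a ha => by
    rw [← q_eq_zero_iff, h.q_eq, q_eq_zero_iff.2 ha, map_zero, mul_zero, zero_mul]

theorem map_univ_sub_one_mem (h : IsLocalLift φ E v Φ) (hφ : φ 1 = 1) :
    Φ (blockProj ξ E Set.univ) - 1 ∈ compactIdeal H := by
  rw [← q_eq_q_iff, h.q_eq, map_one]
  have : ((blockProj ξ E Set.univ : blockAlgebra ξ E) : H →L[ℂ] H) = 1 := basisProj_univ ξ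
  rw [this, map_one, hφ, mul_one, Unitary.mul_star_self_of_mem h.mem_unitary]

/-- Coordinate projections belong to every D[E], so a lift W of v w* essentially conjugates one
projection-valued measure to the other. -/
theorem eventually_atomRank_le (h : IsLocalLift φ E v Φ) (h' : IsLocalLift φ F w Φ') :
    ∀ᶠ i in atTop, atomRank (fun M => Φ' (blockProj ξ F M)) i ≤
      atomRank (fun M => Φ (blockProj ξ E M)) i := by
  obtain ⟨W, hW⟩ := q_surjective (v * star w)
  refine h.isCompactMeasure.eventually_atomRank_le h'.isCompactMeasure (W := W) ?_ fun M => ?_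
  · rw [← q_eq_q_iff, map_mul, map_star, map_one, hW, star_mul, star_star, mul_assoc,
      ← mul_assoc (star v), Unitary.star_mul_self_of_mem h.mem_unitary, one_mul,
      Unitary.mul_star_self_of_mem h'.mem_unitary]
  · rw [← q_eq_q_iff, map_mul, map_mul, hW, h.q_eq, h'.q_eq]
    change v * star w * (w * φ (Calkin.q H (basisProj ξ M)) * star w) =
      v * φ (Calkin.q H (basisProj ξ M)) * star v * (v * star w)
    have h1 := Unitary.star_mul_self_of_mem h.mem_unitary
    have h2 := Unitary.star_mul_self_of_mem h'.mem_unitary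
    calc _ = v * (star w * w) * φ (Calkin.q H (basisProj ξ M)) * star w := by
          simp only [mul_assoc]
      _ = v * φ (Calkin.q H (basisProj ξ M)) * (star v * v) * star w := by
          rw [h1, h2, mul_one, mul_one]
      _ = _ := by simp only [mul_assoc]

theorem eventually_atomRank_eq (h : IsLocalLift φ E v Φ) (h' : IsLocalLift φ F w Φ') :
    ∀ᶠ i in atTop, atomRank (fun M => Φ' (blockProj ξ F M)) i =
      atomRank (fun M => Φ (blockProj ξ E M)) i := by
  filter_upwards [h.eventually_atomRank_le h', h'.eventually_atomRank_le h] with i h1 h2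
  exact le_antisymm h1 h2

end IsLocalLift

/-- The partition into singletons. -/
def singletonPartition : IntervalPartition := ⟨id, rfl, strictMono_id⟩

theorem idx_singletonPartition (i : ℕ) : singletonPartition.idx i = i :=
  singletonPartition.idx_eq_iff.2 ⟨le_rfl, Nat.lt_succ_self i⟩

theorem exists_multiplicity {φ : Calkin H →⋆ₙₐ[ℂ] Calkin H} (hφ1 : φ 1 = 1)
    (hφ : IsLocallyTrivial ξ φ) :
    ∃ m : ℕ, 0 < m ∧ ∀ E v (Φ : blockAlgebra ξ E →⋆ₙₐ[ℂ] (H →L[ℂ] H)), IsLocalLift φ E v Φ →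
      ∀ᶠ i in atTop, atomRank (fun M => Φ (blockProj ξ E M)) i = m := by
  obtain ⟨v, Φ, hΦ⟩ := hφ.exists_isLocalLift singletonPartition
  let r := atomRank (fun M => Φ (blockProj ξ singletonPartition M))
  -- Ranks agree inside an interval of any partition. The even and odd pairings of singletons
  -- together cover all pairs i, i + 1.
  have hstep : ∀ᶠ i in atTop, r (i + 1) = r i := by
    have key : ∀ F : IntervalPartition, ∀ᶠ i in atTop, F.idx i = F.idx (i + 1) →
        r (i + 1) = r i := by
      intro F
      obtain ⟨w, Φ', hΦ'⟩ := hφ.exists_isLocalLift F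
      have h1 := hΦ'.eventually_atomRank_eq hΦ
      filter_upwards [h1, (tendsto_add_atTop_nat 1).eventually h1] with i e1 e2 hi
      refine e2.trans (Eq.trans ?_ e1.symm)
      exact le_antisymm (atomRank_le_of_idx_eq hΦ'.isCompactMeasure hi)
        (atomRank_le_of_idx_eq hΦ'.isCompactMeasure hi.symm)
    filter_upwards [key singletonPartition.evenPairs, key singletonPartition.oddPairs] with i h1 h2
    simp only [IntervalPartition.idx_evenPairs, IntervalPartition.idx_oddPairs,
      idx_singletonPartition] at h1 h2
    rcases Nat.even_or_odd' i with ⟨k, hk | hk⟩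
    · exact h1 (by omega)
    · exact h2 (by omega)
  obtain ⟨N, hN⟩ := eventually_atTop.1 hstep
  have hconst : ∀ i ≥ N, r i = r N := by
    intro i hi
    induction i, hi using Nat.le_induction with
    | base => rfl
    | succ i hi ih => rw [hN i hi, ih]
  refine ⟨r N, Nat.pos_of_ne_zero fun h0 => ?_, fun E w Φ' hΦ' => ?_⟩
  -- Were the eventual rank 0, Φ(1) would equal Φ of a finite projection and be compact, while it is
  -- 1 modulo compacts.
  · have hQ := hΦ.isCompactMeasure
    have hzero : ∀ i ≥ N, Φ (blockProj ξ singletonPartition {i}) = 0 := by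
      intro i hi
      have hfd := hQ.finiteDimensional i
      have h1 : r i = 0 := (hconst i hi).trans h0
      have h2 := Submodule.finrank_eq_zero.1 h1
      refine ContinuousLinearMap.ext fun x => ?_
      have : Φ (blockProj ξ singletonPartition {i}) x ∈
        (Φ (blockProj ξ singletonPartition {i})).range := ⟨x, rfl⟩
      rw [h2] at this
      exact this
    have hIio : ∀ n, Φ (blockProj ξ singletonPartition (Set.Iio (N + n))) =
        Φ (blockProj ξ singletonPartition (Set.Iio N)) := by
      intro n
      induction n with
      | zero => rfl
      | succ n ih =>
        have h1 : Set.Iio (N + (n + 1)) = Set.Iio (N + n) ∪ {N + n} := by ext k; simp; omega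
        have h2 := hQ.add_eq (Set.Iio (N + n)) {N + n} (by simp)
        rw [h1, ← h2, ih, hzero _ (Nat.le_add_right _ _), add_zero]
    have huniv : Φ (blockProj ξ singletonPartition Set.univ) =
        Φ (blockProj ξ singletonPartition (Set.Iio N)) := by
      refine ContinuousLinearMap.ext fun x => ?_
      refine tendsto_nhds_unique ((hQ.tendsto x).comp (tendsto_add_atTop_nat N))
        (tendsto_const_nhds.congr fun n => ?_)
      rw [Function.comp_apply, add_comm, hIio]
    have h1 := hΦ.map_univ_sub_one_mem hφ1
    have h2 := hQ.Iio_mem N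
    rw [← huniv] at h2
    have := sub_mem h2 h1
    rw [sub_sub_cancel] at this
    exact one_notMem_compactIdeal ξ this
  · filter_upwards [hΦ.eventually_atomRank_eq hΦ', eventually_ge_atTop N] with i h1 h2
    exact h1.trans (hconst i h2)

/-- A unital locally trivial endomorphism is, on every block algebra, conjugate to a fixed
amplification. -/
theorem exists_local_ampl {φ : Calkin H →⋆ₙₐ[ℂ] Calkin H} (hφ1 : φ 1 = 1)
    (hφ : IsLocallyTrivial ξ φ) :
    ∃ (m : ℕ) (S : Fin m → H →L[ℂ] H), IsCuntzFamily S ∧ ∀ E, ∃ u ∈ unitary (Calkin H),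
      ∀ T ∈ blockAlgebra ξ E, u * φ (Calkin.q H T) * star u = Calkin.q H (ampl S T) := by
  obtain ⟨m, hm, hrank⟩ := exists_multiplicity hφ1 hφ
  obtain ⟨S, hS⟩ := exists_isCuntzFamily ξ hm
  refine ⟨m, S, hS, fun E => ?_⟩
  obtain ⟨v, Φ, hΦ⟩ := hφ.exists_isLocalLift E
  obtain ⟨Y, hY1, hY2, hY⟩ := exists_intertwiner hΦ.isCompactMeasure
    (hΦ.map_univ_sub_one_mem hφ1) (hrank E v Φ hΦ) hS
  have hy1 : star (Calkin.q H Y) * Calkin.q H Y = 1 := by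
    rw [← map_star, ← map_mul, ← map_one (Calkin.q H)]; exact q_eq_q_iff.2 hY1
  have hy2 : Calkin.q H Y * star (Calkin.q H Y) = 1 := by
    rw [← map_star, ← map_mul, ← map_one (Calkin.q H)]; exact q_eq_q_iff.2 hY2
  have hyu : Calkin.q H Y ∈ unitary (Calkin H) := Unitary.mem_iff.2 ⟨hy1, hy2⟩
  refine ⟨star (Calkin.q H Y) * v, mul_mem (Unitary.star_mem hyu) hΦ.mem_unitary, fun T hT => ?_⟩
  have h1 := hΦ.q_eq ⟨T, hT⟩
  have h2 := congrArg (Calkin.q H) (hY ⟨T, hT⟩)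
  rw [map_mul, map_mul, h1] at h2
  calc _ = star (Calkin.q H Y) * (v * φ (Calkin.q H T) * star v * Calkin.q H Y) := by
        rw [star_mul, star_star]; simp only [mul_assoc]
    _ = star (Calkin.q H Y) * Calkin.q H Y * Calkin.q H (ampl S T) := by rw [h2, mul_assoc]
    _ = _ := by rw [hy1, one_mul]

end LocalForm

/-! ### Block diagonal operators -/

section MatOp

open Filter Topology InnerProductSpace

set_option linter.unusedSectionVars false

variable {H : Type*} [NormedAddCommGroup H] [InnerProductSpace ℂ H] [CompleteSpace H]

/-- The operator with operator matrix `M`, with respect to a Cuntz family. -/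
noncomputable def opOfMatrix {m : ℕ} (S : Fin m → H →L[ℂ] H) (M : Fin m → Fin m → H →L[ℂ] H) :
    H →L[ℂ] H := ∑ a, ∑ b, S a * M a b * star (S b)

theorem opOfMatrix_sub {m : ℕ} (S : Fin m → H →L[ℂ] H) (M N : Fin m → Fin m → H →L[ℂ] H) :
    opOfMatrix S M - opOfMatrix S N = opOfMatrix S fun a b => M a b - N a b := by
  simp only [opOfMatrix, mul_sub, sub_mul, Finset.sum_sub_distrib]

theorem opOfMatrix_mem_compactIdeal {m : ℕ} (S : Fin m → H →L[ℂ] H)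
    {M : Fin m → Fin m → H →L[ℂ] H} (hM : ∀ a b, M a b ∈ compactIdeal H) :
    opOfMatrix S M ∈ compactIdeal H :=
  sum_mem fun a _ => sum_mem fun b _ =>
    (compactIdeal H).mul_mem_right _ ((compactIdeal H).mul_mem_left _ (hM a b))

theorem star_opOfMatrix {m : ℕ} (S : Fin m → H →L[ℂ] H) (M : Fin m → Fin m → H →L[ℂ] H) :
    star (opOfMatrix S M) = opOfMatrix S fun a b => star (M b a) := by
  simp only [opOfMatrix, star_sum, star_mul, star_star, mul_assoc]
  exact Finset.sum_comm

namespace IsCuntzFamily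

variable {m : ℕ} {S : Fin m → H →L[ℂ] H} (hS : IsCuntzFamily S)

include hS

/-- With `compress_opOfMatrix` this identifies B(H) with the m × m matrices over B(H); later
identities are checked entrywise. -/
theorem opOfMatrix_compress (X : H →L[ℂ] H) :
    opOfMatrix S (fun a b => star (S a) * X * S b) = X := by
  have : opOfMatrix S (fun a b => star (S a) * X * S b) =
      (∑ a, S a * star (S a)) * X * ∑ b, S b * star (S b) := by
    simp only [opOfMatrix, Finset.sum_mul, Finset.mul_sum, mul_assoc]
    exact Finset.sum_comm
  rw [this, hS.sum_mul_star, one_mul, mul_one]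

theorem compress_opOfMatrix (M : Fin m → Fin m → H →L[ℂ] H) (a b : Fin m) :
    star (S a) * opOfMatrix S M * S b = M a b := by
  simp only [opOfMatrix, Finset.mul_sum, Finset.sum_mul, mul_assoc, hS.star_mul_mul]
  simp [mul_assoc, hS.star_mul]

theorem opOfMatrix_mul (M N : Fin m → Fin m → H →L[ℂ] H) :
    opOfMatrix S M * opOfMatrix S N = opOfMatrix S fun a b => ∑ c, M a c * N c b := by
  rw [← hS.opOfMatrix_compress (opOfMatrix S M * opOfMatrix S N)]
  congr 1
  funext a b
  calc star (S a) * (opOfMatrix S M * opOfMatrix S N) * S b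
      = star (S a) * opOfMatrix S M * (∑ c, S c * star (S c)) * (opOfMatrix S N * S b) := by
        rw [hS.sum_mul_star]; simp only [mul_assoc, one_mul]
    _ = ∑ c, (star (S a) * opOfMatrix S M * S c) * (star (S c) * opOfMatrix S N * S b) := by
        simp only [Finset.mul_sum, Finset.sum_mul, mul_assoc]
    _ = _ := by simp only [hS.compress_opOfMatrix]

theorem ampl_mul_right (T : H →L[ℂ] H) (b : Fin m) : ampl S T * S b = S b * T := by
  simp only [ampl, Finset.sum_mul, mul_assoc, hS.star_mul]
  simp

theorem star_mul_ampl (T : H →L[ℂ] H) (a : Fin m) : star (S a) * ampl S T = T * star (S a) := by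
  simp only [ampl, Finset.mul_sum, mul_assoc, hS.star_mul_mul]
  simp

theorem ampl_mul_opOfMatrix (T : H →L[ℂ] H) (M : Fin m → Fin m → H →L[ℂ] H) :
    ampl S T * opOfMatrix S M = opOfMatrix S fun a b => T * M a b := by
  rw [← hS.opOfMatrix_compress (ampl S T * opOfMatrix S M)]
  congr 1
  funext a b
  rw [← mul_assoc, hS.star_mul_ampl, mul_assoc, mul_assoc, ← mul_assoc (star (S a)),
    hS.compress_opOfMatrix]

theorem opOfMatrix_mul_ampl (T : H →L[ℂ] H) (M : Fin m → Fin m → H →L[ℂ] H) :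
    opOfMatrix S M * ampl S T = opOfMatrix S fun a b => M a b * T := by
  rw [← hS.opOfMatrix_compress (opOfMatrix S M * ampl S T)]
  congr 1
  funext a b
  rw [mul_assoc, mul_assoc, hS.ampl_mul_right, ← mul_assoc, ← mul_assoc, hS.compress_opOfMatrix]

theorem mem_compactIdeal_of_opOfMatrix {M : Fin m → Fin m → H →L[ℂ] H}
    (h : opOfMatrix S M ∈ compactIdeal H) (a b : Fin m) : M a b ∈ compactIdeal H := by
  rw [← hS.compress_opOfMatrix M]
  exact (compactIdeal H).mul_mem_right _ ((compactIdeal H).mul_mem_left _ h)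

end IsCuntzFamily

/-- A sequence of matrices with uniformly bounded entries. -/
def EntryBdd {m : ℕ} (α : ℕ → Matrix (Fin m) (Fin m) ℂ) : Prop :=
  ∃ C : ℝ, ∀ i a b, ‖α i a b‖ ≤ C

theorem EntryBdd.mul {m : ℕ} {α β : ℕ → Matrix (Fin m) (Fin m) ℂ} (hα : EntryBdd α)
    (hβ : EntryBdd β) : EntryBdd fun i => α i * β i := by
  obtain ⟨C, hC⟩ := hα
  obtain ⟨C', hC'⟩ := hβ
  refine ⟨∑ _c : Fin m, C * C', fun i a b => ?_⟩
  change ‖(α i * β i) a b‖ ≤ _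
  rw [Matrix.mul_apply]
  refine (norm_sum_le _ _).trans (Finset.sum_le_sum fun c _ => ?_)
  rw [norm_mul]
  exact mul_le_mul (hC i a c) (hC' i c b) (norm_nonneg _) ((norm_nonneg _).trans (hC i a c))

theorem EntryBdd.star {m : ℕ} {α : ℕ → Matrix (Fin m) (Fin m) ℂ} (hα : EntryBdd α) :
    EntryBdd fun i => star (α i) := by
  obtain ⟨C, hC⟩ := hα
  refine ⟨C, fun i a b => ?_⟩
  change ‖(Star.star (α i)) a b‖ ≤ C
  rw [Matrix.star_apply, norm_star]
  exact hC i b a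

theorem EntryBdd.sub {m : ℕ} {α β : ℕ → Matrix (Fin m) (Fin m) ℂ} (hα : EntryBdd α)
    (hβ : EntryBdd β) : EntryBdd fun i => α i - β i := by
  obtain ⟨C, hC⟩ := hα
  obtain ⟨C', hC'⟩ := hβ
  exact ⟨C + C', fun i a b => (norm_sub_le _ _).trans (add_le_add (hC i a b) (hC' i a b))⟩

theorem entryBdd_of_mem_unitary {m : ℕ} {α : ℕ → Matrix (Fin m) (Fin m) ℂ}
    (hα : ∀ i, α i ∈ unitary (Matrix (Fin m) (Fin m) ℂ)) : EntryBdd α :=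
  ⟨1, fun i a b => entry_norm_bound_of_unitary (hα i) a b⟩

theorem entryBdd_one {m : ℕ} : EntryBdd fun _ => (1 : Matrix (Fin m) (Fin m) ℂ) :=
  entryBdd_of_mem_unitary fun _ => one_mem _

/-- The block diagonal operator with blocks `α i`. -/
noncomputable def matOp (ξ : HilbertBasis ℕ ℂ H) {m : ℕ} (S : Fin m → H →L[ℂ] H)
    (α : ℕ → Matrix (Fin m) (Fin m) ℂ) : H →L[ℂ] H :=
  opOfMatrix S fun a b => diagOp ξ fun i => α i a b

variable (ξ : HilbertBasis ℕ ℂ H) {m : ℕ} {S : Fin m → H →L[ℂ] H} (hS : IsCuntzFamily S)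
  {α β : ℕ → Matrix (Fin m) (Fin m) ℂ}

theorem matOp_sub (S : Fin m → H →L[ℂ] H) (hα : EntryBdd α) (hβ : EntryBdd β) :
    matOp ξ S α - matOp ξ S β = matOp ξ S fun i => α i - β i := by
  obtain ⟨C'', hC''⟩ := hα.sub hβ
  obtain ⟨C, hC⟩ := hα
  obtain ⟨C', hC'⟩ := hβ
  rw [matOp, matOp, opOfMatrix_sub]
  unfold matOp
  congr 1
  funext a b
  refine ξ.clm_ext fun i => ?_
  rw [sub_apply, diagOp_apply ξ (fun i => hC i a b), diagOp_apply ξ (fun i => hC' i a b),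
    diagOp_apply ξ (fun i => hC'' i a b), ← sub_smul]
  rfl

theorem star_matOp (S : Fin m → H →L[ℂ] H) (hα : EntryBdd α) :
    star (matOp ξ S α) = matOp ξ S fun i => star (α i) := by
  obtain ⟨C, hC⟩ := hα
  rw [matOp, star_opOfMatrix]
  unfold matOp
  congr 1
  funext a b
  rw [star_diagOp ξ (fun i => hC i b a)]
  rfl

theorem matOp_mem_compactIdeal (S : Fin m → H →L[ℂ] H) (h : Tendsto α atTop (𝓝 0)) :
    matOp ξ S α ∈ compactIdeal H :=
  opOfMatrix_mem_compactIdeal S fun a b => diagOp_mem_compactIdeal ξ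
    (tendsto_pi_nhds.1 (tendsto_pi_nhds.1 h a) b)

include hS

theorem matOp_mul (hα : EntryBdd α) (hβ : EntryBdd β) :
    matOp ξ S α * matOp ξ S β = matOp ξ S fun i => α i * β i := by
  obtain ⟨C'', hC''⟩ := hα.mul hβ
  obtain ⟨C, hC⟩ := hα
  obtain ⟨C', hC'⟩ := hβ
  rw [matOp, matOp, hS.opOfMatrix_mul]
  unfold matOp
  congr 1
  funext a b
  refine ξ.clm_ext fun i => ?_
  rw [diagOp_apply ξ (fun i => hC'' i a b), sum_apply]
  change _ = (α i * β i) a b • ξ i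
  rw [Matrix.mul_apply, Finset.sum_smul]
  refine Finset.sum_congr rfl fun c _ => ?_
  rw [mul_apply_eq_comp, diagOp_apply ξ (fun i => hC' i c b), map_smul,
    diagOp_apply ξ (fun i => hC i a c), smul_smul, mul_comm]

theorem matOp_one : matOp ξ S (fun _ => 1) = 1 := by
  rw [← hS.opOfMatrix_compress 1]
  unfold matOp
  congr 1
  funext a b
  rw [diagOp_const, mul_one, hS.star_mul, Matrix.one_apply]
  split_ifs <;> simp

theorem tendsto_of_matOp_mem_compactIdeal (hα : EntryBdd α) (h : matOp ξ S α ∈ compactIdeal H) :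
    Tendsto α atTop (𝓝 0) := by
  obtain ⟨C, hC⟩ := hα
  refine tendsto_pi_nhds.2 fun a => tendsto_pi_nhds.2 fun b => ?_
  exact tendsto_of_diagOp_mem_compactIdeal ξ (fun i => hC i a b)
    (hS.mem_compactIdeal_of_opOfMatrix h a b)

theorem star_matOp_mul_self (hα : ∀ i, α i ∈ unitary (Matrix (Fin m) (Fin m) ℂ)) :
    star (matOp ξ S α) * matOp ξ S α = 1 := by
  have hb := entryBdd_of_mem_unitary hα
  rw [star_matOp ξ S hb, matOp_mul ξ hS hb.star hb, ← matOp_one ξ hS]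
  simp only [fun i => Unitary.star_mul_self_of_mem (hα i)]

theorem matOp_mul_star_self (hα : ∀ i, α i ∈ unitary (Matrix (Fin m) (Fin m) ℂ)) :
    matOp ξ S α * star (matOp ξ S α) = 1 := by
  have hb := entryBdd_of_mem_unitary hα
  rw [star_matOp ξ S hb, matOp_mul ξ hS hb hb.star, ← matOp_one ξ hS]
  simp only [fun i => Unitary.mul_star_self_of_mem (hα i)]

theorem matOp_mem_unitary (hα : ∀ i, α i ∈ unitary (Matrix (Fin m) (Fin m) ℂ)) :
    matOp ξ S α ∈ unitary (H →L[ℂ] H) :=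
  Unitary.mem_iff.2 ⟨star_matOp_mul_self ξ hS hα, matOp_mul_star_self ξ hS hα⟩

end MatOp

/-! ### The unitary group of the matrices -/

section UnitaryGroup

open Filter Topology
open scoped Matrix.Norms.L2Operator

/-- Together with its right-hand counterpart and compactness below, this makes U(m) a compact group
with bi-invariant metric, as the uniformization requires. -/
instance unitary_isIsometricSMul_left {A : Type*} [NormedRing A] [StarRing A] [CStarRing A] :
    IsIsometricSMul (unitary A) (unitary A) :=
  ⟨fun u => Isometry.of_dist_eq fun x y => by
    rw [Subtype.dist_eq, Subtype.dist_eq, dist_eq_norm, dist_eq_norm]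
    change ‖(u : A) * x - (u : A) * y‖ = _
    rw [← mul_sub, CStarRing.norm_coe_unitary_mul]⟩

instance unitary_isIsometricSMul_right {A : Type*} [NormedRing A] [StarRing A] [CStarRing A] :
    IsIsometricSMul (unitary A)ᵐᵒᵖ (unitary A) :=
  ⟨fun u => Isometry.of_dist_eq fun x y => by
    rw [Subtype.dist_eq, Subtype.dist_eq, dist_eq_norm, dist_eq_norm]
    change ‖(x : A) * (u.unop : A) - (y : A) * (u.unop : A)‖ = _
    rw [← sub_mul, CStarRing.norm_mul_coe_unitary]⟩

theorem isCompact_unitary_matrix (m : ℕ) :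
    IsCompact (unitary (Matrix (Fin m) (Fin m) ℂ) : Set (Matrix (Fin m) (Fin m) ℂ)) := by
  have : ProperSpace (Matrix (Fin m) (Fin m) ℂ) := FiniteDimensional.proper ℂ _
  refine Metric.isCompact_of_isClosed_isBounded ?_ ?_
  · have : (unitary (Matrix (Fin m) (Fin m) ℂ) : Set (Matrix (Fin m) (Fin m) ℂ)) =
        {A | star A * A = 1} ∩ {A | A * star A = 1} := by
      ext A; exact Unitary.mem_iff
    rw [this]
    exact (isClosed_eq (by fun_prop) continuous_const).inter
      (isClosed_eq (by fun_prop) continuous_const)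
  · refine (Metric.isBounded_closedBall (x := 0) (r := 1)).subset fun A hA => ?_
    rw [mem_closedBall_zero_iff]
    rcases subsingleton_or_nontrivial (Matrix (Fin m) (Fin m) ℂ) with h | h
    · rw [Subsingleton.elim A 0, norm_zero]; norm_num
    · exact (CStarRing.norm_of_mem_unitary hA).le

instance compactSpace_unitary_matrix (m : ℕ) :
    CompactSpace (unitary (Matrix (Fin m) (Fin m) ℂ)) :=
  isCompact_iff_compactSpace.1 (isCompact_unitary_matrix m)

/-- Asymptotically unitary matrices are close to unitary matrices. -/
theorem exists_unitary_tendsto {m : ℕ} {A : ℕ → Matrix (Fin m) (Fin m) ℂ} (hA : EntryBdd A)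
    (h : Tendsto (fun i => star (A i) * A i) atTop (𝓝 1)) :
    ∃ α : ℕ → unitary (Matrix (Fin m) (Fin m) ℂ),
      Tendsto (fun i => A i - (α i : Matrix (Fin m) (Fin m) ℂ)) atTop (𝓝 0) := by
  let U : Set (Matrix (Fin m) (Fin m) ℂ) := unitary (Matrix (Fin m) (Fin m) ℂ)
  have hne : U.Nonempty := ⟨1, one_mem (unitary _)⟩
  -- Take a nearest unitary. Subsequential limits B of the bounded sequence A satisfy B* B = 1, so
  -- in finite dimension they are unitary, and the distances tend to zero.
  choose α hαU hα using fun i => (isCompact_unitary_matrix m).exists_infDist_eq_dist hne (A i)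
  refine ⟨fun i => ⟨α i, hαU i⟩, ?_⟩
  rw [tendsto_zero_iff_norm_tendsto_zero]
  have key : Tendsto (fun i => Metric.infDist (A i) U) atTop (𝓝 0) := by
    refine tendsto_of_subseq_tendsto fun ns hns => ?_
    obtain ⟨C, hC⟩ := hA
    have hcpt : IsCompact (Set.pi Set.univ fun _ : Fin m => Set.pi Set.univ fun _ : Fin m =>
        Metric.closedBall (0 : ℂ) C) :=
      isCompact_univ_pi fun _ => isCompact_univ_pi fun _ => isCompact_closedBall _ _
    obtain ⟨(B : Matrix (Fin m) (Fin m) ℂ), -, ms, hms, hB⟩ := hcpt.tendsto_subseq (x := fun n a b => A (ns n) a b)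
      fun n a _ b _ => mem_closedBall_zero_iff.2 (hC (ns n) a b)
    refine ⟨ms, ?_⟩
    have hB' : Tendsto (fun n => A (ns (ms n))) atTop (𝓝 B) := hB
    have h1 : Tendsto (fun n => star (A (ns (ms n))) * A (ns (ms n))) atTop (𝓝 (star B * B)) :=
      ((continuous_star.tendsto _).comp hB').mul hB'
    have h2 := tendsto_nhds_unique h1 ((h.comp hns).comp hms.tendsto_atTop)
    have hBU : B ∈ U := Unitary.mem_iff.2 ⟨h2, mul_eq_one_comm.1 h2⟩
    have h3 := ((Metric.continuous_infDist_pt U).tendsto B).comp hB'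
    rw [Metric.infDist_zero_of_mem hBU] at h3
    exact h3
  refine key.congr fun i => ?_
  rw [hα i, dist_eq_norm]

end UnitaryGroup

/-! ### Local implementation by block diagonal unitaries -/

section LocalUnitaries

open Filter Topology InnerProductSpace

set_option linter.unusedSectionVars false

variable {H : Type*} [NormedAddCommGroup H] [InnerProductSpace ℂ H] [CompleteSpace H]
  (ξ : HilbertBasis ℕ ℂ H) {m : ℕ} {S : Fin m → H →L[ℂ] H} (hS : IsCuntzFamily S)

include hS

/-- A unitary of the Calkin algebra which commutes with the amplified diagonal operators is
represented by a block diagonal unitary. -/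
theorem exists_eq_q_matOp {u : Calkin H} (hu : u ∈ unitary (Calkin H))
    (hc : ∀ s, IsSign s → u * Calkin.q H (ampl S (diagOp ξ s)) =
      Calkin.q H (ampl S (diagOp ξ s)) * u) :
    ∃ α : ℕ → unitary (Matrix (Fin m) (Fin m) ℂ), u = Calkin.q H (matOp ξ S fun i => α i) := by
  obtain ⟨U, rfl⟩ := q_surjective u
  -- Compressing the relation by S a and S b: every entry of U essentially commutes with the sign
  -- operators, hence is diagonal modulo compacts.
  have hM : ∀ a b, ∀ s, IsSign s → star (S a) * U * S b * diagOp ξ s -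
      diagOp ξ s * (star (S a) * U * S b) ∈ compactIdeal H := by
    intro a b s hs
    have h1 := hc s hs
    rw [← map_mul, ← map_mul, q_eq_q_iff] at h1
    have h2 : star (S a) * U * S b * diagOp ξ s - diagOp ξ s * (star (S a) * U * S b) =
        star (S a) * (U * ampl S (diagOp ξ s) - ampl S (diagOp ξ s) * U) * S b := by
      rw [mul_sub, sub_mul, ← mul_assoc (star (S a)) (ampl S (diagOp ξ s)), hS.star_mul_ampl]
      simp only [mul_assoc, hS.ampl_mul_right]
    rw [h2]
    exact (compactIdeal H).mul_mem_right _ ((compactIdeal H).mul_mem_left _ h1)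
  let A : ℕ → Matrix (Fin m) (Fin m) ℂ := fun i a b => diagEntries ξ (star (S a) * U * S b) i
  have hA : EntryBdd A := by
    refine ⟨∑ a, ∑ b, ‖star (S a) * U * S b‖, fun i a b => ?_⟩
    refine (norm_diagEntries_le ξ _ i).trans ?_
    refine le_trans ?_ (Finset.single_le_sum (f := fun a => ∑ b, ‖star (S a) * U * S b‖)
      (fun _ _ => Finset.sum_nonneg fun _ _ => norm_nonneg _) (Finset.mem_univ a))
    exact Finset.single_le_sum (f := fun b => ‖star (S a) * U * S b‖)
      (fun _ _ => norm_nonneg _) (Finset.mem_univ b)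
  have hUA : Calkin.q H U = Calkin.q H (matOp ξ S A) := by
    rw [q_eq_q_iff]
    nth_rewrite 1 [← hS.opOfMatrix_compress U]
    rw [matOp, opOfMatrix_sub]
    exact opOfMatrix_mem_compactIdeal S fun a b => sub_diagOp_mem_compactIdeal ξ (hM a b)
  have hAA : Tendsto (fun i => star (A i) * A i) atTop (𝓝 1) := by
    have h1 := Unitary.star_mul_self_of_mem hu
    rw [hUA, ← map_star, ← map_mul, ← map_one (Calkin.q H), q_eq_q_iff, star_matOp ξ S hA,
      matOp_mul ξ hS hA.star hA, ← matOp_one ξ hS,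
      matOp_sub ξ S (hA.star.mul hA) entryBdd_one] at h1
    have h2 := tendsto_of_matOp_mem_compactIdeal ξ hS ((hA.star.mul hA).sub entryBdd_one) h1
    exact tendsto_sub_nhds_zero_iff.1 h2
  obtain ⟨α, hα⟩ := exists_unitary_tendsto hA hAA
  refine ⟨α, hUA.trans ?_⟩
  rw [q_eq_q_iff, matOp_sub ξ S hA (entryBdd_of_mem_unitary fun i => (α i).2)]
  exact matOp_mem_compactIdeal ξ S hα

omit hS

/-- The unitaries for E and for the partition into singletons implement the same amplification on
diagonal operators. Their quotient therefore commutes with the amplified diagonals, and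
`exists_eq_q_matOp` applies. -/
theorem exists_local_matOp {φ : Calkin H →⋆ₙₐ[ℂ] Calkin H} (hφ1 : φ 1 = 1)
    (hφ : IsLocallyTrivial ξ φ) :
    ∃ (m : ℕ) (S : Fin m → H →L[ℂ] H), IsCuntzFamily S ∧ ∃ u ∈ unitary (Calkin H),
      ∃ α : IntervalPartition → ℕ → unitary (Matrix (Fin m) (Fin m) ℂ),
      ∀ E, ∀ T ∈ blockAlgebra ξ E, u * φ (Calkin.q H T) * star u =
        Calkin.q H (star (matOp ξ S fun i => α E i) * ampl S T * matOp ξ S fun i => α E i) := by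
  obtain ⟨m, S, hS, hloc⟩ := exists_local_ampl hφ1 hφ
  choose u hu huT using hloc
  set v := u singletonPartition with hv
  have hvv : star v * v = 1 := Unitary.star_mul_self_of_mem (hu _)
  have huu : ∀ E, star (u E) * u E = 1 := fun E => Unitary.star_mul_self_of_mem (hu _)
  have key : ∀ E, ∃ α : ℕ → unitary (Matrix (Fin m) (Fin m) ℂ),
      u E * star v = Calkin.q H (matOp ξ S fun i => α i) := fun E => by
    refine exists_eq_q_matOp ξ hS (mul_mem (hu E) (Unitary.star_mem (hu _))) fun s hs => ?_
    have h1 := huT E _ (diagOp_mem_blockAlgebra ξ E hs.norm_le)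
    have h2 := huT singletonPartition _ (diagOp_mem_blockAlgebra ξ singletonPartition hs.norm_le)
    rw [← hv] at h2
    calc u E * star v * Calkin.q H (ampl S (diagOp ξ s))
        = u E * (star v * v) * φ (Calkin.q H (diagOp ξ s)) * star v := by
          rw [← h2]; simp only [mul_assoc]
      _ = u E * φ (Calkin.q H (diagOp ξ s)) * (star (u E) * u E) * star v := by
          rw [hvv, huu, mul_one, mul_one]
      _ = _ := by rw [← h1]; simp only [mul_assoc]
  choose α hα using key
  refine ⟨m, S, hS, v, hu _, α, fun E T hT => ?_⟩
  rw [map_mul, map_mul, map_star, ← hα, ← huT E T hT, star_mul, star_star]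
  calc v * φ (Calkin.q H T) * star v
      = v * (star (u E) * u E) * φ (Calkin.q H T) * (star (u E) * u E) * star v := by
        rw [huu, mul_one, mul_one]
    _ = _ := by simp only [mul_assoc]

end LocalUnitaries

/-! ### Coherence of the local implementations -/

section Coherence

open Filter Topology InnerProductSpace
open scoped Matrix.Norms.L2Operator

set_option linter.unusedSectionVars false

variable {H : Type*} [NormedAddCommGroup H] [InnerProductSpace ℂ H] [CompleteSpace H]
  (ξ : HilbertBasis ℕ ℂ H) {m : ℕ} {S : Fin m → H →L[ℂ] H} (hS : IsCuntzFamily S)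

include hS

theorem star_matOp_mul_ampl_mul_matOp {α : ℕ → Matrix (Fin m) (Fin m) ℂ} (hα : EntryBdd α)
    (T : H →L[ℂ] H) :
    star (matOp ξ S α) * ampl S T * matOp ξ S α = opOfMatrix S fun a b =>
      ∑ c, diagOp ξ (fun i => star (α i) a c) * (T * diagOp ξ (fun i => α i c b)) := by
  rw [star_matOp ξ S hα, mul_assoc]
  unfold matOp
  rw [hS.ampl_mul_opOfMatrix, hS.opOfMatrix_mul]

/-- When T sends ξ k to ξ (σ k), the (a, b) entry of the conjugated amplification sends ξ k to the
(a, b) coefficient of α(σ k)* α(k) times ξ (σ k). A compact difference tends to zero along the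
basis. -/
theorem tendsto_of_conj_sub_mem {α β : ℕ → Matrix (Fin m) (Fin m) ℂ} (hα : EntryBdd α)
    (hβ : EntryBdd β) {T : H →L[ℂ] H} {σ : ℕ → ℕ} (hT : ∀ k, T (ξ k) = ξ (σ k))
    (h : star (matOp ξ S α) * ampl S T * matOp ξ S α -
      star (matOp ξ S β) * ampl S T * matOp ξ S β ∈ compactIdeal H) :
    Tendsto (fun k => star (α (σ k)) * α k - star (β (σ k)) * β k) atTop (𝓝 0) := by
  rw [star_matOp_mul_ampl_mul_matOp ξ hS hα, star_matOp_mul_ampl_mul_matOp ξ hS hβ,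
    opOfMatrix_sub] at h
  have happ : ∀ {γ : ℕ → Matrix (Fin m) (Fin m) ℂ}, EntryBdd γ → ∀ a b k,
      (∑ c, diagOp ξ (fun i => star (γ i) a c) * (T * diagOp ξ (fun i => γ i c b))) (ξ k) =
        (star (γ (σ k)) * γ k) a b • ξ (σ k) := by
    intro γ hγ a b k
    obtain ⟨C', hC'⟩ := hγ.star
    obtain ⟨C, hC⟩ := hγ
    rw [sum_apply, Matrix.mul_apply, Finset.sum_smul]
    refine Finset.sum_congr rfl fun c _ => ?_
    rw [mul_apply_eq_comp, mul_apply_eq_comp, diagOp_apply ξ (fun i => hC i c b), map_smul,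
      map_smul, hT, diagOp_apply ξ (fun i => hC' i a c), smul_smul, mul_comm]
  refine tendsto_pi_nhds.2 fun a => tendsto_pi_nhds.2 fun b => ?_
  have h1 := tendsto_zero_of_mem_compactIdeal (hS.mem_compactIdeal_of_opOfMatrix h a b)
    ξ.orthonormal
  rw [tendsto_zero_iff_norm_tendsto_zero] at h1
  refine tendsto_zero_iff_norm_tendsto_zero.2 (h1.congr fun k => ?_)
  rw [sub_apply, happ hα, happ hβ, ← sub_smul, norm_smul, ξ.norm_eq_one, mul_one]
  rfl

/-- Families of unitaries implementing the same map on the algebras `D[E]` are coherent. -/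
theorem isBlockCoherent_of_conj {α : IntervalPartition → ℕ → unitary (Matrix (Fin m) (Fin m) ℂ)}
    (h : ∀ E F, ∀ T ∈ blockAlgebra ξ E, T ∈ blockAlgebra ξ F →
      (star (matOp ξ S fun i => α E i) * ampl S T * matOp ξ S fun i => α E i) -
      (star (matOp ξ S fun i => α F i) * ampl S T * matOp ξ S fun i => α F i) ∈ compactIdeal H) :
    IsBlockCoherent α := by
  classical
  intro E F ε hε
  have hBfin : ∀ p : ℕ × ℕ, {i | E.idx i = p.1 ∧ F.idx i = p.2}.Finite := fun p =>
    (Set.finite_Iio (E.endpoint (p.1 + 1))).subset fun i hi => by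
      rw [Set.mem_Iio, ← hi.1]; exact E.lt_endpoint_idx_succ i
  -- In each finite cell common to E and F pick a pair x, y with the largest discrepancy.
  have hmax : ∀ p : ℕ × ℕ, ∃ x y, (∀ k, E.idx k = p.1 → F.idx k = p.2 →
      (E.idx x = p.1 ∧ F.idx x = p.2) ∧ E.idx y = p.1 ∧ F.idx y = p.2) ∧
      ∀ i j, (E.idx i = p.1 ∧ F.idx i = p.2) → (E.idx j = p.1 ∧ F.idx j = p.2) →
        discr (α E) (α F) i j ≤ discr (α E) (α F) x y := by
    intro p
    by_cases hne : ∃ k, E.idx k = p.1 ∧ F.idx k = p.2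
    · obtain ⟨k, hk⟩ := hne
      obtain ⟨⟨x, y⟩, hxy, hm⟩ := ((hBfin p).prod (hBfin p)).exists_maximalFor
        (fun z : ℕ × ℕ => discr (α E) (α F) z.1 z.2) _ ⟨(k, k), hk, hk⟩
      refine ⟨x, y, fun _ _ _ => ⟨hxy.1, hxy.2⟩, fun i j hi hj => ?_⟩
      exact le_of_not_gt fun hlt => absurd (hm (j := (i, j)) ⟨hi, hj⟩ hlt.le) (not_le.2 hlt)
    · exact ⟨0, 0, fun k h1 h2 => absurd ⟨k, h1, h2⟩ hne, fun i _ hi => absurd ⟨i, hi⟩ hne⟩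
  choose x y hxy hm using hmax
  let p : ℕ → ℕ × ℕ := fun k => (E.idx k, F.idx k)
  -- Swap the chosen pair in every cell. The resulting permutation operator lies in both algebras,
  -- and this single test operator controls all pairs.
  let σ : ℕ → ℕ := fun k => Equiv.swap (x (p k)) (y (p k)) k
  have hp : ∀ k, p (x (p k)) = p k ∧ p (y (p k)) = p k := fun k => by
    obtain ⟨h1, h2⟩ := hxy (p k) k rfl rfl
    exact ⟨Prod.ext h1.1 h1.2, Prod.ext h2.1 h2.2⟩
  have hpσ : ∀ k, p (σ k) = p k := fun k => by
    change p (Equiv.swap (x (p k)) (y (p k)) k) = p k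
    rw [Equiv.swap_apply_def]
    split_ifs
    exacts [(hp k).2, (hp k).1, rfl]
  have hσσ : Function.Involutive σ := fun k => by
    change Equiv.swap (x (p (σ k))) (y (p (σ k))) (σ k) = k
    rw [hpσ]
    exact Equiv.swap_apply_self _ _ _
  obtain ⟨T, hT, -⟩ := ξ.exists_clm (z := fun k => ξ (σ k)) (C := 1)
    (fun i j hij => by rw [ξ.inner_eq, if_neg fun h => hij (hσσ.injective h)])
    (fun i => (ξ.norm_eq_one _).le)
  have hTE : T ∈ blockAlgebra ξ E := (mem_blockAlgebra_iff ξ E T).2 fun i j hij => by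
    rw [hT, ξ.inner_eq, if_neg]
    rintro rfl
    exact hij (congrArg Prod.fst (hpσ j))
  have hTF : T ∈ blockAlgebra ξ F := (mem_blockAlgebra_iff ξ F T).2 fun i j hij => by
    rw [hT, ξ.inner_eq, if_neg]
    rintro rfl
    exact hij (congrArg Prod.snd (hpσ j))
  have hlim := tendsto_of_conj_sub_mem ξ hS (entryBdd_of_mem_unitary fun i => (α E i).2)
    (entryBdd_of_mem_unitary fun i => (α F i).2) hT (h E F T hTE hTF)
  rw [tendsto_zero_iff_norm_tendsto_zero] at hlim
  obtain ⟨N, hN⟩ := eventually_atTop.1 (hlim.eventually_lt_const hε)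
  -- Starting after the whole interval of N ensures that the chosen pair in the cell of i also lies
  -- beyond N.
  refine ⟨E.endpoint (E.idx N + 1), fun i j hi hij hE hF => ?_⟩
  refine (hm (p i) i j ⟨rfl, rfl⟩ ⟨hE.symm, hF.symm⟩).trans_lt ?_
  set k := y (p i) with hk
  have hpk : p k = p i := (hp i).2
  have hNk : N ≤ k := by
    by_contra! hlt
    have h1 : E.idx k ≤ E.idx N := E.idx_mono hlt.le
    have h2 : E.idx k = E.idx i := congrArg Prod.fst hpk
    have h3 := E.idx_mono hi
    rw [E.idx_endpoint] at h3
    omega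
  have hσk : σ k = x (p i) := by
    change Equiv.swap (x (p k)) (y (p k)) k = x (p i)
    rw [hpk, hk]
    exact Equiv.swap_apply_right _ _
  have := hN k hNk
  rw [hσk] at this
  rw [discr, Subtype.dist_eq, dist_eq_norm]
  exact this

end Coherence

/-! ### Decomposition of operators -/

section Decomposition

open Filter Topology InnerProductSpace

set_option linter.unusedSectionVars false

variable {H : Type*} [NormedAddCommGroup H] [InnerProductSpace ℂ H] [CompleteSpace H]
  (ξ : HilbertBasis ℕ ℂ H)

theorem norm_mul_basisProj_Iio_le (A : H →L[ℂ] H) (k : ℕ) :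
    ‖A * basisProj ξ (Set.Iio k)‖ ≤ ∑ i ∈ Finset.range k, ‖A (ξ i)‖ := by
  classical
  have h : A * basisProj ξ (Set.Iio k) = ∑ i ∈ Finset.range k, rankOne ℂ (A (ξ i)) (ξ i) := by
    refine ξ.clm_ext fun j => ?_
    rw [mul_apply_eq_comp, basisProj_apply, sum_apply]
    simp only [rankOne_apply, ξ.inner_eq, ite_smul, one_smul, zero_smul, Finset.sum_ite_eq',
      Finset.mem_range, Set.mem_Iio]
    split_ifs <;> simp
  rw [h]
  refine (norm_sum_le _ _).trans (Finset.sum_le_sum fun i _ => ?_)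
  rw [norm_rankOne, ξ.norm_eq_one, mul_one]

/-- After taking adjoints, tail projections converge strongly to zero, hence in norm on the span of
finitely many basis vectors. -/
theorem tendsto_norm_basisProj_Iio_mul (T : H →L[ℂ] H) (k : ℕ) :
    Tendsto (fun n => ‖basisProj ξ (Set.Iio k) * T * basisProj ξ (Set.Ici n)‖) atTop (𝓝 0) := by
  have h1 : ∀ n, ‖basisProj ξ (Set.Iio k) * T * basisProj ξ (Set.Ici n)‖ ≤
      ∑ i ∈ Finset.range k, ‖(basisProj ξ (Set.Ici n) * star T) (ξ i)‖ := fun n => by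
    rw [← norm_star, star_mul, star_mul, star_basisProj, star_basisProj, ← mul_assoc]
    exact norm_mul_basisProj_Iio_le ξ _ k
  refine squeeze_zero (fun _ => norm_nonneg _) h1 ?_
  have h2 : ∀ i, Tendsto (fun n => ‖(basisProj ξ (Set.Ici n) * star T) (ξ i)‖) atTop (𝓝 0) := by
    intro i
    have h3 := (tendsto_basisProj_Iio ξ (star T (ξ i))).const_sub (star T (ξ i))
    rw [sub_self] at h3
    refine (tendsto_zero_iff_norm_tendsto_zero.1 h3).congr fun n => ?_
    rw [← Set.compl_Iio, basisProj_compl, mul_apply_eq_comp, sub_apply, one_apply_eq_self]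
  simpa using tendsto_finsetSum (Finset.range k) fun i _ => h2 i

/-- The part of `T` lying far above the diagonal is compact, if its norms are summable. -/
theorem exists_compact_upper_part {T : H →L[ℂ] H} {E : IntervalPartition}
    (hT : ∀ n, ‖basisProj ξ (Set.Iio (E.endpoint (n + 1))) * T *
      basisProj ξ (Set.Ici (E.endpoint (n + 2)))‖ ≤ (1 / 2) ^ n) :
    ∃ K ∈ compactIdeal H, ∀ i j, ⟪ξ i, K (ξ j)⟫_ℂ =
      if E.idx i + 2 ≤ E.idx j then ⟪ξ i, T (ξ j)⟫_ℂ else 0 := by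
  classical
  -- The far part of the rows in interval n: finite rank, with norms summable by hypothesis.
  let A : ℕ → H →L[ℂ] H := fun n =>
    basisProj ξ (E.block n) * T * basisProj ξ (Set.Ici (E.endpoint (n + 2)))
  have hAn : ∀ n, ‖A n‖ ≤ (1 / 2) ^ n := fun n => by
    refine le_trans ?_ (hT n)
    have : A n = basisProj ξ (E.block n) * (basisProj ξ (Set.Iio (E.endpoint (n + 1))) * T *
      basisProj ξ (Set.Ici (E.endpoint (n + 2)))) := by
      rw [← mul_assoc, ← mul_assoc, basisProj_mul, Set.inter_eq_left.2]
      exact fun i hi => hi.2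
    rw [this]
    refine (norm_mul_le _ _).trans (mul_le_of_le_one_left (norm_nonneg _) ?_)
    refine ContinuousLinearMap.opNorm_le_bound _ zero_le_one fun x => ?_
    rw [one_mul]
    exact norm_basisProj_apply_le ξ _ x
  have hsum : Summable A := Summable.of_norm_bounded
    (summable_geometric_of_lt_one (by norm_num) (by norm_num)) hAn
  refine ⟨∑' n, A n, ?_, fun i j => ?_⟩
  · refine isClosed_compactIdeal.mem_of_tendsto hsum.hasSum (Eventually.of_forall fun s => ?_)
    exact sum_mem fun n _ => (compactIdeal H).mul_mem_right _ ((compactIdeal H).mul_mem_right _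
      (basisProj_mem_compactIdeal ξ (Set.finite_Ico _ _)))
  · have hentry : ∀ n, ⟪ξ i, A n (ξ j)⟫_ℂ =
        if n = E.idx i then (if E.idx i + 2 ≤ E.idx j then ⟪ξ i, T (ξ j)⟫_ℂ else 0) else 0 := by
      intro n
      have h1 : j ∈ Set.Ici (E.endpoint (n + 2)) ↔ n + 2 ≤ E.idx j := by
        rw [Set.mem_Ici]
        constructor
        · intro h
          have := E.idx_mono h
          rwa [E.idx_endpoint] at this
        · exact fun h => (E.strictMono.monotone h).trans (E.endpoint_idx_le j)
      change ⟪ξ i, (basisProj ξ (E.block n) * T *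
        basisProj ξ (Set.Ici (E.endpoint (n + 2)))) (ξ j)⟫_ℂ = _
      rw [mul_apply_eq_comp, mul_apply_eq_comp, ← inner_basisProj, basisProj_apply,
        basisProj_apply]
      simp only [E.mem_block, h1]
      by_cases hn : n = E.idx i
      · subst hn
        by_cases hj : E.idx i + 2 ≤ E.idx j <;> simp [hj]
      · rw [if_neg fun h => hn h.symm, if_neg hn, inner_zero_left]
    clear_value A
    have h0 : HasSum (fun n => A n (ξ j)) ((∑' n, A n) (ξ j)) :=
      (ContinuousLinearMap.apply ℂ H (ξ j)).hasSum hsum.hasSum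
    have h1 : HasSum (fun n => ⟪ξ i, A n (ξ j)⟫_ℂ) ⟪ξ i, (∑' n, A n) (ξ j)⟫_ℂ :=
      (innerSL ℂ (ξ i)).hasSum h0
    simp only [hentry] at h1
    exact h1.unique (hasSum_ite_eq _ _)

/-- Modulo the compact operators, every operator is a sum of two block diagonal operators. -/
theorem exists_add_mem_blockAlgebra (T : H →L[ℂ] H) :
    ∃ E : IntervalPartition, ∃ T₀ ∈ blockAlgebra ξ E.evenPairs, ∃ T₁ ∈ blockAlgebra ξ E.oddPairs,
      T - (T₀ + T₁) ∈ compactIdeal H := by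
  classical
  -- T controls the entries far above the diagonal and star T those far below.
  have hex : ∀ k : ℕ, ∃ N, ∀ n ≥ N,
      ‖basisProj ξ (Set.Iio (k + 1)) * T * basisProj ξ (Set.Ici n)‖ ≤ (1 / 2) ^ k ∧
      ‖basisProj ξ (Set.Iio (k + 1)) * star T * basisProj ξ (Set.Ici n)‖ ≤ (1 / 2) ^ k := by
    intro k
    have hk : (0 : ℝ) < (1 / 2) ^ k := by positivity
    obtain ⟨N, hN⟩ := eventually_atTop.1
      (((tendsto_norm_basisProj_Iio_mul ξ T (k + 1)).eventually_lt_const hk).and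
        ((tendsto_norm_basisProj_Iio_mul ξ (star T) (k + 1)).eventually_lt_const hk))
    exact ⟨N, fun n hn => ⟨(hN n hn).1.le, (hN n hn).2.le⟩⟩
  choose f hf using hex
  obtain ⟨E, hE⟩ := IntervalPartition.exists_lt_endpoint f
  have hstep : ∀ n,
      ‖basisProj ξ (Set.Iio (E.endpoint (n + 1))) * T *
        basisProj ξ (Set.Ici (E.endpoint (n + 2)))‖ ≤ (1 / 2) ^ n ∧
      ‖basisProj ξ (Set.Iio (E.endpoint (n + 1))) * star T *
        basisProj ξ (Set.Ici (E.endpoint (n + 2)))‖ ≤ (1 / 2) ^ n := by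
    intro n
    have h1 : n + 1 ≤ E.endpoint (n + 1) := E.strictMono.id_le _
    -- For the last index k before the endpoint, `Iio (k + 1)` is the initial segment needed, and n
    -- ≤ k makes the bound (1/2)^k strong enough.
    obtain ⟨k, hk⟩ : ∃ k, E.endpoint (n + 1) = k + 1 := ⟨E.endpoint (n + 1) - 1, by omega⟩
    have h2 := hf k (E.endpoint (n + 2)) (hE (n + 1) k (by omega)).le
    rw [← hk] at h2
    have h3 : ((1 : ℝ) / 2) ^ k ≤ (1 / 2) ^ n :=
      pow_le_pow_of_le_one (by norm_num) (by norm_num) (by omega)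
    exact ⟨h2.1.trans h3, h2.2.trans h3⟩
  obtain ⟨K, hK, hKe⟩ := exists_compact_upper_part ξ fun n => (hstep n).1
  obtain ⟨K', hK', hKe'⟩ := exists_compact_upper_part ξ fun n => (hstep n).2
  set R := T - K - star K' with hR
  have hRe : ∀ i j, E.idx i + 2 ≤ E.idx j ∨ E.idx j + 2 ≤ E.idx i → ⟪ξ i, R (ξ j)⟫_ℂ = 0 := by
    intro i j hij
    have h1 : ⟪ξ i, star K' (ξ j)⟫_ℂ =
        if E.idx j + 2 ≤ E.idx i then ⟪ξ i, T (ξ j)⟫_ℂ else 0 := by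
      rw [ContinuousLinearMap.star_eq_adjoint, ContinuousLinearMap.adjoint_inner_right,
        ← inner_conj_symm, hKe', ContinuousLinearMap.star_eq_adjoint,
        ContinuousLinearMap.adjoint_inner_right]
      split_ifs
      · rw [inner_conj_symm]
      · simp
    rw [hR, sub_apply, sub_apply, inner_sub_right, inner_sub_right, hKe, h1]
    rcases hij with h | h
    · rw [if_pos h, if_neg (by omega)]; ring
    · rw [if_neg (by omega), if_pos h]; ring
  -- R is block tridiagonal. The signs are constant on the pairs (2k, 2k + 1) and alternate with k:
  -- entries with equal signs stay inside such a pair, those with opposite signs link intervals 2k +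
  -- 1 and 2k + 2. Half the sum and half the difference with the conjugate separate the two kinds.
  let s : ℕ → ℂ := fun i => if Even (E.idx i / 2) then 1 else -1
  have hs : IsSign s := fun i => by
    change (if Even (E.idx i / 2) then (1 : ℂ) else -1) = 1 ∨
      (if Even (E.idx i / 2) then (1 : ℂ) else -1) = -1
    split_ifs <;> simp
  have hsij : ∀ i j, s i * s j = if Even (E.idx i / 2) ↔ Even (E.idx j / 2) then 1 else -1 := by
    intro i j
    change (if Even (E.idx i / 2) then (1 : ℂ) else -1) *
      (if Even (E.idx j / 2) then (1 : ℂ) else -1) = _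
    by_cases h1 : Even (E.idx i / 2) <;> by_cases h2 : Even (E.idx j / 2) <;> simp [h1, h2]
  set R' := diagOp ξ s * R * diagOp ξ s with hR'
  refine ⟨E, (1 / 2 : ℂ) • (R + R'), ?_, (1 / 2 : ℂ) • (R - R'), ?_, ?_⟩
  · rw [mem_blockAlgebra_iff]
    intro i j hij
    rw [E.idx_evenPairs, E.idx_evenPairs] at hij
    rw [smul_apply, add_apply, inner_smul_right, inner_add_right, hR', inner_diagOp_conj ξ hs,
      hsij]
    split_ifs with h
    · rw [hRe i j]
      · simp
      · by_contra hcon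
        rw [Nat.even_iff, Nat.even_iff] at h
        omega
    · ring
  · rw [mem_blockAlgebra_iff]
    intro i j hij
    rw [E.idx_oddPairs, E.idx_oddPairs] at hij
    rw [smul_apply, sub_apply, inner_smul_right, inner_sub_right, hR', inner_diagOp_conj ξ hs,
      hsij]
    split_ifs with h
    · ring
    · rw [hRe i j]
      · simp
      · by_contra hcon
        rw [Nat.even_iff, Nat.even_iff] at h
        omega
  · have h1 : (1 / 2 : ℂ) • (R + R') + (1 / 2 : ℂ) • (R - R') = R := by
      rw [← smul_add, add_add_sub_cancel, ← two_smul ℂ R, smul_smul]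
      norm_num
    rw [h1, hR]
    have h2 : T - (T - K - star K') = K + star K' := by abel
    rw [h2]
    exact add_mem hK (star_mem_compactIdeal hK')

end Decomposition

/-! ### Uniform implementation -/

section Uniform

open Filter Topology InnerProductSpace
open scoped Matrix.Norms.L2Operator

set_option linter.unusedSectionVars false

variable {H : Type*} [NormedAddCommGroup H] [InnerProductSpace ℂ H] [CompleteSpace H]
  (ξ : HilbertBasis ℕ ℂ H) {m : ℕ} {S : Fin m → H →L[ℂ] H} (hS : IsCuntzFamily S)

theorem diagOp_mul_comm_of_mem_blockAlgebra {E : IntervalPartition} {T : H →L[ℂ] H}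
    (hT : T ∈ blockAlgebra ξ E) {c : ℕ → ℂ} {C : ℝ} (hC : ∀ i, ‖c i‖ ≤ C)
    (hc : ∀ i j, E.idx i = E.idx j → c i = c j) : diagOp ξ c * T = T * diagOp ξ c := by
  have hC' : ∀ i, ‖star (c i)‖ ≤ C := fun i => by rw [norm_star]; exact hC i
  refine ξ.clm_ext_inner fun i j => ?_
  have h1 : star (diagOp ξ fun i => star (c i)) = diagOp ξ c := by
    rw [star_diagOp ξ hC']; simp only [star_star]
  rw [mul_apply_eq_comp, mul_apply_eq_comp, diagOp_apply ξ hC, map_smul, inner_smul_right, ← h1,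
    ContinuousLinearMap.star_eq_adjoint, ContinuousLinearMap.adjoint_inner_right,
    diagOp_apply ξ hC', inner_smul_left]
  by_cases h : E.idx i = E.idx j
  · rw [hc i j h]; simp
  · rw [(mem_blockAlgebra_iff ξ E T).1 hT i j h]; simp

include hS

/-- The entries of a block diagonal operator that is constant along intervals are scalar on each
interval, so they commute with D[E]. -/
theorem ampl_mul_matOp_comm {E : IntervalPartition} {T : H →L[ℂ] H} (hT : T ∈ blockAlgebra ξ E)
    {g : ℕ → Matrix (Fin m) (Fin m) ℂ} (hg : EntryBdd g)
    (hgE : ∀ i j, E.idx i = E.idx j → g i = g j) :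
    ampl S T * matOp ξ S g = matOp ξ S g * ampl S T := by
  obtain ⟨C, hC⟩ := hg
  rw [matOp, hS.ampl_mul_opOfMatrix, hS.opOfMatrix_mul_ampl]
  congr 1
  funext a b
  exact (diagOp_mul_comm_of_mem_blockAlgebra ξ hT (fun i => hC i a b) fun i j h =>
    congrFun (congrFun (hgE i j h) a) b).symm

/-- Unitaries with asymptotically equal increments on the intervals of `E` implement the same map
on the algebra `D[E]`. -/
theorem q_conj_eq_of_discr {α b : ℕ → unitary (Matrix (Fin m) (Fin m) ℂ)} {E : IntervalPartition}
    (h : ∀ ε > 0, ∃ n, ∀ i j, n ≤ i → i ≤ j → E.idx i = E.idx j → discr b α i j < ε)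
    {T : H →L[ℂ] H} (hT : T ∈ blockAlgebra ξ E) :
    Calkin.q H (star (matOp ξ S fun i => α i) * ampl S T * matOp ξ S fun i => α i) =
      Calkin.q H (star (matOp ξ S fun i => b i) * ampl S T * matOp ξ S fun i => b i) := by
  let e : ℕ → ℕ := fun i => E.endpoint (E.idx i)
  -- The correction read off at the left end of each interval. By hypothesis α is asymptotic to g b,
  -- and g is constant on intervals, so it commutes with the amplification of T and cancels in the
  -- conjugation.
  let g : ℕ → unitary (Matrix (Fin m) (Fin m) ℂ) := fun i => α (e i) * (b (e i))⁻¹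
  have hbdd : ∀ γ : ℕ → unitary (Matrix (Fin m) (Fin m) ℂ),
      EntryBdd fun i => (γ i : Matrix (Fin m) (Fin m) ℂ) :=
    fun γ => entryBdd_of_mem_unitary fun i => (γ i).2
  have hlim : Tendsto (fun i => (α i : Matrix (Fin m) (Fin m) ℂ) - (g i * b i : unitary _))
      atTop (𝓝 0) := by
    rw [tendsto_zero_iff_norm_tendsto_zero, Metric.tendsto_atTop]
    intro ε hε
    obtain ⟨n, hn⟩ := h ε hε
    refine ⟨E.endpoint (E.idx n + 1), fun i hi => ?_⟩
    have h1 : E.idx n + 1 ≤ E.idx i := by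
      have := E.idx_mono hi
      rwa [E.idx_endpoint] at this
    have h2 : n ≤ e i := (E.lt_endpoint_idx_succ n).le.trans (E.strictMono.monotone h1)
    have h3 := hn (e i) i h2 (E.endpoint_idx_le i) (E.idx_endpoint _)
    rw [dist_zero_right, norm_norm, ← dist_eq_norm]
    rw [discr_comm, discr, ← dist_mul_left (α (e i)), mul_inv_cancel_left, ← mul_assoc] at h3
    exact h3
  have hq : Calkin.q H (matOp ξ S fun i => α i) = Calkin.q H (matOp ξ S fun i => g i) *
      Calkin.q H (matOp ξ S fun i => b i) := by
    rw [← map_mul, matOp_mul ξ hS (hbdd g) (hbdd b), q_eq_q_iff,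
      matOp_sub ξ S (hbdd α) ((hbdd g).mul (hbdd b))]
    exact matOp_mem_compactIdeal ξ S hlim
  have hcomm := ampl_mul_matOp_comm ξ hS hT (hbdd g) fun i j hij => by
    change ((α (E.endpoint (E.idx i)) * (b (E.endpoint (E.idx i)))⁻¹ :
      unitary (Matrix (Fin m) (Fin m) ℂ)) : Matrix (Fin m) (Fin m) ℂ) =
      (α (E.endpoint (E.idx j)) * (b (E.endpoint (E.idx j)))⁻¹ :
      unitary (Matrix (Fin m) (Fin m) ℂ))
    rw [hij]
  have hg := star_matOp_mul_self ξ hS fun i => (g i).2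
  set B := matOp ξ S fun i => (b i : Matrix (Fin m) (Fin m) ℂ)
  set G := matOp ξ S fun i => (g i : Matrix (Fin m) (Fin m) ℂ)
  have hG : star G * ampl S T * G = ampl S T := by
    rw [mul_assoc, hcomm, ← mul_assoc, hg, one_mul]
  rw [map_mul, map_mul, map_star, hq, star_mul, ← map_star, ← map_star, ← map_mul, ← map_mul,
    ← map_mul, ← map_mul]
  congr 1
  nth_rewrite 2 [← hG]
  simp only [mul_assoc]

omit hS

theorem exists_uniform_matOp (hOCA : OCA) {φ : Calkin H →⋆ₙₐ[ℂ] Calkin H} (hφ1 : φ 1 = 1)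
    (hφ : IsLocallyTrivial ξ φ) :
    ∃ (m : ℕ) (S : Fin m → H →L[ℂ] H), IsCuntzFamily S ∧ ∃ v ∈ unitary (Calkin H),
      ∀ T, Calkin.q H (ampl S T) = v * φ (Calkin.q H T) * star v := by
  obtain ⟨m, S, hS, u, hu, α, hα⟩ := exists_local_matOp ξ hφ1 hφ
  have hcoh : IsBlockCoherent α := isBlockCoherent_of_conj ξ hS fun E F T hE hF =>
    q_eq_q_iff.1 ((hα E T hE).symm.trans (hα F T hF))
  obtain ⟨b, hb⟩ := hcoh.exists_uniformization hOCA
  have hB := matOp_mem_unitary ξ hS fun i => (b i).2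
  set B := matOp ξ S fun i => (b i : Matrix (Fin m) (Fin m) ℂ) with hBdef
  have hB1 : B * star B = 1 := Unitary.mul_star_self_of_mem hB
  have hB2 : star B * B = 1 := Unitary.star_mul_self_of_mem hB
  have hloc : ∀ E, ∀ T ∈ blockAlgebra ξ E,
      u * φ (Calkin.q H T) * star u = Calkin.q H (star B * ampl S T * B) := fun E T hT =>
    (hα E T hT).trans (q_conj_eq_of_discr ξ hS (hb E) hT)
  -- Both sides are additive in T and vanish on compacts, so the decomposition into two block
  -- diagonal operators suffices.
  have hglob : ∀ T, u * φ (Calkin.q H T) * star u = Calkin.q H (star B * ampl S T * B) := by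
    intro T
    obtain ⟨E, T₀, h₀, T₁, h₁, hK⟩ := exists_add_mem_blockAlgebra ξ T
    have h2 : Calkin.q H T = Calkin.q H T₀ + Calkin.q H T₁ := by
      rw [← map_add]; exact q_eq_q_iff.2 hK
    have h3 : Calkin.q H (ampl S T) = Calkin.q H (ampl S T₀) + Calkin.q H (ampl S T₁) := by
      rw [← map_add, ← ampl_add, q_eq_q_iff, ← ampl_sub]
      exact ampl_mem_compactIdeal S hK
    rw [h2, map_add, mul_add, add_mul, hloc _ _ h₀, hloc _ _ h₁]
    simp only [map_mul, h3, mul_add, add_mul]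
  have hqB : Calkin.q H B ∈ unitary (Calkin H) := Unitary.mem_iff.2
    ⟨by rw [← map_star, ← map_mul, hB2, map_one], by rw [← map_star, ← map_mul, hB1, map_one]⟩
  refine ⟨m, S, hS, Calkin.q H B * u, mul_mem hqB hu, fun T => ?_⟩
  calc Calkin.q H (ampl S T) = Calkin.q H (B * star B * ampl S T * (B * star B)) := by
        rw [hB1, one_mul, mul_one]
    _ = Calkin.q H B * Calkin.q H (star B * ampl S T * B) * star (Calkin.q H B) := by
        rw [← map_star, ← map_mul, ← map_mul]; simp only [mul_assoc]
    _ = _ := by rw [← hglob, star_mul]; simp only [mul_assoc]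

end Uniform

/-! ### The amplification as a strongly continuous endomorphism of B(H). -/

section Amplification

variable {H : Type*} [NormedAddCommGroup H] [InnerProductSpace ℂ H] [CompleteSpace H]

/-- The amplification with respect to a Cuntz family, as an endomorphism of `B(H)`. -/
noncomputable def amplHom {m : ℕ} {S : Fin m → H →L[ℂ] H} (hS : IsCuntzFamily S) :
    (H →L[ℂ] H) →⋆ₙₐ[ℂ] (H →L[ℂ] H) where
  toFun := ampl S
  map_smul' c T := ampl_smul S c T
  map_zero' := ampl_zero S
  map_add' := ampl_add S
  map_mul' := hS.ampl_mul
  map_star' T := (star_ampl S T).symm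

theorem stronglyContinuous_ampl {m : ℕ} (S : Fin m → H →L[ℂ] H) :
    StronglyContinuous (ampl S) := by
  unfold StronglyContinuous
  let _ := strongTopology H
  refine continuous_induced_rng.2 (PointwiseConvergenceCLM.continuous_of_continuous_eval fun x => ?_)
  change Continuous fun T : H →L[ℂ] H => ampl S T x
  simp only [ampl_apply]
  refine continuous_finsetSum _ fun a _ => (S a).continuous.comp ?_
  exact (PointwiseConvergenceCLM.evalCLM (RingHom.id ℂ) H (star (S a) x)).continuous.comp
    continuous_induced_dom

end Amplification

theorem theorem4p1 {H : Type*} [NormedAddCommGroup H] [InnerProductSpace ℂ H] [CompleteSpace H]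
    (ξ : HilbertBasis ℕ ℂ H) (hOCA : OCA)
    (φ : Calkin H →⋆ₙₐ[ℂ] Calkin H) (hunital : φ 1 = 1) (hloc : IsLocallyTrivial ξ φ) :
    IsTrivialEnd φ := by
  obtain ⟨m, S, hS, v, hv, h⟩ := exists_uniform_matOp ξ hOCA hunital hloc
  exact ⟨v, hv, amplHom hS, stronglyContinuous_ampl S, h⟩
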